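/- **Setting.** Let $R$ be a commutative ring with $1$, let $q\in R$ be invertible, let $r\ge 1$ and $n\ge 0$ be integers and let $\mathbf Q=(Q_1,\dots,Q_r)\in R^r$. For an integer $m\ge 0$ and a finite (possibly empty) sequence $\mathbf P=(P_1,\dots,P_k)$ of elements of $R$, the Ariki–Koike algebra $\mathcal H_{q,\mathbf P}(m)$ is the associative unital $R$-algebra with generators $T_0,T_1,\dots,T_{m-1}$ and relations $$(T_0-P_1)\cdots(T_0-P_k)=0 \text{ (if } m\ge 1),\qquad T_0T_1T_0T_1=T_1T_0T_1T_0 \text{ (if } m\ge 2),$$ $$(T_i+1)(T_i-q)=0\ (1\le i\le m-1),\quad T_{i+1}T_iT_{i+1}=T_iT_{i+1}T_i\ (1\le i\le m-2),\quad T_iT_j=T_jT_i\ (0\le i<j-1\le m-2).$$ (So $\mathcal H_{q,\mathbf P}(0)=R$, and $\mathcal H_{q,\emptyset}(m)=0$ for $m\ge 1$.) Write $\mathcal H=\mathcal H_{q,\mathbf Q}(n)$ and let $L_1=T_0$ and $L_{i+1}=q^{-1}T_iL_iT_i$ for $1\le i<n$. Fix an integer $s$ with $1\le s\le r$. For $0\le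 b\le n$ put $$u_{n-b}^-=\prod_{t=1}^{s}(L_1-Q_t)\cdots(L_{n-b}-Q_t),\qquad u_b^+=\prod_{t=s+1}^{r}(L_1-Q_t)\cdots(L_b-Q_t),$$ $$v_b=u_{n-b}^-\,T_{w_{n-b,b}}\,u_b^+,\qquad V^b=v_b\mathcal H .$$ Here $w_{n-b,b}$ is the permutation of $\{1,\dots,n\}$ with $i\mapsto i+b$ for $1\le i\le n-b$ and $n-b+i\mapsto i$ for $1\le i\le b$, permutations act from the right, and $T_w=T_{i_1}\cdots T_{i_k}$ for a reduced expression $w=s_{i_1}\cdots s_{i_k}$ in the simple transpositions $s_i=(i,i+1)$. Put $$\mathcal H_b\otimes\mathcal H_{n-b}=\mathcal H_{q,(Q_1,\dots,Q_s)}(b)\otimes_R\mathcal H_{q,(Q_{s+1},\dots,Q_r)}(n-b).$$ **Theorem.** Suppose that $$f_s(q,\mathbf Q)=\prod_{1\le i\le s<j\le r}\ \prod_{-n<a<n}(q^aQ_i-Q_j)$$ is invertible in $R$. (i) For $0\le b\le n$ the right ideal $V^b$ is a faithful left $\mathcal H_b\otimes\mathcal H_{n-b}$-module, where the action is by right $\mathcal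 H$-module endomorphisms and is given as follows: $T_0\otimes 1$ acts as left multiplication by $L_{n-b+1}$ and $T_i\otimes 1$ as left multiplication by $T_{n-b+i}$ for $1\le i<b$; $1\otimes T_0$ acts as left multiplication by $L_1$ and $1\otimes T_j$ as left multiplication by $T_j$ for $1\le j<n-b$. (The conditions on $T_0\otimes 1$ and $1\otimes T_0$ are present only when $b\ge 1$ and $n-b\ge 1$, respectively.) (ii) For $0\le b\le n$ this action gives an isomorphism of $R$-algebras $\mathcal H_b\otimes\mathcal H_{n-b}\cong\operatorname{End}_{\mathcal H}(V^b)$, the endomorphism ring of the right $\mathcal H$-module $V^b$. (iii) $\mathcal H$ is Morita equivalent, as an $R$-algebra (that is, through an $R$-linear equivalence of module categories), to the direct sum of algebras $\bigoplus_{b=0}^n\mathcal H_b\otimes\mathcal H_{n-b}$. -/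

import Mathlib

open scoped TensorProduct

universe u

/-- The defining relations of the Ariki–Koike algebra on the free algebra with generators
`T_0, …, T_{n-1}`. The parameters `Q_1, …, Q_r` are indexed by `Fin r`. -/
inductive ArikiKoikeRel {R : Type u} [CommRing R] (q : Rˣ) {r : ℕ} (Q : Fin r → R) (n : ℕ) :
    FreeAlgebra R (Fin n) → FreeAlgebra R (Fin n) → Prop
  /-- `(T_0 - Q_1) ⋯ (T_0 - Q_r) = 0`; present only if there is a generator `T_0`. -/
  | cyclotomic (h : 0 < n) :
      ArikiKoikeRel q Q n
        (List.ofFn fun t : Fin r =>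
          FreeAlgebra.ι R (⟨0, h⟩ : Fin n) - algebraMap R (FreeAlgebra R (Fin n)) (Q t)).prod
        0
  /-- `T_0 T_1 T_0 T_1 = T_1 T_0 T_1 T_0` -/
  | braidZero (i j : Fin n) (hi : i.val = 0) (hj : j.val = 1) :
      ArikiKoikeRel q Q n
        (FreeAlgebra.ι R i * FreeAlgebra.ι R j * FreeAlgebra.ι R i * FreeAlgebra.ι R j)
        (FreeAlgebra.ι R j * FreeAlgebra.ι R i * FreeAlgebra.ι R j * FreeAlgebra.ι R i)
  /-- `(T_i + 1)(T_i - q) = 0` for `1 ≤ i ≤ n - 1` -/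
  | quadratic (i : Fin n) (hi : 1 ≤ i.val) :
      ArikiKoikeRel q Q n
        ((FreeAlgebra.ι R i + 1) *
          (FreeAlgebra.ι R i - algebraMap R (FreeAlgebra R (Fin n)) (q : R)))
        0
  /-- `T_{i+1} T_i T_{i+1} = T_i T_{i+1} T_i` for `1 ≤ i ≤ n - 2` -/
  | braid (i j : Fin n) (hi : 1 ≤ i.val) (hj : j.val = i.val + 1) :
      ArikiKoikeRel q Q n
        (FreeAlgebra.ι R j * FreeAlgebra.ι R i * FreeAlgebra.ι R j)
        (FreeAlgebra.ι R i * FreeAlgebra.ι R j * FreeAlgebra.ι R i)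
  /-- `T_i T_j = T_j T_i` for `0 ≤ i < j - 1 ≤ n - 2` -/
  | comm (i j : Fin n) (hij : i.val + 1 < j.val) :
      ArikiKoikeRel q Q n
        (FreeAlgebra.ι R i * FreeAlgebra.ι R j)
        (FreeAlgebra.ι R j * FreeAlgebra.ι R i)

/-- The Ariki–Koike algebra `H_{q,Q}(n)` over `R`, given by generators and relations. -/
def ArikiKoike {R : Type u} [CommRing R] (q : Rˣ) {r : ℕ} (Q : Fin r → R) (n : ℕ) : Type u :=
  RingQuot (ArikiKoikeRel q Q n)

namespace ArikiKoike

noncomputable instance instRing {R : Type u} [CommRing R] (q : Rˣ) {r : ℕ} (Q : Fin r → R)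
    (n : ℕ) : Ring (ArikiKoike q Q n) :=
  inferInstanceAs (Ring (RingQuot (ArikiKoikeRel q Q n)))

noncomputable instance instAlgebra {R : Type u} [CommRing R] (q : Rˣ) {r : ℕ} (Q : Fin r → R)
    (n : ℕ) : Algebra R (ArikiKoike q Q n) :=
  inferInstanceAs (Algebra R (RingQuot (ArikiKoikeRel q Q n)))

/-- The generator `T_i`, for `0 ≤ i < n`. (The value for `i ≥ n` is irrelevant.) -/
noncomputable def T {R : Type u} [CommRing R] (q : Rˣ) {r : ℕ} (Q : Fin r → R) (n : ℕ)
    (i : ℕ) : ArikiKoike q Q n :=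
  if h : i < n then
    RingQuot.mkAlgHom R (ArikiKoikeRel q Q n) (FreeAlgebra.ι R (⟨i, h⟩ : Fin n))
  else 0

/-- The Jucys–Murphy elements, indexed from zero: `jm k` is `L_{k+1}`, so that `L_1 = T_0` and
`L_{i+1} = q⁻¹ T_i L_i T_i`, for `0 ≤ k < n`. -/
noncomputable def jm {R : Type u} [CommRing R] (q : Rˣ) {r : ℕ} (Q : Fin r → R) (n : ℕ) :
    ℕ → ArikiKoike q Q n
  | 0 => T q Q n 0
  | k + 1 => ((q⁻¹ : Rˣ) : R) • (T q Q n (k + 1) * jm q Q n k * T q Q n (k + 1))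

/-- For a list of scalars `c_1, …, c_p`, the product `∏_t (L_1 - c_t)(L_2 - c_t) ⋯ (L_m - c_t)`
in the algebra `H_{q,Q}(n)`. -/
noncomputable def jmProd {R : Type u} [CommRing R] (q : Rˣ) {r : ℕ} (Q : Fin r → R) (n : ℕ)
    (c : List R) (m : ℕ) : ArikiKoike q Q n :=
  (c.map fun x =>
    ((List.range m).map fun k => jm q Q n k - algebraMap R (ArikiKoike q Q n) x).prod).prod

end ArikiKoike

/-! ### The permutation `w_{a,b}` and a reduced expression for it

Permutations act from the right, and a word `i_1 ⋯ i_k` stands for the permutation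
`s_{i_1} ⋯ s_{i_k}`, which applies `s_{i_1}` first; here `s_i = (i, i+1)`. -/

/-- The permutation `s_{i_1} s_{i_2} ⋯ s_{i_k}` (acting from the right) of a word
`[i_1, …, i_k]`. -/
def wordPerm : List ℕ → Equiv.Perm ℕ
  | [] => 1
  | i :: l => wordPerm l * Equiv.swap i (i + 1)

/-- The word `s_{a,a+b} s_{a-1,a+b-1} ⋯ s_{1,b+1}`, where `s_{i,j} = s_i s_{i+1} ⋯ s_{j-1}`. -/
def blockWord : ℕ → ℕ → List ℕ
  | 0, _ => []
  | a + 1, b => (List.range b).map (fun j => a + 1 + j) ++ blockWord a b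

theorem wordPerm_append (l m : List ℕ) : wordPerm (l ++ m) = wordPerm m * wordPerm l := by
  induction l with
  | nil => simp [wordPerm]
  | cons i l ih => simp [wordPerm, ih, mul_assoc]

theorem wordPerm_row (a b x : ℕ) :
    wordPerm ((List.range b).map (fun j => a + 1 + j)) x =
      if x = a + 1 then a + 1 + b
      else if a + 1 < x ∧ x ≤ a + 1 + b then x - 1 else x := by
  induction b with
  | zero =>
    simp only [List.range_zero, List.map_nil, wordPerm, Equiv.Perm.one_apply]
    split_ifs <;> omega
  | succ b ih =>
    rw [List.range_succ, List.map_append, wordPerm_append, Equiv.Perm.mul_apply, ih]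
    simp only [List.map_cons, List.map_nil, wordPerm, one_mul, Equiv.swap_apply_def]
    split_ifs <;> omega

/-- The word `blockWord a b` represents `w_{a,b}`, the permutation which sends `1, …, a` to
`b+1, …, a+b` and `a+1, …, a+b` to `1, …, b`. -/
theorem wordPerm_blockWord (a b x : ℕ) :
    wordPerm (blockWord a b) x =
      if 1 ≤ x ∧ x ≤ a then x + b
      else if a < x ∧ x ≤ a + b then x - a else x := by
  induction a generalizing x with
  | zero =>
    simp only [blockWord, wordPerm, Equiv.Perm.one_apply]
    split_ifs <;> omega
  | succ a ih =>
    rw [blockWord, wordPerm_append, Equiv.Perm.mul_apply, wordPerm_row, ih]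
    split_ifs <;> omega

theorem length_blockWord (a b : ℕ) : (blockWord a b).length = a * b := by
  induction a with
  | zero => simp [blockWord]
  | succ a ih => simp [blockWord, ih, Nat.succ_mul, Nat.add_comm]

theorem encard_inversions_le (l : List ℕ) :
    {p : ℕ × ℕ | p.1 < p.2 ∧ wordPerm l p.2 < wordPerm l p.1}.encard ≤ l.length := by
  induction l using List.reverseRecOn with
  | nil =>
    have : {p : ℕ × ℕ | p.1 < p.2 ∧ wordPerm [] p.2 < wordPerm [] p.1} = ∅ := by
      ext p
      simp [wordPerm]
      omega
    rw [this]
    simp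
  | append_singleton l i ih =>
    have hsub : {p : ℕ × ℕ | p.1 < p.2 ∧ wordPerm (l ++ [i]) p.2 < wordPerm (l ++ [i]) p.1} ⊆
        insert ((wordPerm l).symm i, (wordPerm l).symm (i + 1))
          {p : ℕ × ℕ | p.1 < p.2 ∧ wordPerm l p.2 < wordPerm l p.1} := by
      rintro ⟨x, y⟩ ⟨hxy, h⟩
      simp only [wordPerm_append, wordPerm, one_mul, Equiv.Perm.mul_apply] at h hxy
      by_cases hlt : wordPerm l y < wordPerm l x
      · exact Or.inr ⟨hxy, hlt⟩
      · left
        have hne : wordPerm l x ≠ wordPerm l y := fun e =>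
          absurd ((wordPerm l).injective e) (by omega)
        have hx : wordPerm l x = i ∧ wordPerm l y = i + 1 := by
          simp only [Equiv.swap_apply_def] at h
          split_ifs at h <;> omega
        rw [← hx.2, ← hx.1]
        simp
    calc _ ≤ _ := Set.encard_le_encard hsub
      _ ≤ _ := Set.encard_insert_le _ _
      _ ≤ _ := by
        rw [List.length_append, List.length_singleton, Nat.cast_add, Nat.cast_one]
        gcongr

/-- `blockWord a b` is a reduced expression: no shorter word represents the same permutation. -/
theorem blockWord_reduced (a b : ℕ) (l : List ℕ)
    (hl : wordPerm l = wordPerm (blockWord a b)) : (blockWord a b).length ≤ l.length := by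
  have h1 := encard_inversions_le l
  rw [hl] at h1
  have h2 : ((Finset.Ioc 0 a ×ˢ Finset.Ioc a (a + b) : Finset (ℕ × ℕ)) : Set (ℕ × ℕ)) ⊆
      {p : ℕ × ℕ | p.1 < p.2 ∧ wordPerm (blockWord a b) p.2 < wordPerm (blockWord a b) p.1} := by
    rintro ⟨x, y⟩ h
    simp only [Finset.coe_product, Set.mem_prod, Finset.coe_Ioc, Set.mem_Ioc] at h
    simp only [Set.mem_ofPred_eq, wordPerm_blockWord]
    refine ⟨by omega, ?_⟩
    split_ifs <;> omega
  have h3 := (Set.encard_le_encard h2).trans h1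
  rw [Set.encard_coe_eq_coe_finsetCard, Finset.card_product, Nat.card_Ioc, Nat.card_Ioc] at h3
  rw [length_blockWord]
  have h4 : (a - 0) * (a + b - a) ≤ l.length := by exact_mod_cast h3
  simpa using h4

namespace ArikiKoike

/-- The element `T_w` of `H_{q,Q}(n)` for `w = w_{a,b}`, where `a + b ≤ n`: the product
`T_{i_1} ⋯ T_{i_k}` along a reduced expression `s_{i_1} ⋯ s_{i_k}` of `w`. -/
noncomputable def TBlock {R : Type u} [CommRing R] (q : Rˣ) {r : ℕ} (Q : Fin r → R) (n : ℕ)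
    (a b : ℕ) : ArikiKoike q Q n :=
  ((blockWord a b).map (T q Q n)).prod

/-- The first `s` parameters `(Q_1, …, Q_s)`. -/
def firstParams {R : Type u} {r : ℕ} (Q : Fin r → R) {s : ℕ} (hs : s ≤ r) : Fin s → R :=
  fun i => Q (Fin.castLE hs i)

/-- The remaining parameters `(Q_{s+1}, …, Q_r)`. -/
def lastParams {R : Type u} {r : ℕ} (Q : Fin r → R) {s : ℕ} (hs : s ≤ r) : Fin (r - s) → R :=
  fun j => Q ⟨s + j.val, by omega⟩

/-- `f_s(q, Q) = ∏_{1 ≤ i ≤ s < j ≤ r} ∏_{-n < a < n} (q^a Q_i - Q_j)`. -/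
noncomputable def fPoly {R : Type u} [CommRing R] (q : Rˣ) {r : ℕ} (Q : Fin r → R) (n : ℕ) {s : ℕ}
    (hs : s ≤ r) : R :=
  ∏ i : Fin s, ∏ j : Fin (r - s), ∏ a ∈ Finset.Ioo (-(n : ℤ)) (n : ℤ),
    (((q ^ a : Rˣ) : R) * firstParams Q hs i - lastParams Q hs j)

/-- `v_b = u_{n-b}^- T_{w_{n-b,b}} u_b^+`, where
`u_{n-b}^- = ∏_{t=1}^s (L_1 - Q_t) ⋯ (L_{n-b} - Q_t)` and
`u_b^+ = ∏_{t=s+1}^r (L_1 - Q_t) ⋯ (L_b - Q_t)`. -/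
noncomputable def v {R : Type u} [CommRing R] (q : Rˣ) {r : ℕ} (Q : Fin r → R) (n : ℕ) {s : ℕ}
    (hs : s ≤ r) (b : ℕ) : ArikiKoike q Q n :=
  jmProd q Q n (List.ofFn (firstParams Q hs)) (n - b) * TBlock q Q n (n - b) b *
    jmProd q Q n (List.ofFn (lastParams Q hs)) b

/-- The right ideal `V^b = v_b H` of `H = H_{q,Q}(n)`; right `H`-modules are modules over the
opposite ring. -/
noncomputable def V {R : Type u} [CommRing R] (q : Rˣ) {r : ℕ} (Q : Fin r → R) (n : ℕ) {s : ℕ}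
    (hs : s ≤ r) (b : ℕ) : Submodule (ArikiKoike q Q n)ᵐᵒᵖ (ArikiKoike q Q n) :=
  Submodule.span (ArikiKoike q Q n)ᵐᵒᵖ {v q Q n hs b}

/-- The algebra `H_b ⊗ H_{n-b} = H_{q,(Q_1,…,Q_s)}(b) ⊗ H_{q,(Q_{s+1},…,Q_r)}(n-b)`. -/
abbrev TensorAlg {R : Type u} [CommRing R] (q : Rˣ) {r : ℕ} (Q : Fin r → R) (n : ℕ) {s : ℕ}
    (hs : s ≤ r) (b : ℕ) : Type u :=
  ArikiKoike q (firstParams Q hs) b ⊗[R] ArikiKoike q (lastParams Q hs) (n - b)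

/-- The algebra homomorphism `ρ` describes the left action of `H_b ⊗ H_{n-b}` on `V^b` in which
* `T_0 ⊗ 1` acts as left multiplication by `L_{n-b+1}` and `T_i ⊗ 1` as left multiplication by
  `T_{n-b+i}`, for `1 ≤ i < b`;
* `1 ⊗ T_0` acts as left multiplication by `L_1` and `1 ⊗ T_j` as left multiplication by `T_j`,
  for `1 ≤ j < n - b`. -/
structure IsLeftAction {R : Type u} [CommRing R] (q : Rˣ) {r : ℕ} (Q : Fin r → R) (n : ℕ) {s : ℕ}
    (hs : s ≤ r) (b : ℕ)
    (ρ : TensorAlg q Q n hs b →ₐ[R] Module.End (ArikiKoike q Q n)ᵐᵒᵖ (V q Q n hs b)) :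
    Prop where
  left_zero : 0 < b → ∀ x : V q Q n hs b,
    (ρ (T q (firstParams Q hs) b 0 ⊗ₜ[R] 1) x : ArikiKoike q Q n) = jm q Q n (n - b) * x
  left_pos : ∀ i, 1 ≤ i → i < b → ∀ x : V q Q n hs b,
    (ρ (T q (firstParams Q hs) b i ⊗ₜ[R] 1) x : ArikiKoike q Q n) = T q Q n (n - b + i) * x
  right_zero : 0 < n - b → ∀ x : V q Q n hs b,
    (ρ (1 ⊗ₜ[R] T q (lastParams Q hs) (n - b) 0) x : ArikiKoike q Q n) = jm q Q n 0 * x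
  right_pos : ∀ j, 1 ≤ j → j < n - b → ∀ x : V q Q n hs b,
    (ρ (1 ⊗ₜ[R] T q (lastParams Q hs) (n - b) j) x : ArikiKoike q Q n) = T q Q n j * x

end ArikiKoike

/-!
The parameters are split into two families, with the letter `true` for `Q_1, …, Q_s` and the letter
`false` for `Q_{s+1}, …, Q_r`. The Jucys–Murphy element `L_{k+1}` is annihilated by an explicit
polynomial with the roots `q^a Q_t`, where `|a| ≤ k` (`aeval_jm_annPoly`). When `f_s(q, Q)` is
invertible, the polynomials of the two families are coprime (`isCoprime_annPoly`), and Bezout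
polynomials in the Jucys–Murphy elements split `1` into idempotents `idem`, one for each word of
length `n` in the two letters. If two adjacent letters are equal, the Hecke generator preserves the
idempotent (`idem_mul_T_mul_idem`). If they are distinct, the intertwiner `twine` exchanges them,
and at a descent its square is invertible on the idempotent (`exists_mul_twine_sq`). Hence the
idempotents `e_b` of the base words `false, …, false, true, …, true`, with `b` letters `true`,
generate the unit ideal (`one_mem_span_idem`).

The main point is that `e_b H e_b` is `H_b ⊗ H_{n-b}`. Since the elements `L_{n-b+1}`, `T_{n-b+i}`,
`L_1`, `T_j` preserve `e_b H` and satisfy the relations of the two factors there, one gets a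
multiplicative map `cornerMap` from `H_b ⊗ H_{n-b}` to `e_b H e_b`. Its bijectivity is proved
without a basis theorem for `H`. Namely, `H` acts on the functions on words with `b` letters `true`
with values in `H_b ⊗ H_{n-b}`, by the formulas which describe the action of `H` on `H e_b` in terms
of the intertwiners (`TwoColor.exists_rep`). In this representation `cornerMap x` multiplies the
component of the base word by `x`, so that `cornerMap` is injective (`cornerMap_injective`).
Conversely, the components of the representation are realised by elements `Corner.col` of `H` with
the same transformation rule (`Corner.T_mul_col`). So `h e_b` is determined by the action of `h` on
the representation (`Corner.mul_map_one`), which gives surjectivity onto the corner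
(`exists_cornerMap_eq`), the vanishing of `e_c H e_b` for `b ≠ c` (`idem_mul_mul_idem_eq_zero`), and
the fact that the representations for `b = 0, …, n` are jointly faithful (`eq_of_rep_eq`).

By faithfulness, the equality `V^b = e_b H` can be tested in the representations (`V_eq`): there
`v_b` maps into the component of the base word, and it maps the component of the word `true, …,
true, false, …, false` onto it, because the leading coefficient of `T_w` between the two is a
product of units. So `H_b ⊗ H_{n-b}`, which is `e_b H e_b`, is the endomorphism ring of `V^b`
(`leftAction_bijective`). Finally, the sum of the `e_b` is a full idempotent whose corner is the
direct sum of the algebras `H_b ⊗ H_{n-b}`, and an algebra is Morita equivalent to its full corners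
(`FullCorner.isMoritaEquivalent`).
-/

namespace ArikiKoike

/-! ### Presentation of the algebra and its Jucys–Murphy elements -/

section Presentation

variable {R : Type u} [CommRing R] (q : Rˣ) {r : ℕ} (Q : Fin r → R) (n : ℕ)

theorem T_of_lt {i : ℕ} (h : i < n) :
    T q Q n i = RingQuot.mkAlgHom R (ArikiKoikeRel q Q n) (FreeAlgebra.ι R (⟨i, h⟩ : Fin n)) :=
  dif_pos h

theorem T_of_le {i : ℕ} (h : n ≤ i) : T q Q n i = 0 :=
  dif_neg (not_lt.2 h)

theorem T_cyclotomic (h : 0 < n) :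
    (List.ofFn fun t : Fin r =>
      T q Q n 0 - algebraMap R (ArikiKoike q Q n) (Q t)).prod = 0 := by
  have := RingQuot.mkAlgHom_rel R (ArikiKoikeRel.cyclotomic (q := q) (Q := Q) h)
  rw [map_zero, map_list_prod, List.map_ofFn] at this
  refine Eq.trans ?_ this
  congr 2
  funext t
  rw [Function.comp_apply, map_sub, AlgHom.commutes, T_of_lt q Q n h]
  rfl

theorem T_braid_zero :
    T q Q n 0 * T q Q n 1 * T q Q n 0 * T q Q n 1 =
      T q Q n 1 * T q Q n 0 * T q Q n 1 * T q Q n 0 := by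
  rcases lt_or_ge 1 n with h | h
  · have := RingQuot.mkAlgHom_rel R
      (ArikiKoikeRel.braidZero (q := q) (Q := Q) ⟨0, by omega⟩ ⟨1, h⟩ rfl rfl)
    simp only [map_mul] at this
    rw [T_of_lt q Q n h, T_of_lt q Q n (show 0 < n by omega)]
    exact this
  · simp [T_of_le q Q n h]

theorem T_sq {i : ℕ} (h1 : 1 ≤ i) (h : i < n) :
    T q Q n i * T q Q n i = ((q : R) - 1) • T q Q n i + (q : R) • 1 := by
  have := RingQuot.mkAlgHom_rel R (ArikiKoikeRel.quadratic (q := q) (Q := Q) ⟨i, h⟩ h1)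
  rw [map_mul, map_add, map_sub, map_one, map_zero, AlgHom.commutes] at this
  have h' : (T q Q n i + 1) * (T q Q n i - algebraMap R (ArikiKoike q Q n) (q : R)) = 0 := by
    rw [T_of_lt q Q n h]
    exact this
  rw [Algebra.algebraMap_eq_smul_one, add_mul, mul_sub, mul_smul_comm, mul_one, one_mul] at h'
  rw [← sub_eq_zero, ← h', sub_smul, one_smul]
  abel

theorem T_braid {i : ℕ} (h1 : 1 ≤ i) :
    T q Q n (i + 1) * T q Q n i * T q Q n (i + 1) =
      T q Q n i * T q Q n (i + 1) * T q Q n i := by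
  rcases lt_or_ge (i + 1) n with h | h
  · have := RingQuot.mkAlgHom_rel R
      (ArikiKoikeRel.braid (q := q) (Q := Q) ⟨i, by omega⟩ ⟨i + 1, h⟩ h1 rfl)
    simp only [map_mul] at this
    rw [T_of_lt q Q n h, T_of_lt q Q n (show i < n by omega)]
    exact this
  · simp [T_of_le q Q n h]

theorem commute_T_T {i j : ℕ} (h : i + 1 < j) : Commute (T q Q n i) (T q Q n j) := by
  rcases lt_or_ge j n with hj | hj
  · have := RingQuot.mkAlgHom_rel R
      (ArikiKoikeRel.comm (q := q) (Q := Q) ⟨i, by omega⟩ ⟨j, hj⟩ h)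
    simp only [map_mul] at this
    rw [T_of_lt q Q n hj, T_of_lt q Q n (show i < n by omega)]
    exact this
  · rw [T_of_le q Q n hj]
    exact Commute.zero_right _

/-- The universal property of the Ariki–Koike algebra. -/
theorem exists_lift {A : Type*} [Ring A] [Algebra R A] (f : ℕ → A)
    (hc : 0 < n → (List.ofFn fun t : Fin r => f 0 - algebraMap R A (Q t)).prod = 0)
    (h0 : 1 < n → f 0 * f 1 * f 0 * f 1 = f 1 * f 0 * f 1 * f 0)
    (hq : ∀ i, 1 ≤ i → i < n → f i * f i = ((q : R) - 1) • f i + (q : R) • 1)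
    (hb : ∀ i, 1 ≤ i → i + 1 < n → f (i + 1) * f i * f (i + 1) = f i * f (i + 1) * f i)
    (hcomm : ∀ i j, i + 1 < j → j < n → f i * f j = f j * f i) :
    ∃ φ : ArikiKoike q Q n →ₐ[R] A, ∀ i < n, φ (T q Q n i) = f i := by
  let F : FreeAlgebra R (Fin n) →ₐ[R] A := FreeAlgebra.lift R fun i => f i.val
  have hF : ∀ ⦃x y : FreeAlgebra R (Fin n)⦄, ArikiKoikeRel q Q n x y → F x = F y := by
    intro x y hxy
    cases hxy with
    | cyclotomic h =>
      rw [map_zero, map_list_prod, List.map_ofFn, ← hc h]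
      congr 2
      funext t
      simp [F, FreeAlgebra.lift_ι_apply, AlgHom.commutes]
    | braidZero i j hi hj =>
      simp only [F, map_mul, FreeAlgebra.lift_ι_apply, hi, hj]
      exact h0 (by omega)
    | quadratic i hi =>
      simp only [F, map_mul, map_add, map_sub, map_one, map_zero, FreeAlgebra.lift_ι_apply,
        AlgHom.commutes]
      rw [Algebra.algebraMap_eq_smul_one, add_mul, mul_sub, mul_smul_comm, mul_one, one_mul,
        hq i hi i.2, sub_smul, one_smul]
      abel
    | braid i j hi hj =>
      simp only [F, map_mul, FreeAlgebra.lift_ι_apply, hj]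
      exact hb i hi (by omega)
    | comm i j hij =>
      simp only [F, map_mul, FreeAlgebra.lift_ι_apply]
      exact hcomm i j hij j.2
  refine ⟨RingQuot.liftAlgHom R ⟨F, hF⟩, fun i hi => ?_⟩
  rw [T_of_lt q Q n hi]
  exact (RingQuot.liftAlgHom_mkAlgHom_apply R F hF _).trans (by simp [F])

theorem adjoin_range_T : Algebra.adjoin R (Set.range (T q Q n)) = ⊤ := by
  rw [eq_top_iff]
  rintro x -
  obtain ⟨y, rfl⟩ := RingQuot.mkAlgHom_surjective R (ArikiKoikeRel q Q n) x
  induction y using FreeAlgebra.induction with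
  | grade0 c =>
    rw [AlgHom.commutes]
    exact Subalgebra.algebraMap_mem _ c
  | grade1 i =>
    refine Algebra.subset_adjoin ⟨i.val, ?_⟩
    exact T_of_lt q Q n i.2
  | mul a b ha hb =>
    rw [map_mul]
    exact Subalgebra.mul_mem _ ha hb
  | add a b ha hb =>
    rw [map_add]
    exact Subalgebra.add_mem _ ha hb

theorem jm_zero : jm q Q n 0 = T q Q n 0 := rfl

theorem jm_succ (k : ℕ) : jm q Q n (k + 1) =
    ((q⁻¹ : Rˣ) : R) • (T q Q n (k + 1) * jm q Q n k * T q Q n (k + 1)) := rfl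

theorem commute_T_jm_of_lt {k j : ℕ} (h : j + 1 < k) : Commute (T q Q n k) (jm q Q n j) := by
  induction j with
  | zero => exact (commute_T_T q Q n h).symm
  | succ j ih =>
    have h1 := (commute_T_T q Q n h).symm
    exact ((h1.mul_right (ih (by omega))).mul_right h1).smul_right _

theorem commute_T_jm_of_gt {k j : ℕ} (hk : 1 ≤ k) (h : k < j) :
    Commute (T q Q n k) (jm q Q n j) := by
  induction j, h using Nat.le_induction with
  | base =>
    obtain ⟨k, rfl⟩ : ∃ l, k = l + 1 := ⟨k - 1, by omega⟩
    rw [jm_succ, jm_succ, mul_smul_comm, smul_mul_assoc]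
    refine Commute.smul_right (Commute.smul_right ?_ _) _
    have hb := T_braid q Q n hk
    have hc : Commute (T q Q n (k + 1 + 1)) (jm q Q n k) :=
      commute_T_jm_of_lt q Q n (by omega)
    generalize T q Q n (k + 1) = a at *
    generalize T q Q n (k + 1 + 1) = b at *
    generalize jm q Q n k = l at *
    calc a * (b * (a * l * a) * b) = (a * b * a) * l * a * b := by simp only [mul_assoc]
      _ = b * a * (b * l) * a * b := by rw [← hb]; simp only [mul_assoc]
      _ = b * a * l * (b * a * b) := by rw [hc.eq]; simp only [mul_assoc]
      _ = b * (a * l * a) * b * a := by rw [hb]; simp only [mul_assoc]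
  | succ j hj ih =>
    have h1 := commute_T_T q Q n (show k + 1 < j + 1 by omega)
    exact ((h1.mul_right ih).mul_right h1).smul_right _

theorem commute_T_zero_jm (j : ℕ) : Commute (T q Q n 0) (jm q Q n j) := by
  induction j with
  | zero => exact Commute.refl _
  | succ j ih =>
    rcases j with _ | j
    · refine Commute.smul_right ?_ _
      have := T_braid_zero q Q n
      simp only [Commute, SemiconjBy, jm_zero, mul_assoc] at this ⊢
      exact this
    · have h1 := commute_T_T q Q n (show 0 + 1 < j + 1 + 1 by omega)
      exact ((h1.mul_right ih).mul_right h1).smul_right _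

theorem commute_jm_jm (i j : ℕ) : Commute (jm q Q n i) (jm q Q n j) := by
  have key : ∀ i j, i < j → Commute (jm q Q n i) (jm q Q n j) := by
    intro i j h
    induction i with
    | zero => exact commute_T_zero_jm q Q n j
    | succ i ih =>
      have h1 := commute_T_jm_of_gt q Q n (show 1 ≤ i + 1 by omega) h
      exact ((h1.mul_left (ih (by omega))).mul_left h1).smul_left _
  rcases lt_trichotomy i j with h | rfl | h
  · exact key i j h
  · exact Commute.refl _
  · exact (key j i h).symm

theorem commute_T_jm {k j : ℕ} (h1 : j ≠ k) (h2 : j ≠ k + 1) :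
    Commute (T q Q n (k + 1)) (jm q Q n j) := by
  rcases lt_or_ge j k with h | h
  · exact commute_T_jm_of_lt q Q n (by omega)
  · exact commute_T_jm_of_gt q Q n (by omega) (by omega)

theorem T_mul_jm {k : ℕ} (h : k + 1 < n) : T q Q n (k + 1) * jm q Q n (k + 1) =
    jm q Q n k * T q Q n (k + 1) + ((q : R) - 1) • jm q Q n (k + 1) := by
  rw [jm_succ, mul_smul_comm, ← mul_assoc, ← mul_assoc, T_sq q Q n (by omega) h, add_mul,
    add_mul, smul_mul_assoc, smul_mul_assoc, smul_mul_assoc, smul_mul_assoc, one_mul, smul_add,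
    smul_smul, smul_smul, Units.inv_mul, one_smul, smul_smul, add_comm, mul_comm _ ((q : R) - 1)]

theorem jm_mul_T {k : ℕ} (h : k + 1 < n) : jm q Q n (k + 1) * T q Q n (k + 1) =
    T q Q n (k + 1) * jm q Q n k + ((q : R) - 1) • jm q Q n (k + 1) := by
  rw [jm_succ, smul_mul_assoc, mul_assoc, T_sq q Q n (by omega) h, mul_add, mul_smul_comm,
    mul_smul_comm, mul_one, smul_add, smul_smul, smul_smul, smul_smul, Units.inv_mul, one_smul,
    add_comm, mul_comm _ ((q : R) - 1)]

end Presentation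

/-! ### Polynomials in commuting elements -/

section Polynomials

open Polynomial

variable {R : Type u} [CommRing R] {A : Type*} [Ring A] [Algebra R A]

theorem commute_aeval {c x : A} (h : Commute c x) (p : R[X]) : Commute c (aeval x p) := by
  induction p using Polynomial.induction_on' with
  | add p₁ p₂ h1 h2 => rw [map_add]; exact h1.add_right h2
  | monomial k a =>
    rw [aeval_monomial]
    exact (Algebra.commute_algebraMap_right a c).mul_right (h.pow_right k)

theorem aeval_mul_of_semiconj {x y c : A} (h : y * c = c * x) (p : R[X]) :
    aeval y p * c = c * aeval x p := by
  induction p using Polynomial.induction_on' with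
  | add p₁ p₂ h1 h2 => rw [map_add, map_add, add_mul, mul_add, h1, h2]
  | monomial k a =>
    rw [aeval_monomial, aeval_monomial, mul_assoc]
    have : y ^ k * c = c * x ^ k := (SemiconjBy.pow_right (a := c) (x := x) (y := y) h.symm k).symm
    rw [this, ← mul_assoc, ← mul_assoc, Algebra.commutes]

theorem aeval_comp_C_mul_X (x : A) (a : R) (p : R[X]) :
    aeval x (p.comp (C a * X)) = aeval (a • x) p := by
  rw [aeval_comp, map_mul, aeval_C, aeval_X, Algebra.smul_def]

/-- The factor theorem `p(x) - p(y) = w (x - y)` for commuting elements; the cofactor `w` is a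
polynomial in `x` and `y`, which is recorded by the elements that commute with it. -/
theorem exists_aeval_sub_aeval {x y : A} (h : Commute x y) (p : R[X]) :
    ∃ w : A, aeval x p - aeval y p = w * (x - y) ∧
      ∀ c, Commute c x → Commute c y → Commute c w := by
  induction p using Polynomial.induction_on' with
  | add p₁ p₂ h1 h2 =>
    obtain ⟨w₁, h1, c1⟩ := h1
    obtain ⟨w₂, h2, c2⟩ := h2
    refine ⟨w₁ + w₂, ?_, fun c hx hy => (c1 c hx hy).add_right (c2 c hx hy)⟩
    rw [map_add, map_add, add_mul, ← h1, ← h2]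
    abel
  | monomial k a =>
    refine ⟨algebraMap R A a * ∑ i ∈ Finset.range k, x ^ i * y ^ (k - 1 - i), ?_,
      fun c hx hy => ?_⟩
    · rw [aeval_monomial, aeval_monomial, ← mul_sub, mul_assoc, h.geom_sum₂_mul]
    · refine (Algebra.commute_algebraMap_right a c).mul_right
        (Commute.sum_right _ _ _ fun i _ => ?_)
      exact (hx.pow_right i).mul_right (hy.pow_right _)

/-- If `x` and `y` are annihilated on `z` by polynomials without common roots, up to the scaling
by `a`, then `x - a y` is invertible on `z`. -/
theorem exists_mul_sub_smul_mul {x y z : A} (hxy : Commute x y) {a : R} {p₁ p₂ : R[X]}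
    (h : IsCoprime (p₁.comp (C a * X)) p₂) (h₁ : aeval x p₁ * z = 0) (h₂ : aeval y p₂ * z = 0) :
    ∃ w : A, w * (x - a • y) * z = z ∧ ∀ c, Commute c x → Commute c y → Commute c w := by
  obtain ⟨U, W, hUW⟩ := h
  obtain ⟨w, hw, hc⟩ := exists_aeval_sub_aeval (hxy.smul_right a) p₁
  have h1 := congrArg (fun p => aeval y p * z) hUW
  simp only [map_add, map_mul, map_one, one_mul, add_mul, aeval_comp_C_mul_X] at h1
  refine ⟨-(aeval y U * w), ?_, fun c hx hy => ?_⟩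
  · rw [neg_mul, mul_assoc, ← hw, neg_mul, mul_assoc, sub_mul, h₁, zero_sub, mul_neg, neg_neg,
      ← mul_assoc]
    rwa [mul_assoc (aeval y W), h₂, mul_zero, add_zero] at h1
  · exact ((commute_aeval hy U).mul_right (hc c hx (hy.smul_right a))).neg_right

theorem isUnit_sub_smul {x y : A} (hxy : Commute x y) {a : R} {p₁ p₂ : R[X]}
    (h : IsCoprime (p₁.comp (C a * X)) p₂) (h₁ : aeval x p₁ = 0) (h₂ : aeval y p₂ = 0) :
    IsUnit (x - a • y) := by
  obtain ⟨w, hw, hc⟩ := exists_mul_sub_smul_mul (z := 1) hxy h (by rw [h₁, zero_mul])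
    (by rw [h₂, zero_mul])
  rw [mul_one] at hw
  have hcomm : Commute (x - a • y) w :=
    hc _ ((Commute.refl x).sub_left (hxy.symm.smul_left a))
      (hxy.sub_left ((Commute.refl y).smul_left a))
  exact ⟨⟨x - a • y, w, by rw [hcomm.eq, hw], hw⟩, rfl⟩

/-- The polynomials `p_0 = p` and `p_{i+1}(X) = p_i(X) p_i(q X) p_i(q⁻¹ X)`. If `p` is the
product of the `X - P_t`, then the roots of `p_i` are the `q^a P_t` with `|a| ≤ i`, with
multiplicities, and `p_i` annihilates the Jucys–Murphy element `L_{i+1}`. -/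
noncomputable def annPoly (q : Rˣ) (p : R[X]) : ℕ → R[X]
  | 0 => p
  | i + 1 => annPoly q p i * ((annPoly q p i).comp (C (q : R) * X) *
      (annPoly q p i).comp (C ((q⁻¹ : Rˣ) : R) * X))

theorem annPoly_succ (q : Rˣ) (p : R[X]) (i : ℕ) : annPoly q p (i + 1) =
    annPoly q p i * ((annPoly q p i).comp (C (q : R) * X) *
      (annPoly q p i).comp (C ((q⁻¹ : Rˣ) : R) * X)) := rfl

/-- The polynomial `(X - P_1) ⋯ (X - P_k)`. -/
noncomputable def paramPoly {k : ℕ} (P : Fin k → R) : R[X] :=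
  (List.ofFn fun t => X - C (P t)).prod

theorem comp_C_mul_X_comp (p : R[X]) (a b : R) :
    (p.comp (C a * X)).comp (C b * X) = p.comp (C (a * b) * X) := by
  rw [comp_assoc, mul_comp, C_comp, X_comp, C_mul, mul_assoc]

theorem isCoprime_comp_of_inv {p₁ p₂ : R[X]} (a : R) (b : Rˣ)
    (h : IsCoprime (p₁.comp (C (a * ((b⁻¹ : Rˣ) : R)) * X)) p₂) :
    IsCoprime (p₁.comp (C a * X)) (p₂.comp (C (b : R) * X)) := by
  have := h.map (compRingHom (C (b : R) * X))
  rwa [coe_compRingHom_apply, coe_compRingHom_apply, comp_C_mul_X_comp, mul_assoc,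
    Units.inv_mul, mul_one] at this

theorem isCoprime_annPoly (q : Rˣ) (n : ℕ) {p₁ p₂ : R[X]}
    (h : ∀ e : ℤ, |e| < n → IsCoprime (p₁.comp (C ((q ^ e : Rˣ) : R) * X)) p₂) (i j : ℕ) :
    ∀ e : ℤ, |e| + i + j < n →
      IsCoprime ((annPoly q p₁ i).comp (C ((q ^ e : Rˣ) : R) * X)) (annPoly q p₂ j) := by
  induction j with
  | zero =>
    induction i with
    | zero => intro e he; exact h e (by simpa using he)
    | succ i ih =>
      intro e he
      have h1 := abs_lt.1 (show |e| < n - i - 1 by push_cast at he; linarith)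
      have hp : ∀ f : ℤ, |f - e| ≤ 1 →
          IsCoprime ((annPoly q p₁ i).comp (C ((q ^ f : Rˣ) : R) * X)) (annPoly q p₂ 0) := by
        intro f hf
        have hf := abs_le.1 hf
        refine ih f ?_
        have : |f| < n - i := abs_lt.2 ⟨by linarith, by linarith⟩
        push_cast
        linarith
      rw [annPoly_succ, mul_comp, mul_comp, comp_C_mul_X_comp, comp_C_mul_X_comp, ← Units.val_mul,
        ← Units.val_mul, ← zpow_one_add, ← zpow_neg_one, ← zpow_add]
      exact (hp e (by simp)).mul_left ((hp _ (by simp)).mul_left (hp _ (by simp)))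
  | succ j ih =>
    intro e he
    have h1 := abs_lt.1 (show |e| < n - i - j - 1 by push_cast at he; linarith)
    have hp : ∀ f : ℤ, |f - e| ≤ 1 →
        IsCoprime ((annPoly q p₁ i).comp (C ((q ^ f : Rˣ) : R) * X)) (annPoly q p₂ j) := by
      intro f hf
      have hf := abs_le.1 hf
      refine ih f ?_
      have : |f| < n - i - j := abs_lt.2 ⟨by linarith, by linarith⟩
      linarith
    rw [annPoly_succ]
    refine (hp e (by simp)).mul_right (IsCoprime.mul_right ?_ ?_)
    · refine isCoprime_comp_of_inv _ q ?_
      rw [← Units.val_mul, ← zpow_sub_one]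
      exact hp _ (by simp)
    · refine isCoprime_comp_of_inv _ q⁻¹ ?_
      rw [inv_inv, ← Units.val_mul, ← zpow_add_one]
      exact hp _ (by simp)

theorem isCoprime_C_mul_X_sub_C (a : Rˣ) {α β : R} (h : IsUnit ((a⁻¹ : Rˣ) * α - β)) :
    IsCoprime (C (a : R) * X - C α) (X - C β) := by
  have h' : IsUnit ((a : R) * β - α) := by
    have h2 := (a.isUnit.mul h).neg
    rwa [mul_sub, ← mul_assoc, Units.mul_inv, one_mul, neg_sub] at h2
  obtain ⟨w, hw⟩ := h'.exists_left_inv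
  refine ⟨C w, -C (w * a), ?_⟩
  rw [← C_1, ← hw]
  simp only [C_mul, C_sub]
  ring

/-- The invertibility of `f_s(q, Q)` as a coprimality statement. -/
theorem isCoprime_paramPoly (q : Rˣ) {r : ℕ} (Q : Fin r → R) (n : ℕ) {s : ℕ} (hs : s ≤ r)
    (hf : IsUnit (fPoly q Q n hs)) (e : ℤ) (he : |e| < n) :
    IsCoprime ((paramPoly (firstParams Q hs)).comp (C ((q ^ e : Rˣ) : R) * X))
      (paramPoly (lastParams Q hs)) := by
  have he := abs_lt.1 he
  simp only [paramPoly, List.prod_ofFn, prod_comp, sub_comp, X_comp, C_comp]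
  refine IsCoprime.prod_left fun i _ => IsCoprime.prod_right fun j _ => ?_
  refine isCoprime_C_mul_X_sub_C _ ?_
  rw [← zpow_neg]
  refine isUnit_of_dvd_unit ?_ hf
  unfold fPoly
  refine dvd_trans ?_ (Finset.dvd_prod_of_mem _ (Finset.mem_univ i))
  refine dvd_trans ?_ (Finset.dvd_prod_of_mem _ (Finset.mem_univ j))
  exact Finset.dvd_prod_of_mem
    (fun a : ℤ => ((q ^ a : Rˣ) : R) * firstParams Q hs i - lastParams Q hs j)
    (Finset.mem_Ioo.2 ⟨by linarith, by linarith⟩)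

end Polynomials

/-! ### Intertwining elements -/

section Intertwiner

open Polynomial

variable {R : Type u} [CommRing R] (q : Rˣ) {A : Type*} [Ring A] [Algebra R A]

/-- The relations of the affine Hecke algebra of rank two: `T` is a Hecke generator and `x`, `y`
are commuting elements with `q y = T x T`. -/
structure RankTwo (T x y : A) : Prop where
  sq : T * T = ((q : R) - 1) • T + (q : R) • 1
  comm : x * y = y * x
  T_mul : T * y = x * T + ((q : R) - 1) • y
  mul_T : y * T = T * x + ((q : R) - 1) • y

/-- The intertwiner `T (y - x) - (q - 1) y`, which exchanges `x` and `y`. -/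
def twine (T x y : A) : A := T * (y - x) - ((q : R) - 1) • y

variable {q} {T x y : A} (h : RankTwo q T x y)

include h in
theorem RankTwo.mul_twine : y * twine q T x y = twine q T x y * x := by
  simp only [twine, mul_sub, sub_mul, mul_smul_comm, smul_mul_assoc, ← mul_assoc, h.mul_T,
    add_mul]
  simp only [mul_assoc, h.comm]
  abel

include h in
theorem RankTwo.mul_twine' : x * twine q T x y = twine q T x y * y := by
  have h1 : x * T = T * y - ((q : R) - 1) • y := by rw [h.T_mul, add_sub_cancel_right]
  simp only [twine, mul_sub, sub_mul, mul_smul_comm, smul_mul_assoc, ← mul_assoc, h1]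
  simp only [mul_assoc, h.comm]
  abel

include h in
theorem RankTwo.twine_sq :
    twine q T x y * twine q T x y = (y - (q : R) • x) * (x - (q : R) • y) := by
  have h1 := h.mul_twine
  have h2 := h.mul_twine'
  have h3 : (y - x) * twine q T x y = twine q T x y * (x - y) := by
    rw [sub_mul, mul_sub, h1, h2]
  have h4 : twine q T x y * twine q T x y =
      T * twine q T x y * (x - y) - ((q : R) - 1) • (twine q T x y * x) := by
    conv_lhs => enter [1]; rw [twine]
    rw [sub_mul, mul_assoc, h3, smul_mul_assoc, h1, ← mul_assoc]
  rw [h4]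
  simp only [twine, mul_sub, sub_mul, mul_smul_comm, smul_mul_assoc, ← mul_assoc, h.sq, add_mul,
    one_mul, smul_sub]
  simp only [mul_assoc, h.comm]
  module

/-- An annihilating polynomial of `x` gives one of `y`: if `F` annihilates `x` on `z` and `G` on the
smaller part `z p`, then `F(y) G(q y) G(q⁻¹ y)` vanishes on `z p`. The square
`(y - q x) (x - q y)` of the intertwiner is a factor of `G(q y) G(q⁻¹ y)` there, and the intertwiner
turns `F(y)` into `F(x) = 0`. -/
theorem RankTwo.aeval_mul_eq_zero (h : RankTwo q T x y) {z p : A} {F G : R[X]}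
    (hT : Commute T z) (hx : Commute x z) (hy : Commute y z)
    (hF : aeval x F * z = 0) (hG : aeval x G * (z * p) = 0) :
    aeval y (F * (G.comp (C (q : R) * X) * G.comp (C ((q⁻¹ : Rˣ) : R) * X))) * (z * p) = 0 := by
  have hxy : Commute x y := h.comm
  have ht : Commute (twine q T x y) z :=
    (hT.mul_left (hy.sub_left hx)).sub_left (hy.smul_left _)
  have h1 : aeval y F * ((y - (q : R) • x) * (x - (q : R) • y)) * z = 0 := by
    rw [← h.twine_sq, ← mul_assoc, aeval_mul_of_semiconj h.mul_twine, mul_assoc, ht.eq, mul_assoc,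
      ← mul_assoc (aeval x F), hF, zero_mul, mul_zero]
  -- On `z p`, where `G(x) = 0`, the values `G(q y)` and `G(q⁻¹ y)` are multiples of `q y - x`
  -- and of `q⁻¹ y - x`.
  obtain ⟨w₁, hw₁, hc₁⟩ := exists_aeval_sub_aeval (hxy.symm.smul_left (q : R)) G
  obtain ⟨w₂, hw₂, hc₂⟩ := exists_aeval_sub_aeval (hxy.symm.smul_left ((q⁻¹ : Rˣ) : R)) G
  have hy₁ : Commute y w₁ := hc₁ y ((Commute.refl y).smul_right _) hxy.symm
  have hy₂ : Commute y w₂ := hc₂ y ((Commute.refl y).smul_right _) hxy.symm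
  have hx₂ : Commute x w₂ := hc₂ x (hxy.smul_right _) (Commute.refl x)
  rw [map_mul, map_mul, aeval_comp_C_mul_X, aeval_comp_C_mul_X]
  have e₁ : aeval ((q : R) • y) G * (z * p) = w₁ * ((q : R) • y - x) * (z * p) := by
    rw [← hw₁, sub_mul, hG, sub_zero]
  have e₂ : aeval (((q⁻¹ : Rˣ) : R) • y) G * (z * p) =
      w₂ * (((q⁻¹ : Rˣ) : R) • y - x) * (z * p) := by
    rw [← hw₂, sub_mul, hG, sub_zero]
  have cq : Commute (aeval ((q : R) • y) G) (w₂ * (((q⁻¹ : Rˣ) : R) • y - x)) := by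
    refine (commute_aeval ?_ G).symm
    refine Commute.smul_right (Commute.mul_left hy₂.symm ?_) _
    exact ((Commute.refl y).smul_left _).sub_left hxy
  have c₃ : Commute (w₂ * (((q⁻¹ : Rˣ) : R) • y - x)) w₁ := by
    refine (hc₁ _ ?_ ?_)
    · refine Commute.smul_right (Commute.mul_left hy₂.symm ?_) _
      exact ((Commute.refl y).smul_left _).sub_left hxy
    · exact Commute.mul_left hx₂.symm ((hxy.symm.smul_left _).sub_left (Commute.refl x))
  have c₄ : Commute (aeval y F) (w₁ * w₂) :=
    ((commute_aeval hy₁.symm F).symm).mul_right ((commute_aeval hy₂.symm F).symm)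
  have e₃ : (((q⁻¹ : Rˣ) : R) • y - x) * ((q : R) • y - x) =
      -(((q⁻¹ : Rˣ) : R) • ((y - (q : R) • x) * (x - (q : R) • y))) := by
    simp only [mul_sub, sub_mul, mul_smul_comm, smul_mul_assoc, h.comm, smul_sub, smul_smul,
      Units.inv_mul, Units.mul_inv, one_smul]
    have : ((q⁻¹ : Rˣ) : R) * ((q : R) * (q : R)) = q := by
      rw [← mul_assoc, Units.inv_mul, one_mul]
    simp only [this]
    abel
  calc aeval y F * (aeval ((q : R) • y) G * aeval (((q⁻¹ : Rˣ) : R) • y) G) * (z * p)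
      = aeval y F * (w₂ * (((q⁻¹ : Rˣ) : R) • y - x) * (aeval ((q : R) • y) G * (z * p))) := by
        rw [mul_assoc, mul_assoc, e₂, ← mul_assoc (aeval ((q : R) • y) G), cq.eq,
          mul_assoc _ _ (z * p)]
    _ = aeval y F * (w₁ * w₂ * ((((q⁻¹ : Rˣ) : R) • y - x) * ((q : R) • y - x))) * (z * p) := by
        rw [e₁, ← mul_assoc (w₂ * _), ← mul_assoc (w₂ * _), c₃.eq]
        simp only [mul_assoc]
    _ = -(((q⁻¹ : Rˣ) : R) • (w₁ * w₂ *
          (aeval y F * ((y - (q : R) • x) * (x - (q : R) • y)) * z) * p)) := by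
        rw [e₃, mul_neg, mul_smul_comm, mul_neg, mul_smul_comm, ← mul_assoc (aeval y F), c₄.eq]
        simp only [mul_assoc, neg_mul, smul_mul_assoc]
    _ = 0 := by rw [h1, mul_zero, zero_mul, smul_zero, neg_zero]

end Intertwiner

section JucysMurphy

open Polynomial

variable {R : Type u} [CommRing R] (q : Rˣ) {r : ℕ} (Q : Fin r → R) (n : ℕ)

theorem rankTwo_jm {k : ℕ} (h : k + 1 < n) :
    RankTwo q (T q Q n (k + 1)) (jm q Q n k) (jm q Q n (k + 1)) where
  sq := T_sq q Q n (by omega) h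
  comm := commute_jm_jm q Q n _ _
  T_mul := T_mul_jm q Q n h
  mul_T := jm_mul_T q Q n h

theorem aeval_paramPoly {A : Type*} [Ring A] [Algebra R A] (x : A) :
    aeval x (paramPoly Q) = (List.ofFn fun t : Fin r => x - algebraMap R A (Q t)).prod := by
  rw [paramPoly, map_list_prod, List.map_ofFn]
  congr 2
  funext t
  simp

theorem aeval_jm_annPoly {k : ℕ} (h : k < n) :
    aeval (jm q Q n k) (annPoly q (paramPoly Q) k) = 0 := by
  induction k with
  | zero =>
    rw [annPoly, aeval_paramPoly]
    exact T_cyclotomic q Q n h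
  | succ k ih =>
    have h1 := ih (by omega)
    have := (rankTwo_jm q Q n h).aeval_mul_eq_zero (z := 1) (p := 1) (Commute.one_right _)
      (Commute.one_right _) (Commute.one_right _) (F := annPoly q (paramPoly Q) k)
      (G := annPoly q (paramPoly Q) k) (by rw [h1, zero_mul]) (by rw [h1, zero_mul])
    rwa [mul_one, mul_one] at this

end JucysMurphy

/-! ### Words in two letters -/

section Words

/-- The number of positions `p < k` at which the word `ε` has the letter `c`. -/
def cnt (c : Bool) (ε : ℕ → Bool) (k : ℕ) : ℕ := Nat.count (fun p => ε p = c) k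

/-- The letter at position `p` is the `idx ε p`-th of its kind, counting from zero. -/
def idx (ε : ℕ → Bool) (p : ℕ) : ℕ := cnt (ε p) ε p

/-- The word `ε` with the letters at the positions `k` and `k + 1` exchanged. -/
def swp (k : ℕ) (ε : ℕ → Bool) : ℕ → Bool := ε ∘ Equiv.swap k (k + 1)

/-- The word which has `m` times the letter `false`, followed by letters `true`. -/
def baseWord (m : ℕ) : ℕ → Bool := fun p => decide (m ≤ p)

/-- The sum of the positions below `n` of the letter `false`, which measures how far a word is
from a base word. -/
def weight (n : ℕ) (ε : ℕ → Bool) : ℕ := ∑ p ∈ Finset.range n, if ε p = false then p else 0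

@[simp] theorem cnt_zero (c : Bool) (ε : ℕ → Bool) : cnt c ε 0 = 0 := rfl

theorem cnt_succ (c : Bool) (ε : ℕ → Bool) (k : ℕ) :
    cnt c ε (k + 1) = cnt c ε k + if ε k = c then 1 else 0 := by
  unfold cnt
  rw [Nat.count_succ]

theorem cnt_succ_self (ε : ℕ → Bool) (k : ℕ) : cnt (ε k) ε (k + 1) = cnt (ε k) ε k + 1 := by
  rw [cnt_succ, if_pos rfl]

theorem cnt_succ_of_ne {c : Bool} {ε : ℕ → Bool} {k : ℕ} (h : ε k ≠ c) :
    cnt c ε (k + 1) = cnt c ε k := by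
  rw [cnt_succ, if_neg h, add_zero]

theorem cnt_congr {c : Bool} {ε δ : ℕ → Bool} {k : ℕ} (h : ∀ p < k, ε p = δ p) :
    cnt c ε k = cnt c δ k := by
  induction k with
  | zero => rfl
  | succ k ih =>
    rw [cnt_succ, cnt_succ, ih fun p hp => h p (by omega), h k (by omega)]

theorem cnt_add (ε : ℕ → Bool) (k : ℕ) : cnt true ε k + cnt false ε k = k := by
  induction k with
  | zero => rfl
  | succ k ih =>
    rw [cnt_succ, cnt_succ]
    cases ε k <;> simp <;> omega

theorem cnt_add_not (c : Bool) (ε : ℕ → Bool) (k : ℕ) : cnt c ε k + cnt (!c) ε k = k := by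
  have := cnt_add ε k
  cases c
  · rw [add_comm]; exact this
  · exact this

theorem cnt_mono (c : Bool) (ε : ℕ → Bool) {k l : ℕ} (h : k ≤ l) : cnt c ε k ≤ cnt c ε l :=
  Nat.count_monotone _ h

theorem swp_left (k : ℕ) (ε : ℕ → Bool) : swp k ε k = ε (k + 1) := by simp [swp]

theorem swp_right (k : ℕ) (ε : ℕ → Bool) : swp k ε (k + 1) = ε k := by simp [swp]

theorem swp_of_ne {k p : ℕ} (ε : ℕ → Bool) (h1 : p ≠ k) (h2 : p ≠ k + 1) :
    swp k ε p = ε p := by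
  simp [swp, Equiv.swap_apply_of_ne_of_ne h1 h2]

theorem swp_swp (k : ℕ) (ε : ℕ → Bool) : swp k (swp k ε) = ε := by
  funext p
  simp [swp]

theorem swp_of_eq {k : ℕ} {ε : ℕ → Bool} (h : ε k = ε (k + 1)) : swp k ε = ε := by
  funext p
  rcases eq_or_ne p k with rfl | h1
  · rw [swp_left, h]
  · rcases eq_or_ne p (k + 1) with rfl | h2
    · rw [swp_right, h]
    · exact swp_of_ne ε h1 h2

theorem swp_comm {k l : ℕ} (h : k + 1 < l) (ε : ℕ → Bool) :
    swp k (swp l ε) = swp l (swp k ε) := by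
  funext p
  simp only [swp, Function.comp_apply, Equiv.swap_apply_def]
  congr 1
  split_ifs <;> omega

theorem cnt_swp_of_le {k p : ℕ} (c : Bool) (ε : ℕ → Bool) (h : p ≤ k) :
    cnt c (swp k ε) p = cnt c ε p :=
  cnt_congr fun _ hi => swp_of_ne ε (by omega) (by omega)

theorem cnt_swp_of_gt {k p : ℕ} (c : Bool) (ε : ℕ → Bool) (h : k + 2 ≤ p) :
    cnt c (swp k ε) p = cnt c ε p := by
  induction p, h using Nat.le_induction with
  | base =>
    simp only [cnt_succ, cnt_swp_of_le c ε le_rfl, swp_left, swp_right]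
    omega
  | succ p hp ih => rw [cnt_succ, cnt_succ, ih, swp_of_ne ε (by omega) (by omega)]

theorem cnt_swp_of_ne {k p : ℕ} (c : Bool) (ε : ℕ → Bool) (h : p ≠ k + 1) :
    cnt c (swp k ε) p = cnt c ε p := by
  rcases le_or_gt p k with h' | h'
  · exact cnt_swp_of_le c ε h'
  · exact cnt_swp_of_gt c ε (by omega)

theorem idx_swp_of_ne {k p : ℕ} (ε : ℕ → Bool) (h1 : p ≠ k) (h2 : p ≠ k + 1) :
    idx (swp k ε) p = idx ε p := by
  rw [idx, swp_of_ne ε h1 h2, cnt_swp_of_ne _ ε h2, idx]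

theorem idx_swp_left {k : ℕ} {ε : ℕ → Bool} (h : ε k ≠ ε (k + 1)) :
    idx (swp k ε) k = idx ε (k + 1) := by
  rw [idx, swp_left, cnt_swp_of_le _ ε le_rfl, idx, cnt_succ_of_ne h]

theorem idx_swp_right {k : ℕ} {ε : ℕ → Bool} (h : ε k ≠ ε (k + 1)) :
    idx (swp k ε) (k + 1) = idx ε k := by
  rw [idx, swp_right, cnt_succ_of_ne (by rw [swp_left]; exact h.symm), cnt_swp_of_le _ ε le_rfl,
    idx]

theorem idx_succ {k : ℕ} {ε : ℕ → Bool} (h : ε k = ε (k + 1)) :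
    idx ε (k + 1) = idx ε k + 1 := by
  rw [idx, ← h, cnt_succ_self, idx]

theorem weight_swp {n k : ℕ} (hk : k + 1 < n) {ε : ℕ → Bool} (h1 : ε k = true)
    (h2 : ε (k + 1) = false) : weight n (swp k ε) + 1 = weight n ε := by
  obtain ⟨d, rfl⟩ := Nat.exists_eq_add_of_lt hk
  induction d with
  | zero =>
    simp only [weight, add_zero, Finset.sum_range_succ, swp_left, swp_right, h1, h2]
    rw [Finset.sum_congr rfl fun p hp => by
      rw [swp_of_ne ε (by have := Finset.mem_range.1 hp; omega)
        (by have := Finset.mem_range.1 hp; omega)]]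
    simp only [if_true, reduceCtorEq, if_false]
    omega
  | succ d ih =>
    have := ih (by omega)
    rw [weight, weight, show k + 1 + (d + 1) + 1 = (k + 1 + d + 1) + 1 by omega,
      Finset.sum_range_succ, Finset.sum_range_succ (fun p => if ε p = false then p else 0),
      swp_of_ne ε (by omega) (by omega)]
    rw [weight, weight] at this
    omega

/-- A word without descents is a base word. -/
theorem eq_baseWord_of_forall {n : ℕ} {ε : ℕ → Bool}
    (h : ∀ k, k + 1 < n → ¬(ε k = true ∧ ε (k + 1) = false)) :
    ∀ p < n, ε p = baseWord (cnt false ε n) p := by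
  have key : ∀ k, k ≤ n → ∃ m ≤ k, cnt false ε k = m ∧ ∀ p < k, ε p = decide (m ≤ p) := by
    intro k
    induction k with
    | zero => intro _; exact ⟨0, le_rfl, rfl, fun p hp => absurd hp (by omega)⟩
    | succ k ih =>
      intro hk
      obtain ⟨m, hm, hc, hp⟩ := ih (by omega)
      rcases hε : ε k with _ | _
      · -- the letter before position `k` is not `true`, so that all letters so far are `false`
        have hmk : m = k := by
          by_contra hne
          obtain ⟨l, rfl⟩ : ∃ l, k = l + 1 := ⟨k - 1, by omega⟩
          exact h l hk ⟨by rw [hp l (by omega)]; simp; omega, hε⟩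
        subst hmk
        refine ⟨m + 1, le_rfl, by rw [cnt_succ, hc, if_pos hε], fun p hp' => ?_⟩
        rcases eq_or_ne p m with rfl | hne
        · rw [hε]; simp
        · rw [hp p (by omega)]
          simp only [decide_eq_decide]
          omega
      · refine ⟨m, by omega, by rw [cnt_succ_of_ne (by rw [hε]; decide), hc], fun p hp' => ?_⟩
        rcases eq_or_ne p k with rfl | hne
        · rw [hε]; simp [hm]
        · exact hp p (by omega)
  obtain ⟨m, -, hc, hp⟩ := key n le_rfl
  intro p hpn
  rw [hp p hpn, baseWord, hc]

end Words

/-! ### Idempotents attached to words -/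

section Idempotents

open Polynomial

variable {R : Type u} [CommRing R] (q : Rˣ) {r : ℕ} (Q : Fin r → R) (n : ℕ) {s : ℕ} (hs : s ≤ r)

/-- The polynomial which annihilates `L_{i+1}` in the Ariki–Koike algebra with the parameters
`(Q_1, …, Q_s)` (letter `true`) or `(Q_{s+1}, …, Q_r)` (letter `false`). -/
noncomputable def colorPoly (c : Bool) (i : ℕ) : R[X] :=
  annPoly q (if c = true then paramPoly (firstParams Q hs) else paramPoly (lastParams Q hs)) i

theorem colorPoly_succ (c : Bool) (i : ℕ) : colorPoly q Q hs c (i + 1) =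
    colorPoly q Q hs c i * ((colorPoly q Q hs c i).comp (C (q : R) * X) *
      (colorPoly q Q hs c i).comp (C ((q⁻¹ : Rˣ) : R) * X)) := rfl

variable {q Q n hs} in
theorem isCoprime_colorPoly_comp (hf : IsUnit (fPoly q Q n hs)) {i j : ℕ} {e : ℤ}
    (h : |e| + i + j < n) : IsCoprime
      ((colorPoly q Q hs true i).comp (C ((q ^ e : Rˣ) : R) * X)) (colorPoly q Q hs false j) :=
  isCoprime_annPoly q n (isCoprime_paramPoly q Q n hs hf) i j e h

variable {q Q n hs} in
theorem isCoprime_colorPoly (hf : IsUnit (fPoly q Q n hs)) {i j : ℕ} (h : i + j < n) (c : Bool) :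
    IsCoprime (colorPoly q Q hs c i) (colorPoly q Q hs (!c) j) := by
  have key : ∀ i j : ℕ, i + j < n →
      IsCoprime (colorPoly q Q hs true i) (colorPoly q Q hs false j) := by
    intro i j h
    have := isCoprime_colorPoly_comp hf (i := i) (j := j) (e := 0)
      (by simp only [abs_zero, zero_add]; exact_mod_cast h)
    simpa using this
  cases c
  · exact (key j i (by omega)).symm
  · exact key i j h

open Classical in
/-- A multiple of `colorPoly (!c)` which is congruent to `1` modulo `colorPoly c`, where
`colorPoly true` is taken at `i` and `colorPoly false` at `j`. It is set to `0` if the two are not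
coprime. -/
noncomputable def bezoutPoly (c : Bool) (i j : ℕ) : R[X] :=
  if h : IsCoprime (colorPoly q Q hs true i) (colorPoly q Q hs false j)
  then if c = true then h.choose_spec.choose * colorPoly q Q hs false j
    else h.choose * colorPoly q Q hs true i
  else 0

/-- The polynomial of the letter `c` at position `k` of the word `ε`: it is `1` on the part of
the spectrum of `L_{k+1}` which belongs to `c`, and `0` on the other part. -/
noncomputable def sepPoly (c : Bool) (ε : ℕ → Bool) (k : ℕ) : R[X] :=
  bezoutPoly q Q hs c (cnt true ε k) (cnt false ε k)

theorem sepPoly_dvd (c : Bool) (ε : ℕ → Bool) (k : ℕ) :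
    ∃ W, sepPoly q Q hs c ε k = W * colorPoly q Q hs (!c) (cnt (!c) ε k) := by
  unfold sepPoly bezoutPoly
  split_ifs with h hc
  · subst hc; exact ⟨_, rfl⟩
  · rw [Bool.not_eq_true] at hc; subst hc; exact ⟨_, rfl⟩
  · exact ⟨0, (zero_mul _).symm⟩

variable {q Q n hs} in
theorem sepPoly_add (hf : IsUnit (fPoly q Q n hs)) (c : Bool) (ε : ℕ → Bool) {k : ℕ}
    (hk : k < n) : sepPoly q Q hs c ε k + sepPoly q Q hs (!c) ε k = 1 := by
  have h := isCoprime_colorPoly hf (i := cnt true ε k) (j := cnt false ε k)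
    (by rw [cnt_add]; exact hk) true
  rw [Bool.not_true] at h
  have h1 := h.choose_spec.choose_spec
  unfold sepPoly bezoutPoly
  rw [dif_pos h, dif_pos h]
  cases c
  · exact h1
  · rw [add_comm]; exact h1

theorem sepPoly_congr (c : Bool) {ε δ : ℕ → Bool} {k : ℕ} (h : ∀ p < k, ε p = δ p) :
    sepPoly q Q hs c ε k = sepPoly q Q hs c δ k := by
  rw [sepPoly, sepPoly, cnt_congr h, cnt_congr h]

section

variable {A : Type*} [Ring A] [Algebra R A]

theorem aeval_sepPoly_mul_eq_zero {c d : Bool} (hcd : c ≠ d) {ε : ℕ → Bool} {k : ℕ} {y z : A}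
    (h : aeval y (colorPoly q Q hs d (cnt d ε k)) * z = 0) :
    aeval y (sepPoly q Q hs c ε k) * z = 0 := by
  obtain ⟨W, hW⟩ := sepPoly_dvd q Q hs c ε k
  have : (!c) = d := by cases c <;> cases d <;> simp_all
  rw [hW, this, map_mul, mul_assoc, h, mul_zero]

variable {q Q n hs} in
theorem aeval_sepPoly_mul_eq_self (hf : IsUnit (fPoly q Q n hs)) {c : Bool} {ε : ℕ → Bool} {k : ℕ}
    (hk : k < n) {y z : A} (h : aeval y (colorPoly q Q hs c (cnt c ε k)) * z = 0) :
    aeval y (sepPoly q Q hs c ε k) * z = z := by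
  have h1 := congrArg (fun p => aeval y p * z) (sepPoly_add hf c ε hk)
  simp only [map_add, map_one, one_mul, add_mul] at h1
  rwa [aeval_sepPoly_mul_eq_zero q Q hs (c := !c) (by simp) h, add_zero] at h1

theorem aeval_colorPoly_mul_sepPoly {c : Bool} {ε : ℕ → Bool} {k : ℕ} {y z : A}
    (h : aeval y (colorPoly q Q hs true (cnt true ε k) * colorPoly q Q hs false (cnt false ε k)) *
      z = 0) :
    aeval y (colorPoly q Q hs c (cnt c ε k)) * (aeval y (sepPoly q Q hs c ε k) * z) = 0 := by
  obtain ⟨W, hW⟩ := sepPoly_dvd q Q hs c ε k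
  have : colorPoly q Q hs c (cnt c ε k) * sepPoly q Q hs c ε k =
      W * (colorPoly q Q hs true (cnt true ε k) * colorPoly q Q hs false (cnt false ε k)) := by
    rw [hW]
    cases c <;> simp only [Bool.not_true, Bool.not_false] <;> ring
  rw [← mul_assoc, ← map_mul, this, map_mul, mul_assoc, h, mul_zero]

end

/-- The idempotent attached to the first `k` letters of `ε`. Over a field, it is the projection to
the joint generalised eigenspace on which `L_{p+1}` has eigenvalues `q^a Q_t` with `t ≤ s` if `ε p`
is `true` and with `t > s` if it is `false`. -/
noncomputable def idem (ε : ℕ → Bool) : ℕ → ArikiKoike q Q n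
  | 0 => 1
  | k + 1 => idem ε k * aeval (jm q Q n k) (sepPoly q Q hs (ε k) ε k)

theorem idem_succ (ε : ℕ → Bool) (k : ℕ) : idem q Q n hs ε (k + 1) =
    idem q Q n hs ε k * aeval (jm q Q n k) (sepPoly q Q hs (ε k) ε k) := rfl

theorem idem_congr {ε δ : ℕ → Bool} {k : ℕ} (h : ∀ p < k, ε p = δ p) :
    idem q Q n hs ε k = idem q Q n hs δ k := by
  induction k with
  | zero => rfl
  | succ k ih =>
    rw [idem_succ, idem_succ, ih fun p hp => h p (by omega), h k (by omega),
      sepPoly_congr q Q hs _ fun p hp => h p (by omega)]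

theorem commute_idem {c : ArikiKoike q Q n} {k : ℕ} (h : ∀ p < k, Commute c (jm q Q n p))
    (ε : ℕ → Bool) : Commute c (idem q Q n hs ε k) := by
  induction k with
  | zero => exact Commute.one_right c
  | succ k ih =>
    exact (ih fun p hp => h p (by omega)).mul_right (commute_aeval (h k (by omega)) _)

theorem commute_jm_idem (j : ℕ) (ε : ℕ → Bool) (k : ℕ) :
    Commute (jm q Q n j) (idem q Q n hs ε k) :=
  commute_idem q Q n hs (fun p _ => commute_jm_jm q Q n j p) ε

theorem commute_aeval_jm_idem (j : ℕ) (p : R[X]) (ε : ℕ → Bool) (k : ℕ) :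
    Commute (aeval (jm q Q n j) p) (idem q Q n hs ε k) :=
  (commute_aeval (commute_jm_idem q Q n hs j ε k).symm p).symm

theorem idem_succ' (ε : ℕ → Bool) (k : ℕ) : idem q Q n hs ε (k + 1) =
    aeval (jm q Q n k) (sepPoly q Q hs (ε k) ε k) * idem q Q n hs ε k := by
  rw [(commute_aeval_jm_idem q Q n hs k _ ε k).eq, idem_succ]

theorem idem_mul_eq_self {ε : ℕ → Bool} {k : ℕ} {w : ArikiKoike q Q n}
    (h : ∀ p < k, aeval (jm q Q n p) (sepPoly q Q hs (ε p) ε p) * w = w) :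
    idem q Q n hs ε k * w = w := by
  induction k with
  | zero => exact one_mul w
  | succ k ih => rw [idem_succ, mul_assoc, h k (by omega), ih fun p hp => h p (by omega)]

theorem paramPoly_mul :
    paramPoly (firstParams Q hs) * paramPoly (lastParams Q hs) = paramPoly Q := by
  simp only [paramPoly, List.prod_ofFn]
  rw [Finset.prod_fin_eq_prod_range, Finset.prod_fin_eq_prod_range, Finset.prod_fin_eq_prod_range]
  have key : ∀ F : ℕ → R[X], ∏ i ∈ Finset.range r, F i =
      (∏ i ∈ Finset.range s, F i) * ∏ i ∈ Finset.range (r - s), F (s + i) := fun F => by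
    rw [← Finset.prod_range_add, Nat.add_sub_cancel' hs]
  rw [key]
  congr 1
  · refine Finset.prod_congr rfl fun i hi => ?_
    have hi := Finset.mem_range.1 hi
    rw [dif_pos hi, dif_pos (by omega)]
    rfl
  · refine Finset.prod_congr rfl fun i hi => ?_
    have hi := Finset.mem_range.1 hi
    rw [dif_pos hi, dif_pos (by omega)]
    rfl

theorem aeval_mul_idem (ε : ℕ → Bool) {k : ℕ} (hk : k < n) :
    aeval (jm q Q n k) (colorPoly q Q hs true (cnt true ε k) *
      colorPoly q Q hs false (cnt false ε k)) * idem q Q n hs ε k = 0 := by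
  induction k with
  | zero =>
    have : colorPoly q Q hs true 0 * colorPoly q Q hs false 0 = paramPoly Q :=
      paramPoly_mul Q hs
    rw [cnt_zero, cnt_zero, this, aeval_paramPoly, jm_zero, T_cyclotomic q Q n hk, zero_mul]
  | succ k ih =>
    have h1 := ih (by omega)
    have h2 := aeval_colorPoly_mul_sepPoly q Q hs (c := ε k) h1
    rw [(commute_aeval_jm_idem q Q n hs k _ ε k).eq] at h2
    have h3 := (rankTwo_jm q Q n hk).aeval_mul_eq_zero
      (commute_idem q Q n hs (fun p hp => commute_T_jm q Q n (by omega) (by omega)) ε)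
      (commute_jm_idem q Q n hs k ε k) (commute_jm_idem q Q n hs (k + 1) ε k) h1 h2
    rw [idem_succ, ← h3]
    congr 2
    rw [cnt_succ, cnt_succ]
    cases ε k
    · simp only [Bool.false_eq_true, if_false, if_true, add_zero, colorPoly_succ]
      ring
    · simp only [Bool.true_eq_false, if_false, if_true, add_zero, colorPoly_succ]
      ring

/-- On the image of the idempotent of `ε`, the element `L_{p+1}` is annihilated by the polynomial
that annihilates `L_{idx ε p + 1}` in the smaller algebra of the letter `ε p`. -/
theorem aeval_colorPoly_mul_idem (ε : ℕ → Bool) {p k : ℕ} (hp : p < k) (hk : k ≤ n) :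
    aeval (jm q Q n p) (colorPoly q Q hs (ε p) (idx ε p)) * idem q Q n hs ε k = 0 := by
  induction k, hp using Nat.le_induction with
  | base =>
    rw [idem_succ']
    exact aeval_colorPoly_mul_sepPoly q Q hs (aeval_mul_idem q Q n hs ε (by omega))
  | succ k hpk ih => rw [idem_succ, ← mul_assoc, ih (by omega), zero_mul]

variable {q Q n hs}

theorem sep_mul_idem (hf : IsUnit (fPoly q Q n hs)) (ε : ℕ → Bool) {p k : ℕ} (hp : p < k)
    (hk : k ≤ n) : aeval (jm q Q n p) (sepPoly q Q hs (ε p) ε p) * idem q Q n hs ε k =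
      idem q Q n hs ε k :=
  aeval_sepPoly_mul_eq_self hf (by omega) (aeval_colorPoly_mul_idem q Q n hs ε hp hk)

theorem idem_mul_idem (hf : IsUnit (fPoly q Q n hs)) (ε : ℕ → Bool) {j k : ℕ} (hj : j ≤ k)
    (hk : k ≤ n) : idem q Q n hs ε j * idem q Q n hs ε k = idem q Q n hs ε k :=
  idem_mul_eq_self q Q n hs fun _ hp => sep_mul_idem hf ε (by omega) hk

/-- The generator `T_{k+1}` preserves the idempotent of a prefix which ends with two equal letters
at the positions `k` and `k + 1`. -/
theorem idem_mul_T_mul_idem_succ (hf : IsUnit (fPoly q Q n hs)) {ε : ℕ → Bool} {k : ℕ}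
    (hk : k + 1 < n) (hε : ε k = ε (k + 1)) :
    idem q Q n hs ε (k + 2) * (T q Q n (k + 1) * idem q Q n hs ε (k + 2)) =
      T q Q n (k + 1) * idem q Q n hs ε (k + 2) := by
  have hR := rankTwo_jm q Q n hk
  set x := jm q Q n k with hx
  set y := jm q Q n (k + 1) with hy
  set t := T q Q n (k + 1)
  set E := idem q Q n hs ε k with hE
  set e := idem q Q n hs ε (k + 2) with he
  have hEt : Commute t E :=
    commute_idem q Q n hs (fun p hp => commute_T_jm q Q n (by omega) (by omega)) ε
  have hEe : E * e = e := idem_mul_idem hf ε (by omega) (by omega)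
  have hee : e * e = e := idem_mul_idem hf ε le_rfl (by omega)
  have hxe : x * e = e * x := commute_jm_idem q Q n hs k ε _
  have hye : y * e = e * y := commute_jm_idem q Q n hs (k + 1) ε _
  have hxE : x * E = E * x := commute_jm_idem q Q n hs k ε _
  have hyE : y * E = E * y := commute_jm_idem q Q n hs (k + 1) ε _
  have hte : E * (t * e) = t * e := by rw [← mul_assoc, ← hEt.eq, mul_assoc, hEe]
  -- The component `z` of `t e` outside `e` intertwines `x` and `y` as well, and this forces
  -- `z` to lie in the image of `e`.
  set z := (E - e) * (t * e) with hz
  have hfe : (E - e) * e = 0 := by rw [sub_mul, hEe, hee, sub_self]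
  have hEz : E * z = z := by
    have : E * (E - e) = E - e := by
      rw [mul_sub, hEe]
      congr 1
      exact idem_mul_idem hf ε le_rfl (by omega)
    rw [hz, ← mul_assoc, this]
  have hez : e * z = 0 := by
    have : e * (E - e) = 0 := by
      rw [mul_sub, hee, ← (commute_idem q Q n hs
        (fun p _ => commute_jm_idem q Q n hs p ε (k + 2) |>.symm) ε : Commute e E).eq.symm, hEe,
        sub_self]
    rw [hz, ← mul_assoc, this, zero_mul]
  have hyz : y * z = z * x := by
    rw [hz, ← mul_assoc, mul_sub, hyE, hye, ← sub_mul, mul_assoc, ← mul_assoc y, hR.mul_T, add_mul,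
      mul_add, smul_mul_assoc, hye, mul_smul_comm, ← mul_assoc _ e y, hfe, zero_mul, smul_zero,
      add_zero, mul_assoc t, hxe]
    simp only [mul_assoc]
  have hxz : x * z = z * y := by
    have h1 : x * t = t * y - ((q : R) - 1) • y := by rw [hR.T_mul, add_sub_cancel_right]
    rw [hz, ← mul_assoc, mul_sub, hxE, hxe, ← sub_mul, mul_assoc, ← mul_assoc x, h1,
      sub_mul (t * y), mul_sub, smul_mul_assoc, hye, mul_smul_comm, ← mul_assoc _ e y, hfe,
      zero_mul, smul_zero, sub_zero, mul_assoc t, hye]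
    simp only [mul_assoc]
  have hzp : ∀ (w : ArikiKoike q Q n), e * w = 0 → z * w = 0 := by
    intro w hw
    rw [hz, mul_assoc, mul_assoc, hw, mul_zero, mul_zero]
  have a1 : aeval y (colorPoly q Q hs (ε k) (idx ε k)) * z = 0 := by
    rw [aeval_mul_of_semiconj hyz]
    refine hzp _ ?_
    rw [← (commute_aeval_jm_idem q Q n hs k _ ε (k + 2)).eq]
    exact aeval_colorPoly_mul_idem q Q n hs ε (by omega) (by omega)
  have a2 : aeval x (colorPoly q Q hs (ε k) (idx ε k + 1)) * z = 0 := by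
    rw [aeval_mul_of_semiconj hxz]
    refine hzp _ ?_
    rw [← (commute_aeval_jm_idem q Q n hs (k + 1) _ ε (k + 2)).eq, ← idx_succ hε, hε]
    exact aeval_colorPoly_mul_idem q Q n hs ε (by omega) (by omega)
  have a3 : aeval x (colorPoly q Q hs (ε k) (idx ε k)) * z = 0 := by
    have h1 : aeval x (colorPoly q Q hs (!(ε k)) (cnt (!(ε k)) ε k) *
        colorPoly q Q hs (ε k) (idx ε k)) * z = 0 := by
      have := aeval_mul_idem q Q n hs ε (show k < n by omega)
      rw [← hEz, ← mul_assoc]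
      convert zero_mul z using 2
      rw [← this, idx]
      congr 2
      cases ε k
      · rfl
      · exact mul_comm _ _
    obtain ⟨U, W, hUW⟩ := isCoprime_colorPoly hf (c := ε k) (i := idx ε k + 1)
      (j := cnt (!(ε k)) ε k) (by have := cnt_add_not (ε k) ε k; rw [idx]; omega)
    have h2 := congrArg (fun p => aeval x (p * colorPoly q Q hs (ε k) (idx ε k)) * z) hUW
    simp only [one_mul] at h2
    rw [← h2, add_mul, map_add, add_mul, mul_assoc W, map_mul _ W, mul_assoc (aeval x W), h1,
      mul_zero, add_zero, mul_comm U, mul_assoc, mul_comm, map_mul, mul_assoc, a2, mul_zero]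
  have a4 : aeval y (colorPoly q Q hs (ε (k + 1)) (idx ε (k + 1))) * z = 0 := by
    rw [idx_succ hε, ← hε, colorPoly_succ, mul_comm, map_mul, mul_assoc, a1, mul_zero]
  have hez' : e * z = z := by
    rw [he, idem_succ, idem_succ, mul_assoc, aeval_sepPoly_mul_eq_self hf hk a4, mul_assoc,
      aeval_sepPoly_mul_eq_self hf (by omega) a3, ← hE, hEz]
  have hz0 : (E - e) * (t * e) = 0 := by rw [← hz, ← hez', hez]
  rw [sub_mul, hte, sub_eq_zero] at hz0
  exact hz0.symm

/-- The generator `T_{k+1}` preserves the idempotent of a word with equal letters at the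
positions `k` and `k + 1`. -/
theorem idem_mul_T_mul_idem (hf : IsUnit (fPoly q Q n hs)) {ε : ℕ → Bool} {k l : ℕ}
    (hkl : k + 1 < l) (hl : l ≤ n) (hε : ε k = ε (k + 1)) :
    idem q Q n hs ε l * (T q Q n (k + 1) * idem q Q n hs ε l) =
      T q Q n (k + 1) * idem q Q n hs ε l := by
  have h2 : ∃ w, idem q Q n hs ε l = idem q Q n hs ε (k + 2) * w := by
    induction l, hkl using Nat.le_induction with
    | base => exact ⟨1, (mul_one _).symm⟩
    | succ l hl' ih =>
      obtain ⟨w, hw⟩ := ih (by omega)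
      exact ⟨_, by rw [idem_succ, hw, mul_assoc]⟩
  refine idem_mul_eq_self q Q n hs fun p hp => ?_
  by_cases h : p = k ∨ p = k + 1
  · obtain ⟨w, hw⟩ := h2
    rw [hw, ← mul_assoc (T q Q n (k + 1)), ← idem_mul_T_mul_idem_succ hf (by omega) hε, ← mul_assoc,
      ← mul_assoc, sep_mul_idem hf ε (by omega) (by omega)]
  · rw [← mul_assoc, ← (commute_aeval (commute_T_jm q Q n (by omega) (by omega)) _).eq, mul_assoc,
      sep_mul_idem hf ε hp hl]

theorem idem_mul_jm_mul_idem (hf : IsUnit (fPoly q Q n hs)) (ε : ℕ → Bool) (k : ℕ) {l : ℕ}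
    (hl : l ≤ n) : idem q Q n hs ε l * (jm q Q n k * idem q Q n hs ε l) =
      jm q Q n k * idem q Q n hs ε l := by
  rw [← mul_assoc, ← (commute_jm_idem q Q n hs k ε l).eq, mul_assoc,
    idem_mul_idem hf ε le_rfl hl]

/-- The intertwiner maps the image of the idempotent of `ε` to that of the word in which two
distinct adjacent letters are exchanged. -/
theorem idem_swp_mul_twine (hf : IsUnit (fPoly q Q n hs)) {ε : ℕ → Bool} {k : ℕ} (hk : k + 1 < n)
    (hε : ε k ≠ ε (k + 1)) :
    idem q Q n hs (swp k ε) n *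
        (twine q (T q Q n (k + 1)) (jm q Q n k) (jm q Q n (k + 1)) * idem q Q n hs ε n) =
      twine q (T q Q n (k + 1)) (jm q Q n k) (jm q Q n (k + 1)) * idem q Q n hs ε n := by
  have hR := rankTwo_jm q Q n hk
  refine idem_mul_eq_self q Q n hs fun p hp => ?_
  refine aeval_sepPoly_mul_eq_self hf hp ?_
  have key : ∀ p', jm q Q n p * twine q (T q Q n (k + 1)) (jm q Q n k) (jm q Q n (k + 1)) =
      twine q (T q Q n (k + 1)) (jm q Q n k) (jm q Q n (k + 1)) * jm q Q n p' → p' < n →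
      swp k ε p = ε p' → idx (swp k ε) p = idx ε p' →
      aeval (jm q Q n p) (colorPoly q Q hs (swp k ε p) (cnt (swp k ε p) (swp k ε) p)) *
        (twine q (T q Q n (k + 1)) (jm q Q n k) (jm q Q n (k + 1)) * idem q Q n hs ε n) = 0 := by
    intro p' h1 hp' h2 h3
    rw [← idx, h3, h2, ← mul_assoc, aeval_mul_of_semiconj h1, mul_assoc,
      aeval_colorPoly_mul_idem q Q n hs ε hp' le_rfl, mul_zero]
  rcases eq_or_ne p k with rfl | h1
  · exact key (p + 1) hR.mul_twine' hk (swp_left _ _) (idx_swp_left hε)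
  rcases eq_or_ne p (k + 1) with rfl | h2
  · exact key k hR.mul_twine (by omega) (swp_right _ _) (idx_swp_right hε)
  refine key p ?_ hp (swp_of_ne ε h1 h2) (idx_swp_of_ne ε h1 h2)
  have ht := commute_T_jm q Q n h1 h2
  have hx := commute_jm_jm q Q n p k
  have hy := commute_jm_jm q Q n p (k + 1)
  exact (((ht.symm.mul_right (hy.sub_right hx))).sub_right (hy.smul_right _)).eq

/-- The square of the intertwiner is invertible on the idempotent of a word with a descent. -/
theorem exists_mul_twine_sq (hf : IsUnit (fPoly q Q n hs)) {ε : ℕ → Bool} {k : ℕ} (hk : k + 1 < n)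
    (h1 : ε k = true) (h2 : ε (k + 1) = false) :
    ∃ w, w * (twine q (T q Q n (k + 1)) (jm q Q n k) (jm q Q n (k + 1)) *
      twine q (T q Q n (k + 1)) (jm q Q n k) (jm q Q n (k + 1))) * idem q Q n hs ε n =
        idem q Q n hs ε n := by
  have hR := rankTwo_jm q Q n hk
  have a1 := aeval_colorPoly_mul_idem q Q n hs ε (show k < n by omega) le_rfl
  have a2 := aeval_colorPoly_mul_idem q Q n hs ε hk le_rfl
  have hi : idx ε k + idx ε (k + 1) = k := by
    rw [idx, idx, h1, h2, cnt_succ_of_ne (by rw [h1]; decide), cnt_add]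
  rw [h1] at a1
  rw [h2] at a2
  obtain ⟨w₁, hw₁, -⟩ := exists_mul_sub_smul_mul (commute_jm_jm q Q n k (k + 1))
    (isCoprime_colorPoly_comp hf (e := 1) (by simp only [abs_one]; omega)) a1 a2
  obtain ⟨w₂, hw₂, -⟩ := exists_mul_sub_smul_mul (commute_jm_jm q Q n k (k + 1))
    (isCoprime_colorPoly_comp hf (e := -1) (by simp only [abs_neg, abs_one]; omega)) a1 a2
  rw [zpow_one] at hw₁
  rw [zpow_neg_one] at hw₂
  refine ⟨-(((q⁻¹ : Rˣ) : R) • (w₁ * w₂)), ?_⟩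
  rw [hR.twine_sq]
  have hx := commute_jm_idem q Q n hs k ε n
  have hy := commute_jm_idem q Q n hs (k + 1) ε n
  set x := jm q Q n k
  set y := jm q Q n (k + 1)
  set e := idem q Q n hs ε n
  have hy' : y - (q : R) • x = -((q : R) • (x - ((q⁻¹ : Rˣ) : R) • y)) := by
    rw [smul_sub, smul_smul, Units.mul_inv, one_smul, neg_sub]
  have hc : Commute (x - (q : R) • y) e := hx.sub_left (hy.smul_left _)
  calc -(((q⁻¹ : Rˣ) : R) • (w₁ * w₂)) * ((y - (q : R) • x) * (x - (q : R) • y)) * e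
      = w₁ * (w₂ * (x - ((q⁻¹ : Rˣ) : R) • y) * ((x - (q : R) • y) * e)) := by
        rw [hy']
        simp only [neg_mul, mul_neg, neg_neg, smul_neg, smul_mul_assoc, mul_smul_comm, smul_smul,
          Units.mul_inv, one_smul, mul_assoc]
    _ = w₁ * (x - (q : R) • y) * e := by
        rw [hc.eq, ← mul_assoc _ e, hw₂, ← hc.eq, mul_assoc]
    _ = e := hw₁

/-- The idempotents of the base words generate the unit ideal. The idempotents of all words sum to
`1`, and at a descent the idempotent of a word factors through that of a word of smaller weight,
because the square of the intertwiner is invertible on it. -/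
theorem one_mem_span_idem (hf : IsUnit (fPoly q Q n hs)) :
    (1 : ArikiKoike q Q n) ∈ Submodule.span R
      {z | ∃ m ≤ n, ∃ x y, z = x * idem q Q n hs (baseWord m) n * y} := by
  set J := Submodule.span R {z | ∃ m ≤ n, ∃ x y, z = x * idem q Q n hs (baseWord m) n * y} with hJ
  have hmul : ∀ a b z, z ∈ J → a * z * b ∈ J := by
    intro a b z hz
    induction hz using Submodule.span_induction with
    | mem z hz =>
      obtain ⟨m, hm, x, y, rfl⟩ := hz
      exact Submodule.subset_span ⟨m, hm, a * x, y * b, by simp only [mul_assoc]⟩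
    | zero => rw [mul_zero, zero_mul]; exact J.zero_mem
    | add z w _ _ h1 h2 => rw [mul_add, add_mul]; exact J.add_mem h1 h2
    | smul c z _ h => rw [mul_smul_comm, smul_mul_assoc]; exact J.smul_mem c h
  have hfull : ∀ N, ∀ ε : ℕ → Bool, weight n ε = N → idem q Q n hs ε n ∈ J := by
    intro N
    induction N with
    | zero =>
      intro ε hN
      rw [idem_congr q Q n hs (eq_baseWord_of_forall (ε := ε) fun k hk h => by
        have := weight_swp hk h.1 h.2; omega)]
      exact Submodule.subset_span
        ⟨cnt false ε n, by have := cnt_add ε n; omega, 1, 1, by rw [one_mul, mul_one]⟩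
    | succ N ih =>
      intro ε hN
      by_cases hd : ∃ k, k + 1 < n ∧ ε k = true ∧ ε (k + 1) = false
      · obtain ⟨k, hk, h1, h2⟩ := hd
        obtain ⟨w, hw⟩ := exists_mul_twine_sq hf hk h1 h2
        rw [← hw, mul_assoc, mul_assoc, ← idem_swp_mul_twine hf hk (by rw [h1, h2]; decide)]
        have := hmul (w * twine q (T q Q n (k + 1)) (jm q Q n k) (jm q Q n (k + 1)))
          (twine q (T q Q n (k + 1)) (jm q Q n k) (jm q Q n (k + 1)) * idem q Q n hs ε n) _
          (ih (swp k ε) (by have := weight_swp hk h1 h2; omega))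
        simpa only [mul_assoc] using this
      · rw [idem_congr q Q n hs (eq_baseWord_of_forall (ε := ε) fun k hk h => hd ⟨k, hk, h⟩)]
        exact Submodule.subset_span
          ⟨cnt false ε n, by have := cnt_add ε n; omega, 1, 1, by rw [one_mul, mul_one]⟩
  -- The idempotent of a prefix is the sum of the idempotents of its two extensions.
  have hpre : ∀ d, ∀ ε : ℕ → Bool, ∀ k, k + d = n → idem q Q n hs ε k ∈ J := by
    intro d
    induction d with
    | zero => rintro ε k rfl; exact hfull _ ε rfl
    | succ d ih =>
      intro ε k hk
      have hu : ∀ c, idem q Q n hs (Function.update ε k c) (k + 1) =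
          idem q Q n hs ε k * aeval (jm q Q n k) (sepPoly q Q hs c ε k) := by
        intro c
        have hc : ∀ p < k, Function.update ε k c p = ε p := fun p hp =>
          Function.update_of_ne (by omega) _ _
        rw [idem_succ, idem_congr q Q n hs hc, sepPoly_congr q Q hs _ hc, Function.update_self]
      have hsum : idem q Q n hs ε k = idem q Q n hs (Function.update ε k true) (k + 1) +
          idem q Q n hs (Function.update ε k false) (k + 1) := by
        rw [hu, hu, ← mul_add, ← map_add]
        have := sepPoly_add hf true ε (show k < n by omega)
        rw [Bool.not_true] at this
        rw [this, map_one, mul_one]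
      rw [hsum]
      exact J.add_mem (ih _ _ (by omega)) (ih _ _ (by omega))
  exact hpre n (fun _ => true) 0 (by omega)

end Idempotents

/-! ### A representation on words -/

section Representation

open Polynomial

variable {R : Type u} [CommRing R] (q : Rˣ) {r : ℕ} (Q : Fin r → R) (n : ℕ) {s : ℕ} (hs : s ≤ r)

/-- Two commuting copies, labelled by letters, of the generators and Jucys–Murphy elements of
Ariki–Koike algebras with `N true` and `N false` strands. Here `t c j` is the Hecke generator which
relates `x c j` to `x c (j + 1)`, so that `x c j` is `L_{j+1}` and `t c j` is `T_{j+1}`. The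
elements `a i j` are the quotients `(q - 1) x / (x - y)` for `x = x true i` and `y = x false j`, and
the elements `x - q^e y` with `|e| ≤ 1` are units. -/
structure TwoColor (N : Bool → ℕ) (B : Type*) [Ring B] [Algebra R B] where
  t : Bool → ℕ → B
  x : Bool → ℕ → B
  a : ℕ → ℕ → B
  t_sq : ∀ c j, j + 1 < N c → t c j * t c j = ((q : R) - 1) • t c j + (q : R) • 1
  t_braid : ∀ c j, t c (j + 1) * t c j * t c (j + 1) = t c j * t c (j + 1) * t c j
  commute_t_t : ∀ c j k, j + 1 < k → Commute (t c j) (t c k)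
  commute_t_t' : ∀ c d j k, c ≠ d → Commute (t c j) (t d k)
  commute_x_x : ∀ c d j k, Commute (x c j) (x d k)
  commute_t_x : ∀ c d j k, (c = d → k ≠ j ∧ k ≠ j + 1) → Commute (t c j) (x d k)
  t_x_t : ∀ c j, t c j * x c j * t c j = (q : R) • x c (j + 1)
  isUnit_sub : ∀ i j (e : ℤ), |e| ≤ 1 → i < N true → j < N false →
    IsUnit (x true i - ((q ^ e : Rˣ) : R) • x false j)
  a_mul : ∀ i j, i < N true → j < N false →
    a i j * (x true i - x false j) = ((q : R) - 1) • x true i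
  commute_a : ∀ i j z, Commute z (x true i) → Commute z (x false j) → Commute z (a i j)
  ann : ∀ c j, j < N c → aeval (x c j) (colorPoly q Q hs c j) = 0

namespace TwoColor

variable {q Q hs} {N : Bool → ℕ} {B : Type*} [Ring B] [Algebra R B] (P : TwoColor q Q hs N B)

/-- The quotient `(q - 1) y / (y - x)` for `x = x true i` and `y = x false j`. -/
def a' (i j : ℕ) : B := ((q : R) - 1) • 1 - P.a i j

/-- The quotient `(q x - y) (x - q y) / (x - y)²` for `x = x true i` and `y = x false j`. -/
def g (i j : ℕ) : B := (q : R) • 1 + P.a i j * P.a' i j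

theorem commute_a' {i j : ℕ} {z : B} (h1 : Commute z (P.x true i)) (h2 : Commute z (P.x false j)) :
    Commute z (P.a' i j) :=
  ((Commute.one_right z).smul_right _).sub_right (P.commute_a i j z h1 h2)

theorem commute_g {i j : ℕ} {z : B} (h1 : Commute z (P.x true i)) (h2 : Commute z (P.x false j)) :
    Commute z (P.g i j) :=
  ((Commute.one_right z).smul_right _).add_right
    ((P.commute_a i j z h1 h2).mul_right (P.commute_a' h1 h2))

theorem commute_a_x (i j : ℕ) (c : Bool) (k : ℕ) : Commute (P.a i j) (P.x c k) :=
  (P.commute_a i j _ (P.commute_x_x _ _ _ _) (P.commute_x_x _ _ _ _)).symm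

theorem commute_a_a' (i j k l : ℕ) : Commute (P.a i j) (P.a' k l) :=
  P.commute_a' (P.commute_a_x _ _ _ _) (P.commute_a_x _ _ _ _)

theorem a_mul_add {i j : ℕ} (hi : i < N true) (hj : j < N false) :
    P.a i j * P.x false j + P.a' i j * P.x true i = 0 := by
  have := P.a_mul i j hi hj
  rw [a', sub_mul, smul_mul_assoc, one_mul, ← this, mul_sub]
  abel

theorem isUnit_sub' {i j : ℕ} (hi : i < N true) (hj : j < N false) :
    IsUnit (P.x true i - P.x false j) := by
  have := P.isUnit_sub i j 0 (by simp) hi hj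
  simpa using this

theorem isUnit_g {i j : ℕ} (hi : i < N true) (hj : j < N false) : IsUnit (P.g i j) := by
  have h1 := P.isUnit_sub i j 1 (by simp) hi hj
  have h2 := P.isUnit_sub i j (-1) (by simp) hi hj
  have h0 := P.isUnit_sub' hi hj
  rw [zpow_one] at h1
  rw [zpow_neg_one] at h2
  have hx := P.commute_x_x true false i j
  have ha := P.a_mul i j hi hj
  have hax := P.commute_a_x i j true i
  have hay := P.commute_a_x i j false j
  -- `g (x - y)² = (q x - y) (x - q y)`, and the right-hand side is invertible
  have key : P.g i j * ((P.x true i - P.x false j) * (P.x true i - P.x false j)) =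
      (q : R) • ((P.x true i - ((q⁻¹ : Rˣ) : R) • P.x false j) *
        (P.x true i - (q : R) • P.x false j)) := by
    have e1 : P.a' i j * (P.x true i - P.x false j) = -(((q : R) - 1) • P.x false j) := by
      rw [a', sub_mul, ha, smul_mul_assoc, one_mul, smul_sub]
      abel
    have e2 : P.a i j * P.a' i j * ((P.x true i - P.x false j) * (P.x true i - P.x false j)) =
        -(((q : R) - 1) • P.x true i * (((q : R) - 1) • P.x false j)) := by
      have hc : Commute (P.a' i j) (P.x true i - P.x false j) :=
        (P.commute_a' ((Commute.refl _).sub_left hx.symm) (hx.sub_left (Commute.refl _))).symm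
      rw [mul_assoc, ← mul_assoc (P.a' i j), hc.eq, mul_assoc _ (P.a' i j), e1, ← mul_assoc, ha,
        mul_neg]
    rw [g, add_mul, e2, ← smul_mul_assoc, smul_sub, smul_smul, Units.mul_inv, one_smul]
    simp only [mul_sub, sub_mul, smul_mul_assoc, mul_smul_comm, one_mul, smul_sub, smul_smul,
      hx.eq, ← mul_assoc]
    module
  have h3 : IsUnit ((q : R) • ((P.x true i - ((q⁻¹ : Rˣ) : R) • P.x false j) *
      (P.x true i - (q : R) • P.x false j))) := by
    rw [Algebra.smul_def]
    exact (q.isUnit.map _).mul (h2.mul h1)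
  rw [← key] at h3
  exact (h0.mul h0).mul_right_iff.1 h3

end TwoColor

end Representation

section Words

/-- The words of length `n` with `N c` letters `c`; they are continued by the letter `true`. -/
@[ext]
structure Shape (n : ℕ) (N : Bool → ℕ) where
  val : ℕ → Bool
  tail : ∀ p, n ≤ p → val p = true
  count : ∀ c, cnt c val n = N c

namespace Shape

variable {n : ℕ} {N : Bool → ℕ}

theorem ext_of_lt {ε δ : Shape n N} (h : ∀ p < n, ε.val p = δ.val p) : ε = δ := by
  refine Shape.ext (funext fun p => ?_)
  rcases lt_or_ge p n with hp | hp
  · exact h p hp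
  · rw [ε.tail p hp, δ.tail p hp]

/-- The exchange of the letters at the positions `k` and `k + 1`. -/
def swap (k : ℕ) (ε : Shape n N) : Shape n N :=
  if h : k + 1 < n then
    ⟨swp k ε.val, fun p hp => by rw [swp_of_ne _ (by omega) (by omega), ε.tail p hp],
      fun c => by rw [cnt_swp_of_gt c _ (by omega), ε.count c]⟩
  else ε

theorem swap_val {k : ℕ} (h : k + 1 < n) (ε : Shape n N) : (swap k ε).val = swp k ε.val := by
  rw [swap, dif_pos h]

theorem swap_swap (k : ℕ) (ε : Shape n N) : swap k (swap k ε) = ε := by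
  by_cases h : k + 1 < n
  · refine Shape.ext ?_
    rw [swap_val h, swap_val h, swp_swp]
  · simp [swap, h]

theorem swap_comm {k l : ℕ} (hkl : k + 1 < l) (h : l + 1 < n) (ε : Shape n N) :
    swap k (swap l ε) = swap l (swap k ε) := by
  refine Shape.ext ?_
  rw [swap_val (by omega), swap_val h, swap_val h, swap_val (by omega), swp_comm hkl]

theorem idx_lt (ε : Shape n N) {p : ℕ} (hp : p < n) : idx ε.val p < N (ε.val p) := by
  have h1 := cnt_succ_self ε.val p
  have h2 := cnt_mono (ε.val p) ε.val (show p + 1 ≤ n from hp)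
  rw [ε.count] at h2
  rw [idx]
  omega

end Shape

end Words

section Representation

open Polynomial

variable {R : Type u} [CommRing R] {q : Rˣ} {r : ℕ} {Q : Fin r → R} {n : ℕ} {s : ℕ} {hs : s ≤ r}

theorem idx_lt_idx {ε : ℕ → Bool} {p p' : ℕ} (h : p < p') (he : ε p = ε p') :
    idx ε p < idx ε p' := by
  have h1 := cnt_succ_self ε p
  have h2 := cnt_mono (ε p) ε (show p + 1 ≤ p' from h)
  rw [idx, idx, ← he]
  omega

/-- The braid relation on the generator of a module with three components `E₁`, `E₂`, `E₃`. -/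
theorem braid_of_three {B M : Type*} [Ring B] [AddCommGroup M] (U W : M → M)
    (hU : ∀ x y, U (x + y) = U x + U y) (hW : ∀ x y, W (x + y) = W x + W y) (E₁ E₂ E₃ : B → M)
    (hE₁ : ∀ x y, E₁ (x + y) = E₁ x + E₁ y) (hE₂ : ∀ x y, E₂ (x + y) = E₂ x + E₂ y)
    {t a₁ a₂ b g : B}
    (hU1 : ∀ y, U (E₁ y) = E₁ (t * y)) (hW1 : ∀ y, W (E₁ y) = E₁ (a₂ * y) + E₂ y)
    (hU2 : ∀ y, U (E₂ y) = E₂ (a₁ * y) + E₃ y) (hW2 : ∀ y, W (E₂ y) = E₂ (b * y) + E₁ (g * y))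
    (hW3 : ∀ y, W (E₃ y) = E₃ (t * y))
    (h1 : a₁ * t = t * a₂ + b * a₁) (h2 : t * a₂ * t = a₂ * t * a₂ + g * a₁) (y : B) :
    U (W (U (E₁ y))) = W (U (W (E₁ y))) := by
  rw [hU1, hW1, hU, hU1, hU2, hW1, hU, hU1, hU2, hW, hW, hW1, hW2, hW3]
  have e1 : t * (a₂ * (t * y)) = a₂ * (t * (a₂ * y)) + g * (a₁ * y) := by
    have := congrArg (· * y) h2
    simpa only [add_mul, mul_assoc] using this
  have e2 : a₁ * (t * y) = t * (a₂ * y) + b * (a₁ * y) := by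
    have := congrArg (· * y) h1
    simpa only [add_mul, mul_assoc] using this
  rw [e1, e2, hE₁, hE₂]
  abel

/-- A braid relation for two Hecke operators is inherited by images under one of them. -/
theorem braid_apply_left {A M : Type*} [CommRing A] [AddCommGroup M] [Module A M]
    {U W : M →ₗ[A] M} {κ c : A} (hU : ∀ v, U (U v) = κ • U v + c • v)
    (hW : ∀ v, W (W v) = κ • W v + c • v) {v : M}
    (h : U (W (U v)) = W (U (W v))) : U (W (U (U v))) = W (U (W (U v))) := by
  rw [hU, h, hW, map_add, map_add, map_smul, map_smul, map_smul, map_smul, h]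

namespace TwoColor

variable {N : Bool → ℕ} {B : Type*} [Ring B] [Algebra R B] (P : TwoColor q Q hs N B)

theorem t_mul_x {c : Bool} {j : ℕ} (h : j + 1 < N c) :
    P.t c j * P.x c (j + 1) = P.x c j * P.t c j + ((q : R) - 1) • P.x c (j + 1) := by
  have h1 : P.x c (j + 1) = ((q⁻¹ : Rˣ) : R) • (P.t c j * P.x c j * P.t c j) := by
    rw [P.t_x_t, smul_smul, Units.inv_mul, one_smul]
  rw [h1, mul_smul_comm, ← mul_assoc, ← mul_assoc, P.t_sq c j h, add_mul,
    add_mul, smul_mul_assoc, smul_mul_assoc, smul_mul_assoc, smul_mul_assoc, one_mul, smul_add,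
    smul_smul, smul_smul, Units.inv_mul, one_smul, smul_smul, add_comm, mul_comm _ ((q : R) - 1)]

theorem x_mul_t {c : Bool} {j : ℕ} (h : j + 1 < N c) :
    P.x c (j + 1) * P.t c j = P.t c j * P.x c j + ((q : R) - 1) • P.x c (j + 1) := by
  have h1 : P.x c (j + 1) = ((q⁻¹ : Rˣ) : R) • (P.t c j * P.x c j * P.t c j) := by
    rw [P.t_x_t, smul_smul, Units.inv_mul, one_smul]
  rw [h1, smul_mul_assoc, mul_assoc, P.t_sq c j h, mul_add, mul_smul_comm,
    mul_smul_comm, mul_one, smul_add, smul_smul, smul_smul, smul_smul, Units.inv_mul, one_smul,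
    add_comm, mul_comm _ ((q : R) - 1)]

theorem a_mul_t_false {i j : ℕ} (hi : i < N true) (hj : j + 1 < N false) :
    P.a i j * P.t false j = P.t false j * P.a i (j + 1) + P.a' i (j + 1) * P.a i j := by
  have d1 := P.isUnit_sub' hi (show j < N false by omega)
  have d2 := P.isUnit_sub' hi hj
  have a1 := P.a_mul i j hi (by omega)
  have a2 := P.a_mul i (j + 1) hi hj
  have a1' : (P.x true i - P.x false j) * P.a i j = ((q : R) - 1) • P.x true i := by
    rw [← a1, mul_sub, sub_mul, (P.commute_a_x i j true i).eq, (P.commute_a_x i j false j).eq]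
  have a2' : P.a' i (j + 1) * (P.x true i - P.x false (j + 1)) =
      -(((q : R) - 1) • P.x false (j + 1)) := by
    rw [a', sub_mul, a2, smul_mul_assoc, one_mul, smul_sub]
    abel
  have ht := P.t_mul_x hj
  have hty : P.t false j * P.x true i = P.x true i * P.t false j :=
    P.commute_t_x false true j i (by simp)
  have hxy : P.x false (j + 1) * P.x true i = P.x true i * P.x false (j + 1) :=
    P.commute_x_x _ _ _ _
  have hc' : Commute (P.x true i - P.x false j) (P.a' i (j + 1)) :=
    P.commute_a' ((P.commute_x_x _ _ _ _).sub_left (P.commute_x_x _ _ _ _))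
      ((P.commute_x_x _ _ _ _).sub_left (P.commute_x_x _ _ _ _))
  -- after multiplication with `x - y_j` on the left and `x - y_{j+1}` on the right there are no
  -- quotients left
  refine d1.mul_left_cancel (d2.mul_right_cancel ?_)
  have e1 : (P.x true i - P.x false j) * (P.a i j * P.t false j) *
      (P.x true i - P.x false (j + 1)) =
      ((q : R) - 1) • (P.x true i * P.t false j * (P.x true i - P.x false (j + 1))) := by
    rw [← mul_assoc, a1', smul_mul_assoc, smul_mul_assoc]
  have e2 : (P.x true i - P.x false j) * (P.t false j * P.a i (j + 1)) *
      (P.x true i - P.x false (j + 1)) =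
      ((q : R) - 1) • ((P.x true i - P.x false j) * P.t false j * P.x true i) := by
    rw [mul_assoc, mul_assoc (P.t false j), a2, mul_smul_comm, mul_smul_comm, mul_assoc]
  have e3 : (P.x true i - P.x false j) * (P.a' i (j + 1) * P.a i j) *
      (P.x true i - P.x false (j + 1)) =
      -(((q : R) - 1) • ((q : R) - 1) • (P.x false (j + 1) * P.x true i)) := by
    have hy : P.x true i * (P.x true i - P.x false (j + 1)) =
        (P.x true i - P.x false (j + 1)) * P.x true i := by rw [mul_sub, sub_mul, hxy]
    rw [← mul_assoc, hc'.eq, mul_assoc (P.a' i (j + 1)), a1', mul_smul_comm, smul_mul_assoc,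
      mul_assoc, hy, ← mul_assoc, a2', neg_mul, smul_mul_assoc, smul_neg]
  rw [mul_add, add_mul, e1, e2, e3]
  have hx1 : P.x false j * P.t false j =
      P.t false j * P.x false (j + 1) - ((q : R) - 1) • P.x false (j + 1) := by
    rw [ht, add_sub_cancel_right]
  simp only [mul_sub, sub_mul, hx1, ← hty, smul_sub, smul_mul_assoc]
  simp only [mul_assoc, hxy]
  module

theorem a_mul_t_true {i j : ℕ} (hi : i + 1 < N true) (hj : j < N false) :
    P.a (i + 1) j * P.t true i = P.t true i * P.a i j + P.a' i j * P.a (i + 1) j := by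
  have d1 := P.isUnit_sub' (show i < N true by omega) hj
  have d2 := P.isUnit_sub' hi hj
  have a1 := P.a_mul i j (by omega) hj
  have a2 := P.a_mul (i + 1) j hi hj
  have a2' : (P.x true (i + 1) - P.x false j) * P.a (i + 1) j =
      ((q : R) - 1) • P.x true (i + 1) := by
    rw [← a2, mul_sub, sub_mul, (P.commute_a_x (i + 1) j true (i + 1)).eq,
      (P.commute_a_x (i + 1) j false j).eq]
  have a1' : P.a' i j * (P.x true i - P.x false j) = -(((q : R) - 1) • P.x false j) := by
    rw [a', sub_mul, a1, smul_mul_assoc, one_mul, smul_sub]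
    abel
  have hty : P.t true i * P.x false j = P.x false j * P.t true i :=
    P.commute_t_x true false i j (by simp)
  have hxy : ∀ k l, P.x true k * P.x false l = P.x false l * P.x true k :=
    fun k l => P.commute_x_x _ _ _ _
  have hxx : P.x true (i + 1) * P.x true i = P.x true i * P.x true (i + 1) :=
    P.commute_x_x _ _ _ _
  have hc' : Commute (P.x true (i + 1) - P.x false j) (P.a' i j) :=
    P.commute_a' ((P.commute_x_x _ _ _ _).sub_left (P.commute_x_x _ _ _ _))
      ((P.commute_x_x _ _ _ _).sub_left (P.commute_x_x _ _ _ _))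
  refine d2.mul_left_cancel (d1.mul_right_cancel ?_)
  have e1 : (P.x true (i + 1) - P.x false j) * (P.a (i + 1) j * P.t true i) *
      (P.x true i - P.x false j) =
      ((q : R) - 1) • (P.x true (i + 1) * P.t true i * (P.x true i - P.x false j)) := by
    rw [← mul_assoc, a2', smul_mul_assoc, smul_mul_assoc]
  have e2 : (P.x true (i + 1) - P.x false j) * (P.t true i * P.a i j) *
      (P.x true i - P.x false j) =
      ((q : R) - 1) • ((P.x true (i + 1) - P.x false j) * P.t true i * P.x true i) := by
    rw [mul_assoc, mul_assoc (P.t true i), a1, mul_smul_comm, mul_smul_comm, mul_assoc]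
  have e3 : (P.x true (i + 1) - P.x false j) * (P.a' i j * P.a (i + 1) j) *
      (P.x true i - P.x false j) =
      -(((q : R) - 1) • ((q : R) - 1) • (P.x false j * P.x true (i + 1))) := by
    have hy : P.x true (i + 1) * (P.x true i - P.x false j) =
        (P.x true i - P.x false j) * P.x true (i + 1) := by rw [mul_sub, sub_mul, hxy, hxx]
    rw [← mul_assoc, hc'.eq, mul_assoc (P.a' i j), a2', mul_smul_comm, smul_mul_assoc,
      mul_assoc, hy, ← mul_assoc, a1', neg_mul, smul_mul_assoc, smul_neg]
  rw [mul_add, add_mul, e1, e2, e3]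
  simp only [mul_sub, sub_mul, P.x_mul_t hi, add_mul, ← hty, smul_mul_assoc]
  simp only [mul_assoc, hxy]
  module

/-- The second identity behind the braid relation, a formal consequence of the first one. -/
theorem t_mul_a_mul_t {t a₁ a₂ : B} (ht : t * t = ((q : R) - 1) • t + (q : R) • 1)
    (h : a₁ * t = t * a₂ + (((q : R) - 1) • 1 - a₂) * a₁) :
    t * a₂ * t = a₂ * t * a₂ + ((q : R) • 1 + a₂ * (((q : R) - 1) • 1 - a₂)) * a₁ := by
  have h1 : t * a₂ = a₁ * t - (((q : R) - 1) • 1 - a₂) * a₁ := by rw [h, add_sub_cancel_right]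
  rw [mul_assoc a₂, h1, sub_mul, mul_assoc a₁, ht, mul_assoc _ a₁ t]
  simp only [mul_add, mul_sub, add_mul, sub_mul, mul_smul_comm, smul_mul_assoc, one_mul, mul_one]
  simp only [← mul_assoc]
  module

/-- The diagonal coefficient of `T_{k+1}` at the word `ε`. -/
def dg (k : ℕ) (ε : ℕ → Bool) : B :=
  if ε k = ε (k + 1) then P.t (ε k) (idx ε k)
  else if ε k = false then P.a (idx ε (k + 1)) (idx ε k) else P.a' (idx ε k) (idx ε (k + 1))

/-- The off-diagonal coefficient of `T_{k+1}` at the word `ε`. -/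
def off (k : ℕ) (ε : ℕ → Bool) : B :=
  if ε k = ε (k + 1) then 0 else if ε k = false then 1 else P.g (idx ε k) (idx ε (k + 1))

/-- The coefficient of `L_{k+1}` at the word `ε`. -/
def val (k : ℕ) (ε : ℕ → Bool) : B := P.x (ε k) (idx ε k)

theorem dg_congr {k : ℕ} {ε δ : ℕ → Bool} (h1 : ε k = δ k) (h2 : ε (k + 1) = δ (k + 1))
    (h3 : idx ε k = idx δ k) (h4 : idx ε (k + 1) = idx δ (k + 1)) : P.dg k ε = P.dg k δ := by
  rw [dg, dg, h1, h2, h3, h4]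

theorem off_congr {k : ℕ} {ε δ : ℕ → Bool} (h1 : ε k = δ k) (h2 : ε (k + 1) = δ (k + 1))
    (h3 : idx ε k = idx δ k) (h4 : idx ε (k + 1) = idx δ (k + 1)) : P.off k ε = P.off k δ := by
  rw [off, off, h1, h2, h3, h4]

theorem commute_dg {k : ℕ} {ε : ℕ → Bool} {z : B} (h1 : Commute z (P.val k ε))
    (h2 : Commute z (P.val (k + 1) ε))
    (h3 : ε k = ε (k + 1) → Commute z (P.t (ε k) (idx ε k))) : Commute z (P.dg k ε) := by
  rw [dg]
  unfold val at h1 h2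
  split_ifs with h h'
  · exact h3 h
  · rw [h'] at h1
    rw [Bool.eq_true_of_not_eq_false fun h'' => h (h'.trans h''.symm)] at h2
    exact P.commute_a _ _ _ h2 h1
  · have h' := Bool.eq_true_of_not_eq_false h'
    rw [h'] at h1
    rw [Bool.eq_false_of_not_eq_true fun h'' => h (h'.trans h''.symm)] at h2
    exact P.commute_a' h1 h2

theorem commute_off {k : ℕ} {ε : ℕ → Bool} {z : B} (h1 : Commute z (P.val k ε))
    (h2 : Commute z (P.val (k + 1) ε)) : Commute z (P.off k ε) := by
  rw [off]
  unfold val at h1 h2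
  split_ifs with h h'
  · exact Commute.zero_right z
  · exact Commute.one_right z
  · have h' := Bool.eq_true_of_not_eq_false h'
    rw [h'] at h1
    rw [Bool.eq_false_of_not_eq_true fun h'' => h (h'.trans h''.symm)] at h2
    exact P.commute_g h1 h2

theorem commute_val_val (k l : ℕ) (ε δ : ℕ → Bool) : Commute (P.val k ε) (P.val l δ) :=
  P.commute_x_x _ _ _ _

theorem commute_t_val {k l : ℕ} {ε : ℕ → Bool} (h : ε k = ε (k + 1)) (h1 : l ≠ k)
    (h2 : l ≠ k + 1) : Commute (P.t (ε k) (idx ε k)) (P.val l ε) := by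
  refine P.commute_t_x _ _ _ _ fun hc => ?_
  have h3 := idx_succ h
  rcases lt_or_gt_of_ne h1 with h' | h'
  · have := idx_lt_idx h' hc.symm
    omega
  · have := idx_lt_idx (show k + 1 < l by omega) (h.symm.trans hc)
    omega

theorem commute_val_dg {k l : ℕ} {ε : ℕ → Bool} (h1 : l ≠ k) (h2 : l ≠ k + 1) :
    Commute (P.val l ε) (P.dg k ε) :=
  P.commute_dg (P.commute_val_val _ _ _ _) (P.commute_val_val _ _ _ _)
    fun h => (P.commute_t_val h h1 h2).symm

theorem commute_val_off (k l : ℕ) (ε δ : ℕ → Bool) : Commute (P.val l δ) (P.off k ε) :=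
  P.commute_off (P.commute_val_val _ _ _ _) (P.commute_val_val _ _ _ _)

theorem commute_dg_dg {k l : ℕ} {ε : ℕ → Bool} (h : k + 1 < l) :
    Commute (P.dg k ε) (P.dg l ε) := by
  refine P.commute_dg (P.commute_val_dg (by omega) (by omega)).symm
    (P.commute_val_dg (by omega) (by omega)).symm fun hl => Commute.symm ?_
  refine P.commute_dg (P.commute_t_val hl (by omega) (by omega))
    (P.commute_t_val hl (by omega) (by omega)) fun hk => Commute.symm ?_
  by_cases hc : ε k = ε l
  · rw [hc]
    refine P.commute_t_t _ _ _ ?_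
    have h1 := idx_succ hk
    have h2 := idx_lt_idx h (hk.symm.trans hc)
    omega
  · exact P.commute_t_t' _ _ _ _ hc

theorem commute_dg_off {k l : ℕ} {ε : ℕ → Bool} (h : k + 1 < l ∨ l + 1 < k) :
    Commute (P.dg k ε) (P.off l ε) :=
  P.commute_off (P.commute_val_dg (by omega) (by omega)).symm
    (P.commute_val_dg (by omega) (by omega)).symm

theorem commute_off_off (k l : ℕ) (ε δ : ℕ → Bool) : Commute (P.off k ε) (P.off l δ) :=
  P.commute_off (P.commute_val_off _ _ _ _).symm (P.commute_val_off _ _ _ _).symm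

end TwoColor
end Representation

section Representation

open Polynomial

variable {R : Type u} [CommRing R] {q : Rˣ} {r : ℕ} {Q : Fin r → R} {n : ℕ} {s : ℕ} {hs : s ≤ r}

namespace TwoColor

variable {N : Bool → ℕ} {B : Type*} [Ring B] [Algebra R B] (P : TwoColor q Q hs N B)

/-- The action of `T_{k+1}` on the functions on words with values in `B`. The component of `ε` is
mapped to itself and to the component of the word with the letters at `k` and `k + 1` exchanged, by
left multiplication with the two coefficients. -/
noncomputable def op (n : ℕ) (k : ℕ) : Module.End R (Shape n N →₀ B) :=
  Finsupp.lsum R fun ε => Finsupp.lsingle ε ∘ₗ LinearMap.mulLeft R (P.dg k ε.val) +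
    Finsupp.lsingle (Shape.swap k ε) ∘ₗ LinearMap.mulLeft R (P.off k ε.val)

/-- The diagonal operator with the given coefficients. -/
noncomputable def dop (R : Type*) [CommRing R] {B : Type*} [Ring B] [Algebra R B] {S : Type*}
    (κ : S → B) : Module.End R (S →₀ B) :=
  Finsupp.lsum R fun ε => Finsupp.lsingle ε ∘ₗ LinearMap.mulLeft R (κ ε)

theorem op_single (k : ℕ) (ε : Shape n N) (y : B) : P.op n k (Finsupp.single ε y) =
    Finsupp.single ε (P.dg k ε.val * y) +
      Finsupp.single (Shape.swap k ε) (P.off k ε.val * y) := by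
  simp [op]

theorem dop_single {S : Type*} (κ : S → B) (ε : S) (y : B) :
    dop R κ (Finsupp.single ε y) = Finsupp.single ε (κ ε * y) := by
  simp [dop]

theorem dop_apply {S : Type*} (κ : S → B) (v : S →₀ B) (ε : S) :
    dop R κ v ε = κ ε * v ε := by
  classical
  induction v using Finsupp.induction_linear with
  | zero => simp
  | add v w hv hw => rw [map_add, Finsupp.add_apply, hv, hw, Finsupp.add_apply, mul_add]
  | single δ y =>
    rw [dop_single, Finsupp.single_apply, Finsupp.single_apply]
    split_ifs with h
    · rw [h]
    · rw [mul_zero]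

theorem dop_mul {S : Type*} (κ κ' : S → B) : dop R κ * dop R κ' = dop R (κ * κ') := by
  refine LinearMap.ext fun v => Finsupp.ext fun ε => ?_
  rw [Module.End.mul_apply, dop_apply, dop_apply, dop_apply, Pi.mul_apply, mul_assoc]

theorem aeval_dop {S : Type*} (κ : S → B) (p : R[X]) :
    aeval (dop R κ) p = dop R fun ε => aeval (κ ε) p := by
  induction p using Polynomial.induction_on' with
  | add p₁ p₂ h1 h2 =>
    rw [map_add, h1, h2]
    refine LinearMap.ext fun v => Finsupp.ext fun ε => ?_
    simp [dop_apply, add_mul]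
  | monomial k a =>
    have h : dop R κ ^ k = dop R (κ ^ k) := by
      induction k with
      | zero =>
        refine LinearMap.ext fun v => Finsupp.ext fun ε => ?_
        simp [dop_apply]
      | succ k ih => rw [pow_succ, ih, dop_mul, pow_succ]
    refine LinearMap.ext fun v => Finsupp.ext fun ε => ?_
    simp [aeval_monomial, h, dop_apply, mul_assoc, Algebra.smul_def]

theorem op_single_of_eq {k : ℕ} {ε : Shape n N} (h : ε.val k = ε.val (k + 1)) (y : B) :
    P.op n k (Finsupp.single ε y) =
      Finsupp.single ε (P.t (ε.val k) (idx ε.val k) * y) := by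
  rw [op_single, dg, if_pos h, off, if_pos h, zero_mul, Finsupp.single_zero, add_zero]

theorem op_single_up {k : ℕ} {ε : Shape n N} (h1 : ε.val k = false) (h2 : ε.val (k + 1) = true)
    (y : B) : P.op n k (Finsupp.single ε y) =
      Finsupp.single ε (P.a (idx ε.val (k + 1)) (idx ε.val k) * y) +
        Finsupp.single (Shape.swap k ε) y := by
  have h : ε.val k ≠ ε.val (k + 1) := by rw [h1, h2]; decide
  rw [op_single, dg, if_neg h, if_pos h1, off, if_neg h, if_pos h1, one_mul]

theorem op_single_down {k : ℕ} (hk : k + 1 < n) {ε : Shape n N} (h1 : ε.val k = false)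
    (h2 : ε.val (k + 1) = true) (y : B) : P.op n k (Finsupp.single (Shape.swap k ε) y) =
      Finsupp.single (Shape.swap k ε) (P.a' (idx ε.val (k + 1)) (idx ε.val k) * y) +
        Finsupp.single ε (P.g (idx ε.val (k + 1)) (idx ε.val k) * y) := by
  have h : ε.val k ≠ ε.val (k + 1) := by rw [h1, h2]; decide
  have h' : swp k ε.val k ≠ swp k ε.val (k + 1) := by rw [swp_left, swp_right]; exact h.symm
  have h'' : ¬ swp k ε.val k = false := by rw [swp_left, h2]; decide
  rw [op_single, Shape.swap_swap, Shape.swap_val hk, dg, if_neg h', if_neg h'', off, if_neg h',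
    if_neg h'', idx_swp_left h, idx_swp_right h]

theorem _root_.ArikiKoike.Shape.cases {k : ℕ} (hk : k + 1 < n) {p : Shape n N → Prop}
    (heq : ∀ ε : Shape n N, ε.val k = ε.val (k + 1) → p ε)
    (hne : ∀ ε : Shape n N, ε.val k = false → ε.val (k + 1) = true → p ε ∧ p (Shape.swap k ε))
    (ε : Shape n N) : p ε := by
  rcases h1 : ε.val k with _ | _ <;> rcases h2 : ε.val (k + 1) with _ | _
  · exact heq ε (h1.trans h2.symm)
  · exact (hne ε h1 h2).1
  · have := (hne (Shape.swap k ε) (by rw [Shape.swap_val hk, swp_left, h2])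
      (by rw [Shape.swap_val hk, swp_right, h1])).2
    rwa [Shape.swap_swap] at this
  · exact heq ε (h1.trans h2.symm)

/-- The bounds on the indices at an ascent. -/
theorem _root_.ArikiKoike.Shape.idx_bounds {k : ℕ} (hk : k + 1 < n) {ε : Shape n N}
    (h1 : ε.val k = false) (h2 : ε.val (k + 1) = true) :
    idx ε.val (k + 1) < N true ∧ idx ε.val k < N false := by
  have h3 := ε.idx_lt (show k < n by omega)
  have h4 := ε.idx_lt hk
  rw [h1] at h3
  rw [h2] at h4
  exact ⟨h4, h3⟩

theorem _root_.ArikiKoike.Shape.idx_bound_of_eq {k : ℕ} (hk : k + 1 < n) {ε : Shape n N}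
    (h : ε.val k = ε.val (k + 1)) : idx ε.val k + 1 < N (ε.val k) := by
  rw [← idx_succ h, h]
  exact ε.idx_lt hk

theorem op_op {k : ℕ} (hk : k + 1 < n) (v : Shape n N →₀ B) :
    P.op n k (P.op n k v) = ((q : R) - 1) • P.op n k v + (q : R) • v := by
  induction v using Finsupp.induction_linear with
  | zero => simp
  | add v w hv hw => rw [map_add, map_add, hv, hw, smul_add, smul_add]; abel
  | single ε y =>
    refine Shape.cases hk (p := fun ε => ∀ y, P.op n k (P.op n k (Finsupp.single ε y)) =
      ((q : R) - 1) • P.op n k (Finsupp.single ε y) + (q : R) • Finsupp.single ε y)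
      (fun ε h y => ?_) (fun ε h1 h2 => ⟨fun y => ?_, fun y => ?_⟩) ε y
    · rw [P.op_single_of_eq h, P.op_single_of_eq h, ← mul_assoc,
        P.t_sq _ _ (Shape.idx_bound_of_eq hk h), Finsupp.smul_single, Finsupp.smul_single,
        ← Finsupp.single_add, add_mul, smul_mul_assoc, smul_mul_assoc, one_mul]
    · rw [P.op_single_up h1 h2, map_add, P.op_single_up h1 h2, P.op_single_down hk h1 h2, smul_add]
      have e1 : P.a (idx ε.val (k + 1)) (idx ε.val k) *
          (P.a (idx ε.val (k + 1)) (idx ε.val k) * y) +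
          P.g (idx ε.val (k + 1)) (idx ε.val k) * y =
          ((q : R) - 1) • (P.a (idx ε.val (k + 1)) (idx ε.val k) * y) + (q : R) • y := by
        rw [g, a']
        simp only [mul_sub, add_mul, sub_mul, mul_smul_comm, smul_mul_assoc, mul_one, one_mul,
          mul_assoc]
        abel
      have e2 : P.a (idx ε.val (k + 1)) (idx ε.val k) * y +
          P.a' (idx ε.val (k + 1)) (idx ε.val k) * y = ((q : R) - 1) • y := by
        rw [a', sub_mul, smul_mul_assoc, one_mul]
        abel
      have e3 := congrArg (Finsupp.single ε) e1
      have e4 := congrArg (Finsupp.single (Shape.swap k ε)) e2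
      simp only [Finsupp.single_add, ← Finsupp.smul_single] at e3 e4
      linear_combination (norm := abel) e3 + e4
    · rw [P.op_single_down hk h1 h2, map_add, P.op_single_up h1 h2, P.op_single_down hk h1 h2,
        smul_add]
      have hc := P.commute_a_a' (idx ε.val (k + 1)) (idx ε.val k)
        (idx ε.val (k + 1)) (idx ε.val k)
      have e1 : P.a' (idx ε.val (k + 1)) (idx ε.val k) *
          (P.a' (idx ε.val (k + 1)) (idx ε.val k) * y) +
          P.g (idx ε.val (k + 1)) (idx ε.val k) * y =
          ((q : R) - 1) • (P.a' (idx ε.val (k + 1)) (idx ε.val k) * y) + (q : R) • y := by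
        have : P.a (idx ε.val (k + 1)) (idx ε.val k) =
            ((q : R) - 1) • 1 - P.a' (idx ε.val (k + 1)) (idx ε.val k) := by
          rw [a', sub_sub_cancel]
        rw [g, this]
        simp only [add_mul, sub_mul, smul_mul_assoc, one_mul, mul_assoc]
        abel
      have e2 : P.g (idx ε.val (k + 1)) (idx ε.val k) *
            (P.a' (idx ε.val (k + 1)) (idx ε.val k) * y) +
          P.a (idx ε.val (k + 1)) (idx ε.val k) *
            (P.g (idx ε.val (k + 1)) (idx ε.val k) * y) =
          ((q : R) - 1) • (P.g (idx ε.val (k + 1)) (idx ε.val k) * y) := by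
        have hg : Commute (P.a (idx ε.val (k + 1)) (idx ε.val k))
            (P.g (idx ε.val (k + 1)) (idx ε.val k)) :=
          P.commute_g (P.commute_a_x _ _ _ _) (P.commute_a_x _ _ _ _)
        rw [← mul_assoc, ← mul_assoc, ← add_mul, hg.eq, ← mul_add, a', sub_add_cancel,
          mul_smul_comm, mul_one, smul_mul_assoc]
      have e3 := congrArg (Finsupp.single (Shape.swap k ε)) e1
      have e4 := congrArg (Finsupp.single ε) e2
      simp only [Finsupp.single_add, ← Finsupp.smul_single] at e3 e4
      linear_combination (norm := abel) e3 + e4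

/-- The operators which are to be the `L_{k+1}` satisfy `T_{k+1} L_{k+1} T_{k+1} = q L_{k+2}`. -/
theorem op_dop_op {k : ℕ} (hk : k + 1 < n) (v : Shape n N →₀ B) :
    P.op n k (dop R (fun ε => P.val k ε.val) (P.op n k v)) =
      (q : R) • dop R (fun ε => P.val (k + 1) ε.val) v := by
  induction v using Finsupp.induction_linear with
  | zero => simp
  | add v w hv hw => rw [map_add, map_add, map_add, hv, hw, map_add, smul_add]
  | single ε y =>
    refine Shape.cases hk (p := fun ε => ∀ y,
      P.op n k (dop R (fun ε => P.val k ε.val) (P.op n k (Finsupp.single ε y))) =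
      (q : R) • dop R (fun ε => P.val (k + 1) ε.val) (Finsupp.single ε y))
      (fun ε h y => ?_) (fun ε h1 h2 => ?_) ε y
    · rw [P.op_single_of_eq h, dop_single, P.op_single_of_eq h, dop_single, Finsupp.smul_single,
        val, val, idx_succ h, ← h, ← mul_assoc, ← mul_assoc, P.t_x_t, smul_mul_assoc]
    · have hne : ε.val k ≠ ε.val (k + 1) := by rw [h1, h2]; decide
      obtain ⟨hi, hj⟩ := Shape.idx_bounds hk h1 h2
      have v1 : P.val k ε.val = P.x false (idx ε.val k) := by rw [val, h1]
      have v2 : P.val (k + 1) ε.val = P.x true (idx ε.val (k + 1)) := by rw [val, h2]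
      have v3 : P.val k (Shape.swap k ε).val = P.x true (idx ε.val (k + 1)) := by
        rw [val, Shape.swap_val hk, swp_left, idx_swp_left hne, h2]
      have v4 : P.val (k + 1) (Shape.swap k ε).val = P.x false (idx ε.val k) := by
        rw [val, Shape.swap_val hk, swp_right, idx_swp_right hne, h1]
      have ha := P.a_mul_add hi hj
      have hax := (P.commute_a_x (idx ε.val (k + 1)) (idx ε.val k) true (idx ε.val (k + 1))).eq
      have hay := (P.commute_a_x (idx ε.val (k + 1)) (idx ε.val k) false (idx ε.val k)).eq
      have hgx : P.g (idx ε.val (k + 1)) (idx ε.val k) * P.x true (idx ε.val (k + 1)) =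
          P.x true (idx ε.val (k + 1)) * P.g (idx ε.val (k + 1)) (idx ε.val k) :=
        (P.commute_g (P.commute_x_x _ _ _ _) (P.commute_x_x _ _ _ _)).symm.eq
      have hgy : P.g (idx ε.val (k + 1)) (idx ε.val k) * P.x false (idx ε.val k) =
          P.x false (idx ε.val k) * P.g (idx ε.val (k + 1)) (idx ε.val k) :=
        (P.commute_g (P.commute_x_x _ _ _ _) (P.commute_x_x _ _ _ _)).symm.eq
      have hax' : P.a' (idx ε.val (k + 1)) (idx ε.val k) * P.x true (idx ε.val (k + 1)) =
          P.x true (idx ε.val (k + 1)) * P.a' (idx ε.val (k + 1)) (idx ε.val k) :=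
        (P.commute_a' (P.commute_x_x _ _ _ _) (P.commute_x_x _ _ _ _)).symm.eq
      have hay' : P.a' (idx ε.val (k + 1)) (idx ε.val k) * P.x false (idx ε.val k) =
          P.x false (idx ε.val k) * P.a' (idx ε.val (k + 1)) (idx ε.val k) :=
        (P.commute_a' (P.commute_x_x _ _ _ _) (P.commute_x_x _ _ _ _)).symm.eq
      have haa : P.a (idx ε.val (k + 1)) (idx ε.val k) * P.a' (idx ε.val (k + 1)) (idx ε.val k) =
          P.a' (idx ε.val (k + 1)) (idx ε.val k) * P.a (idx ε.val (k + 1)) (idx ε.val k) :=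
        (P.commute_a_a' _ _ _ _).eq
      have hg : P.g (idx ε.val (k + 1)) (idx ε.val k) = (q : R) • 1 +
          P.a (idx ε.val (k + 1)) (idx ε.val k) * P.a' (idx ε.val (k + 1)) (idx ε.val k) := rfl
      generalize P.x true (idx ε.val (k + 1)) = X at *
      generalize P.x false (idx ε.val k) = Y at *
      have op1 := P.op_single_up h1 h2
      have op2 := P.op_single_down hk h1 h2
      generalize P.a (idx ε.val (k + 1)) (idx ε.val k) = a at *
      generalize P.a' (idx ε.val (k + 1)) (idx ε.val k) = b at *
      generalize P.g (idx ε.val (k + 1)) (idx ε.val k) = g at *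
      have eX : b * X = -(a * Y) := by rw [← sub_eq_zero, sub_neg_eq_add, add_comm, ha]
      constructor
      · intro y
        simp only [op1, map_add, dop_single, op2, v1, v2, v3]
        have e1 : a * (Y * (a * y)) + g * (X * y) = (q : R) • (X * y) := by
          rw [hg, add_mul, ← mul_assoc (a * b), mul_assoc a b X, eX, ← mul_assoc Y, ← hay,
            smul_mul_assoc, one_mul]
          simp only [mul_neg, neg_mul, mul_assoc]
          abel
        have e2 : Y * (a * y) + b * (X * y) = 0 := by
          rw [← mul_assoc b, eX, ← mul_assoc Y, ← hay, neg_mul, add_neg_cancel]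
        rw [Finsupp.smul_single, ← e1, Finsupp.single_add]
        have e3 := congrArg (Finsupp.single (Shape.swap k ε)) e2
        rw [Finsupp.single_add, Finsupp.single_zero] at e3
        linear_combination (norm := abel) e3
      · intro y
        simp only [op2, map_add, dop_single, op1, v1, v3, v4]
        have e1 : b * (X * (b * y)) + Y * (g * y) = (q : R) • (Y * y) := by
          rw [← mul_assoc b, eX, ← mul_assoc Y, ← hgy, hg, add_mul, smul_mul_assoc, one_mul,
            add_mul, smul_mul_assoc, mul_assoc a b Y, hay']
          simp only [neg_mul, mul_assoc]
          abel
        have e2 : g * (X * (b * y)) + a * (Y * (g * y)) = 0 := by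
          have : X * (b * y) = -(a * (Y * y)) := by
            rw [← mul_assoc, ← hax', eX, neg_mul, mul_assoc]
          have hga : g * a = a * g := by
            rw [hg, add_mul, mul_add, smul_mul_assoc, mul_smul_comm, one_mul, mul_one, mul_assoc,
              ← haa]
          rw [this, mul_neg, ← mul_assoc, hga, mul_assoc, ← mul_assoc g, hgy, mul_assoc,
            neg_add_cancel]
        rw [Finsupp.smul_single, ← e1, Finsupp.single_add]
        have e3 := congrArg (Finsupp.single ε) e2
        rw [Finsupp.single_add, Finsupp.single_zero] at e3
        linear_combination (norm := abel) e3

theorem op_dop_comm {k l : ℕ} (hk : k + 1 < n) (h1 : l ≠ k) (h2 : l ≠ k + 1)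
    (v : Shape n N →₀ B) : P.op n k (dop R (fun ε => P.val l ε.val) v) =
      dop R (fun ε => P.val l ε.val) (P.op n k v) := by
  induction v using Finsupp.induction_linear with
  | zero => simp
  | add v w hv hw => simp only [map_add, hv, hw]
  | single ε y =>
    have hv : P.val l (Shape.swap k ε).val = P.val l ε.val := by
      rw [val, val, Shape.swap_val hk, swp_of_ne _ h1 h2, idx_swp_of_ne _ h1 h2]
    simp only [dop_single, op_single, map_add, hv]
    rw [← mul_assoc, ← mul_assoc, ← (P.commute_val_dg h1 h2).eq,
      ← (P.commute_val_off k l ε.val ε.val).eq, mul_assoc, mul_assoc]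

theorem op_op_comm {k l : ℕ} (hkl : k + 1 < l) (hl : l + 1 < n) (v : Shape n N →₀ B) :
    P.op n k (P.op n l v) = P.op n l (P.op n k v) := by
  induction v using Finsupp.induction_linear with
  | zero => simp
  | add v w hv hw => simp only [map_add, hv, hw]
  | single ε y =>
    have hk : k + 1 < n := by omega
    have e1 : P.dg k (Shape.swap l ε).val = P.dg k ε.val := by
      rw [Shape.swap_val hl]
      exact P.dg_congr (swp_of_ne _ (by omega) (by omega)) (swp_of_ne _ (by omega) (by omega))
        (idx_swp_of_ne _ (by omega) (by omega)) (idx_swp_of_ne _ (by omega) (by omega))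
    have e2 : P.off k (Shape.swap l ε).val = P.off k ε.val := by
      rw [Shape.swap_val hl]
      exact P.off_congr (swp_of_ne _ (by omega) (by omega)) (swp_of_ne _ (by omega) (by omega))
        (idx_swp_of_ne _ (by omega) (by omega)) (idx_swp_of_ne _ (by omega) (by omega))
    have e3 : P.dg l (Shape.swap k ε).val = P.dg l ε.val := by
      rw [Shape.swap_val hk]
      exact P.dg_congr (swp_of_ne _ (by omega) (by omega)) (swp_of_ne _ (by omega) (by omega))
        (idx_swp_of_ne _ (by omega) (by omega)) (idx_swp_of_ne _ (by omega) (by omega))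
    have e4 : P.off l (Shape.swap k ε).val = P.off l ε.val := by
      rw [Shape.swap_val hk]
      exact P.off_congr (swp_of_ne _ (by omega) (by omega)) (swp_of_ne _ (by omega) (by omega))
        (idx_swp_of_ne _ (by omega) (by omega)) (idx_swp_of_ne _ (by omega) (by omega))
    simp only [op_single, map_add, e1, e2, e3, e4, Shape.swap_comm hkl hl]
    simp only [← mul_assoc]
    rw [(P.commute_dg_dg hkl).eq, (P.commute_dg_off (Or.inl hkl)).eq,
      ← (P.commute_dg_off (Or.inr hkl)).eq, (P.commute_off_off k l ε.val ε.val).eq]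
    abel

theorem op_braid {k : ℕ} (hk : k + 2 < n) (v : Shape n N →₀ B) :
    P.op n k (P.op n (k + 1) (P.op n k v)) = P.op n (k + 1) (P.op n k (P.op n (k + 1) v)) := by
  have hk' : k + 1 < n := by omega
  set U := P.op n k with hU
  set W := P.op n (k + 1) with hW
  have hUU : ∀ v, U (U v) = ((q : R) - 1) • U v + (q : R) • v := P.op_op hk'
  have hWW : ∀ v, W (W v) = ((q : R) - 1) • W v + (q : R) • v := P.op_op hk
  let Good : (Shape n N →₀ B) → Prop := fun v => U (W (U v)) = W (U (W v))
  have hadd : ∀ v w, Good v → Good w → Good (v + w) := by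
    intro v w h1 h2
    simp only [Good, map_add] at h1 h2 ⊢
    rw [h1, h2]
  have hsub : ∀ v w, Good v → Good w → Good (v - w) := by
    intro v w h1 h2
    simp only [Good, map_sub] at h1 h2 ⊢
    rw [h1, h2]
  have goodU : ∀ v, Good v → Good (U v) := fun v h => braid_apply_left hUU hWW h
  have goodW : ∀ v, Good v → Good (W v) := fun v h => (braid_apply_left hWW hUU h.symm).symm
  induction v using Finsupp.induction_linear with
  | zero => simp
  | add v w hv hw => exact hadd v w hv hw
  | single ε y =>
    -- the words for which the relation holds on all of the component
    suffices h : ∀ ε : Shape n N, ∀ y, Good (Finsupp.single ε y) from h ε y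
    have hall : ∀ ε : Shape n N, ε.val k = ε.val (k + 1) → ε.val (k + 1) = ε.val (k + 2) →
        ∀ y, Good (Finsupp.single ε y) := by
      intro ε h1 h2 y
      simp only [Good, hU, hW, P.op_single_of_eq h1, P.op_single_of_eq h2]
      rw [← h1, idx_succ h1]
      simp only [← mul_assoc, P.t_braid]
    have hfft : ∀ ε : Shape n N, ε.val k = false → ε.val (k + 1) = false → ε.val (k + 2) = true →
        ∀ y, Good (Finsupp.single ε y) ∧ Good (Finsupp.single (Shape.swap (k + 1) ε) y) ∧
          Good (Finsupp.single (Shape.swap k (Shape.swap (k + 1) ε)) y) := by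
      intro ε h1 h2 h3
      set ε₂ := Shape.swap (k + 1) ε with hε₂
      set ε₃ := Shape.swap k ε₂ with hε₃
      have v₂ : ε₂.val = swp (k + 1) ε.val := Shape.swap_val hk ε
      have v₃ : ε₃.val = swp k ε₂.val := Shape.swap_val hk' ε₂
      have hne : ε.val (k + 1) ≠ ε.val (k + 1 + 1) := by rw [h2, h3]; decide
      have p1 : ε₂.val k = false := by rw [v₂, swp_of_ne _ (by omega) (by omega), h1]
      have p2 : ε₂.val (k + 1) = true := by rw [v₂, swp_left]; exact h3
      have p3 : ε₂.val (k + 2) = false := by rw [v₂]; exact (swp_right _ _).trans h2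
      have i1 : idx ε₂.val k = idx ε.val k := by rw [v₂, idx_swp_of_ne _ (by omega) (by omega)]
      have i2 : idx ε₂.val (k + 1) = idx ε.val (k + 2) := by rw [v₂]; exact idx_swp_left hne
      have hne₂ : ε₂.val k ≠ ε₂.val (k + 1) := by rw [p1, p2]; decide
      have p4 : ε₃.val (k + 1) = false := by rw [v₃, swp_right, p1]
      have p5 : ε₃.val (k + 1 + 1) = false := by
        rw [v₃, swp_of_ne _ (by omega) (by omega)]; exact p3
      have i3 : idx ε₃.val (k + 1) = idx ε.val k := by rw [v₃, idx_swp_right hne₂, i1]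
      have i4 : idx ε.val (k + 1) = idx ε.val k + 1 := idx_succ (h1.trans h2.symm)
      obtain ⟨b1, b2⟩ := Shape.idx_bounds hk h2 h3
      rw [i4] at b2
      have w1 : ∀ y, W (Finsupp.single ε y) = Finsupp.single ε
          (P.a (idx ε.val (k + 2)) (idx ε.val k + 1) * y) + Finsupp.single ε₂ y := by
        intro y
        rw [hW, P.op_single_up h2 h3, ← i4]
      have u2 : ∀ y, U (Finsupp.single ε₂ y) = Finsupp.single ε₂
          (P.a (idx ε.val (k + 2)) (idx ε.val k) * y) + Finsupp.single ε₃ y := by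
        intro y
        rw [hU, P.op_single_up p1 p2, i1, i2]
      have base : ∀ y, Good (Finsupp.single ε y) := by
        have id1 := P.a_mul_t_false b1 b2
        refine braid_of_three U W (map_add U) (map_add W) (Finsupp.single ε) (Finsupp.single ε₂)
          (Finsupp.single ε₃) (Finsupp.single_add ε) (Finsupp.single_add ε₂) (fun y => ?_) w1 u2
          (fun y => ?_) (fun y => ?_) id1
          (t_mul_a_mul_t (P.t_sq false _ b2) id1)
        · rw [hU, P.op_single_of_eq (h1.trans h2.symm), h1]
        · rw [hW, hε₂, P.op_single_down hk h2 h3, ← i4]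
          rfl
        · rw [hW, P.op_single_of_eq (p4.trans p5.symm), p4, i3]
      have good2 : ∀ y, Good (Finsupp.single ε₂ y) := by
        intro y
        have := hsub _ _ (goodW _ (base y))
          (base (P.a (idx ε.val (k + 2)) (idx ε.val k + 1) * y))
        rwa [w1, add_sub_cancel_left] at this
      refine fun y => ⟨base y, good2 y, ?_⟩
      have := hsub _ _ (goodU _ (good2 y)) (good2 (P.a (idx ε.val (k + 2)) (idx ε.val k) * y))
      rwa [u2, add_sub_cancel_left] at this
    have hftt : ∀ ε : Shape n N, ε.val k = false → ε.val (k + 1) = true → ε.val (k + 2) = true →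
        ∀ y, Good (Finsupp.single ε y) ∧ Good (Finsupp.single (Shape.swap k ε) y) ∧
          Good (Finsupp.single (Shape.swap (k + 1) (Shape.swap k ε)) y) := by
      intro ε h1 h2 h3
      set ε₂ := Shape.swap k ε with hε₂
      set ε₃ := Shape.swap (k + 1) ε₂ with hε₃
      have v₂ : ε₂.val = swp k ε.val := Shape.swap_val hk' ε
      have v₃ : ε₃.val = swp (k + 1) ε₂.val := Shape.swap_val hk ε₂
      have hne : ε.val k ≠ ε.val (k + 1) := by rw [h1, h2]; decide
      have p1 : ε₂.val k = true := by rw [v₂, swp_left, h2]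
      have p2 : ε₂.val (k + 1) = false := by rw [v₂, swp_right, h1]
      have p3 : ε₂.val (k + 1 + 1) = true := by
        rw [v₂, swp_of_ne _ (by omega) (by omega)]; exact h3
      have i1 : idx ε₂.val (k + 1) = idx ε.val k := by rw [v₂, idx_swp_right hne]
      have i2 : idx ε₂.val (k + 1 + 1) = idx ε.val (k + 2) := by
        rw [v₂, idx_swp_of_ne _ (by omega) (by omega)]
      have hne₂ : ε₂.val (k + 1) ≠ ε₂.val (k + 1 + 1) := by rw [p2, p3]; decide
      have p4 : ε₃.val k = true := by rw [v₃, swp_of_ne _ (by omega) (by omega), p1]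
      have p5 : ε₃.val (k + 1) = true := by rw [v₃, swp_left, p3]
      have i0 : idx ε₂.val k = idx ε.val (k + 1) := by rw [v₂, idx_swp_left hne]
      have i3 : idx ε₃.val k = idx ε.val (k + 1) := by
        rw [v₃, idx_swp_of_ne _ (by omega) (by omega), i0]
      have i4 : idx ε.val (k + 2) = idx ε.val (k + 1) + 1 := idx_succ (h2.trans h3.symm)
      have b1 : idx ε.val (k + 1) + 1 < N true := by
        have := ε.idx_lt hk
        rwa [i4, h3] at this
      have b2 := (Shape.idx_bounds hk' h1 h2).2
      have u1 : ∀ y, U (Finsupp.single ε y) = Finsupp.single ε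
          (P.a (idx ε.val (k + 1)) (idx ε.val k) * y) + Finsupp.single ε₂ y := by
        intro y
        rw [hU, P.op_single_up h1 h2]
      have w2 : ∀ y, W (Finsupp.single ε₂ y) = Finsupp.single ε₂
          (P.a (idx ε.val (k + 1) + 1) (idx ε.val k) * y) + Finsupp.single ε₃ y := by
        intro y
        rw [hW, P.op_single_up p2 p3, i1, i2, i4]
      have base : ∀ y, Good (Finsupp.single ε y) := by
        have id1 := P.a_mul_t_true b1 b2
        refine fun y => (braid_of_three W U (map_add W) (map_add U) (Finsupp.single ε)
          (Finsupp.single ε₂) (Finsupp.single ε₃) (Finsupp.single_add ε) (Finsupp.single_add ε₂)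
          (fun y => ?_) u1 w2 (fun y => ?_) (fun y => ?_) id1
          (t_mul_a_mul_t (P.t_sq true _ b1) id1) y).symm
        · rw [hW, P.op_single_of_eq (h2.trans h3.symm), h2]
        · rw [hU, hε₂, P.op_single_down hk' h1 h2]
          rfl
        · rw [hU, P.op_single_of_eq (p4.trans p5.symm), p4, i3]
      have good2 : ∀ y, Good (Finsupp.single ε₂ y) := by
        intro y
        have := hsub _ _ (goodU _ (base y))
          (base (P.a (idx ε.val (k + 1)) (idx ε.val k) * y))
        rwa [u1, add_sub_cancel_left] at this
      refine fun y => ⟨base y, good2 y, ?_⟩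
      have := hsub _ _ (goodW _ (good2 y))
        (good2 (P.a (idx ε.val (k + 1) + 1) (idx ε.val k) * y))
      rwa [w2, add_sub_cancel_left] at this
    intro ε
    have sk : (Shape.swap k ε).val = swp k ε.val := Shape.swap_val hk' ε
    have sk1 : (Shape.swap (k + 1) ε).val = swp (k + 1) ε.val := Shape.swap_val hk ε
    have c1 : swp k ε.val k = ε.val (k + 1) := swp_left _ _
    have c2 : swp k ε.val (k + 1) = ε.val k := swp_right _ _
    have c3 : swp k ε.val (k + 2) = ε.val (k + 2) := swp_of_ne _ (by omega) (by omega)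
    have d1 : swp (k + 1) ε.val k = ε.val k := swp_of_ne _ (by omega) (by omega)
    have d2 : swp (k + 1) ε.val (k + 1) = ε.val (k + 2) := swp_left _ _
    have d3 : swp (k + 1) ε.val (k + 2) = ε.val (k + 1) := swp_right _ _
    rcases h1 : ε.val k with _ | _ <;> rcases h2 : ε.val (k + 1) with _ | _ <;>
      rcases h3 : ε.val (k + 2) with _ | _
    · exact hall ε (h1.trans h2.symm) (h2.trans h3.symm)
    · exact fun y => (hfft ε h1 h2 h3 y).1
    · intro y
      have := (hfft (Shape.swap (k + 1) ε) (by rw [sk1, d1, h1]) (by rw [sk1, d2, h3])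
        (by rw [sk1, d3, h2]) y).2.1
      rwa [Shape.swap_swap] at this
    · exact fun y => (hftt ε h1 h2 h3 y).1
    · intro y
      have e : (Shape.swap (k + 1) (Shape.swap k ε)).val = swp (k + 1) (swp k ε.val) := by
        rw [Shape.swap_val hk, sk]
      have := (hfft (Shape.swap (k + 1) (Shape.swap k ε))
        (by rw [e, swp_of_ne _ (by omega) (by omega), c1, h2])
        (by rw [e, swp_left]; exact c3.trans h3)
        (by rw [e]; exact (swp_right _ _).trans (c2.trans h1)) y).2.2
      rwa [Shape.swap_swap, Shape.swap_swap] at this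
    · intro y
      have := (hftt (Shape.swap k ε) (by rw [sk, c1, h2]) (by rw [sk, c2, h1])
        (by rw [sk, c3, h3]) y).2.1
      rwa [Shape.swap_swap] at this
    · intro y
      have e : (Shape.swap k (Shape.swap (k + 1) ε)).val = swp k (swp (k + 1) ε.val) := by
        rw [Shape.swap_val hk', sk1]
      have := (hftt (Shape.swap k (Shape.swap (k + 1) ε))
        (by rw [e, swp_left, d2, h3]) (by rw [e, swp_right, d1, h1])
        (by rw [e, swp_of_ne _ (by omega) (by omega)]; exact d3.trans h2) y).2.2
      rwa [Shape.swap_swap, Shape.swap_swap] at this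
    · exact hall ε (h1.trans h2.symm) (h2.trans h3.symm)

/-- The images of the generators in the representation on words. -/
noncomputable def gen (n : ℕ) : ℕ → Module.End R (Shape n N →₀ B)
  | 0 => dop R fun ε => P.val 0 ε.val
  | k + 1 => P.op n k

theorem aeval_dop_val_zero (hn : 0 < n) :
    aeval (dop R fun ε : Shape n N => P.val 0 ε.val) (paramPoly Q) = 0 := by
  rw [aeval_dop, ← paramPoly_mul Q hs]
  refine LinearMap.ext fun v => Finsupp.ext fun ε => ?_
  rw [dop_apply]
  have h := P.ann (ε.val 0) 0 (by have := ε.idx_lt hn; rwa [idx, cnt_zero] at this)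
  change _ = (0 : B)
  suffices h' : aeval (P.val 0 ε.val)
      (paramPoly (firstParams Q hs) * paramPoly (lastParams Q hs)) = 0 by rw [h', zero_mul]
  rw [val, idx, cnt_zero]
  rcases hc : ε.val 0 with _ | _
  · rw [hc] at h
    have h' : aeval (P.x false 0) (paramPoly (lastParams Q hs)) = 0 := h
    rw [map_mul, h', mul_zero]
  · rw [hc] at h
    have h' : aeval (P.x true 0) (paramPoly (firstParams Q hs)) = 0 := h
    rw [map_mul, h', zero_mul]

theorem gen_braid_zero (hn : 1 < n) : P.gen n 0 * P.gen n 1 * P.gen n 0 * P.gen n 1 =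
    P.gen n 1 * P.gen n 0 * P.gen n 1 * P.gen n 0 := by
  have h : P.gen n 1 * P.gen n 0 * P.gen n 1 =
      (q : R) • dop R fun ε : Shape n N => P.val 1 ε.val :=
    LinearMap.ext fun v => P.op_dop_op (n := n) (k := 0) (by omega) v
  rw [h, mul_assoc, mul_assoc, ← mul_assoc (P.gen n 1), h, gen, smul_mul_assoc, mul_smul_comm,
    dop_mul, dop_mul]
  congr 2
  funext ε
  exact (P.commute_val_val _ _ _ _).eq

theorem gen_comm {i j : ℕ} (hij : i + 1 < j) (hj : j < n) :
    P.gen n i * P.gen n j = P.gen n j * P.gen n i := by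
  obtain ⟨l, rfl⟩ : ∃ l, j = l + 1 := ⟨j - 1, by omega⟩
  rcases i with _ | k
  · refine LinearMap.ext fun v => ?_
    rw [Module.End.mul_apply, Module.End.mul_apply, gen, gen]
    exact (P.op_dop_comm (k := l) (l := 0) hj (by omega) (by omega) v).symm
  · refine LinearMap.ext fun v => ?_
    rw [Module.End.mul_apply, Module.End.mul_apply, gen, gen]
    exact P.op_op_comm (k := k) (l := l) (by omega) hj v

theorem gen_sq {i : ℕ} (h1 : 1 ≤ i) (hi : i < n) :
    P.gen n i * P.gen n i = ((q : R) - 1) • P.gen n i + (q : R) • 1 := by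
  obtain ⟨k, rfl⟩ : ∃ k, i = k + 1 := ⟨i - 1, by omega⟩
  refine LinearMap.ext fun v => ?_
  rw [Module.End.mul_apply, gen]
  exact P.op_op hi v

theorem gen_braid {i : ℕ} (h1 : 1 ≤ i) (hi : i + 1 < n) :
    P.gen n (i + 1) * P.gen n i * P.gen n (i + 1) = P.gen n i * P.gen n (i + 1) * P.gen n i := by
  obtain ⟨k, rfl⟩ : ∃ k, i = k + 1 := ⟨i - 1, by omega⟩
  refine LinearMap.ext fun v => ?_
  simp only [Module.End.mul_apply, gen]
  exact (P.op_braid (k := k) (by omega) v).symm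

theorem gen_cyclotomic (hn : 0 < n) : (List.ofFn fun t : Fin r =>
    P.gen n 0 - algebraMap R (Module.End R (Shape n N →₀ B)) (Q t)).prod = 0 :=
  (aeval_paramPoly Q (P.gen n 0)).symm.trans (P.aeval_dop_val_zero hn)

/-- The Ariki–Koike algebra acts on the functions on words, `L_{k+1}` through a diagonal operator.
This is a form of induction from `H_b ⊗ H_{n-b}` which does not use a basis of the algebra. -/
theorem exists_rep : ∃ Φ : ArikiKoike q Q n →ₐ[R] Module.End R (Shape n N →₀ B),
    (∀ k, k + 1 < n → Φ (T q Q n (k + 1)) = P.op n k) ∧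
    (∀ k, k < n → Φ (jm q Q n k) = dop R fun ε => P.val k ε.val) := by
  obtain ⟨Φ, hΦ⟩ := exists_lift q Q n (P.gen n)
    P.gen_cyclotomic P.gen_braid_zero (fun i => P.gen_sq) (fun i => P.gen_braid)
    (fun i j => P.gen_comm)
  refine ⟨Φ, fun k hk => hΦ _ hk, fun k => ?_⟩
  induction k with
  | zero => exact fun hk => hΦ 0 hk
  | succ k ih =>
    intro hk
    rw [jm_succ, map_smul, map_mul, map_mul, hΦ _ hk, ih (by omega)]
    refine LinearMap.ext fun v => ?_
    change ((q⁻¹ : Rˣ) : R) • P.op n k (dop R _ (P.op n k v)) = _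
    rw [P.op_dop_op hk, smul_smul, Units.inv_mul, one_smul]

end TwoColor
end Representation

section Representation

open Polynomial

variable {R : Type u} [CommRing R] {q : Rˣ} {r : ℕ} {Q : Fin r → R} {n : ℕ} {s : ℕ} {hs : s ≤ r}

namespace TwoColor

variable {N : Bool → ℕ} {B : Type*} [Ring B] [Algebra R B] (P : TwoColor q Q hs N B)

/-- The representation of the Ariki–Koike algebra on the functions on words. -/
noncomputable def rep (n : ℕ) : ArikiKoike q Q n →ₐ[R] Module.End R (Shape n N →₀ B) :=
  P.exists_rep.choose

theorem rep_T {k : ℕ} (hk : k + 1 < n) : P.rep n (T q Q n (k + 1)) = P.op n k :=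
  P.exists_rep.choose_spec.1 k hk

theorem rep_jm {k : ℕ} (hk : k < n) :
    P.rep n (jm q Q n k) = dop R fun ε => P.val k ε.val :=
  P.exists_rep.choose_spec.2 k hk

theorem rep_aeval_jm {k : ℕ} (hk : k < n) (p : R[X]) (v : Shape n N →₀ B) (ε : Shape n N) :
    P.rep n (aeval (jm q Q n k) p) v ε = aeval (P.val k ε.val) p * v ε := by
  rw [← aeval_algHom_apply, P.rep_jm hk, aeval_dop, dop_apply]

theorem ann_val (ε : Shape n N) {k : ℕ} (hk : k < n) :
    aeval (P.val k ε.val) (colorPoly q Q hs (ε.val k) (idx ε.val k)) = 0 :=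
  P.ann _ _ (ε.idx_lt hk)

/-- The idempotent of a word acts as the projection to the component of that word. -/
theorem rep_idem_apply_of_eq (hf : IsUnit (fPoly q Q n hs)) {δ : ℕ → Bool} {ε : Shape n N}
    {k : ℕ} (hk : k ≤ n) (h : ∀ p < k, δ p = ε.val p) (v : Shape n N →₀ B) :
    P.rep n (idem q Q n hs δ k) v ε = v ε := by
  rw [idem_congr q Q n hs h]
  clear h
  induction k with
  | zero => rw [idem, map_one, Module.End.one_apply]
  | succ k ih =>
    rw [idem_succ', map_mul, Module.End.mul_apply, P.rep_aeval_jm hk, ih (by omega)]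
    refine aeval_sepPoly_mul_eq_self hf hk ?_
    rw [← idx, P.ann_val ε hk, zero_mul]

theorem rep_idem_apply_of_ne {δ : ℕ → Bool} {ε : Shape n N} {k : ℕ} (hk : k ≤ n)
    (h : ∃ p < k, δ p ≠ ε.val p) (v : Shape n N →₀ B) :
    P.rep n (idem q Q n hs δ k) v ε = 0 := by
  induction k with
  | zero => obtain ⟨p, hp, -⟩ := h; omega
  | succ k ih =>
    rw [idem_succ', map_mul, Module.End.mul_apply, P.rep_aeval_jm hk]
    by_cases h' : ∃ p < k, δ p ≠ ε.val p
    · rw [ih (by omega) h', mul_zero]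
    · have h' : ∀ p < k, δ p = ε.val p := fun p hp => by
        by_contra hne
        exact h' ⟨p, hp, hne⟩
      obtain ⟨p, hp, hne⟩ := h
      have hpk : p = k := by
        by_contra hpk
        exact hne (h' p (by omega))
      subst hpk
      refine aeval_sepPoly_mul_eq_zero q Q hs hne ?_
      rw [cnt_congr h', ← idx, P.ann_val ε hk, zero_mul]

theorem rep_idem_single_self (hf : IsUnit (fPoly q Q n hs)) (ε : Shape n N) (y : B) :
    P.rep n (idem q Q n hs ε.val n) (Finsupp.single ε y) = Finsupp.single ε y := by
  classical
  refine Finsupp.ext fun δ => ?_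
  by_cases h : ∀ p < n, ε.val p = δ.val p
  · rw [P.rep_idem_apply_of_eq hf le_rfl h]
  · push Not at h
    rw [P.rep_idem_apply_of_ne le_rfl h, Finsupp.single_apply, if_neg]
    rintro rfl
    obtain ⟨p, -, hp⟩ := h
    exact hp rfl

theorem rep_idem (hf : IsUnit (fPoly q Q n hs)) (ε : Shape n N) (v : Shape n N →₀ B) :
    P.rep n (idem q Q n hs ε.val n) v = Finsupp.single ε (v ε) := by
  classical
  refine Finsupp.ext fun δ => ?_
  by_cases h : ∀ p < n, ε.val p = δ.val p
  · rw [P.rep_idem_apply_of_eq hf le_rfl h, Shape.ext_of_lt h, Finsupp.single_eq_same]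
  · push Not at h
    rw [P.rep_idem_apply_of_ne le_rfl h, Finsupp.single_apply, if_neg]
    rintro rfl
    obtain ⟨p, -, hp⟩ := h
    exact hp rfl

/-- An idempotent of a word with a different number of letters acts as zero. -/
theorem rep_idem_eq_zero {δ : ℕ → Bool} {c : Bool} (h : cnt c δ n ≠ N c) :
    P.rep n (idem q Q n hs δ n) = 0 := by
  refine LinearMap.ext fun v => Finsupp.ext fun ε => ?_
  refine P.rep_idem_apply_of_ne le_rfl ?_ v
  by_contra h'
  push Not at h'
  exact h (by rw [cnt_congr h', ε.count])

end TwoColor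

end Representation

/-! ### The algebra `H_b ⊗ H_{n-b}` -/

section Words

/-- The numbers of strands of the two factors of `H_b ⊗ H_{n-b}`. -/
def strands (n b : ℕ) : Bool → ℕ
  | true => b
  | false => n - b

theorem baseWord_of_lt {m p : ℕ} (h : p < m) : baseWord m p = false := by
  simp only [baseWord, decide_eq_false_iff_not]; omega

theorem baseWord_of_ge {m p : ℕ} (h : m ≤ p) : baseWord m p = true := by
  simp only [baseWord, decide_eq_true_eq]; omega

theorem cnt_baseWord (m k : ℕ) : cnt false (baseWord m) k = min k m := by
  induction k with
  | zero => simp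
  | succ k ih =>
    rw [cnt_succ, ih]
    simp only [baseWord, decide_eq_false_iff_not]
    split_ifs <;> omega

theorem idx_baseWord_of_lt {m p : ℕ} (h : p < m) : idx (baseWord m) p = p := by
  rw [idx, baseWord_of_lt h, cnt_baseWord]; omega

theorem idx_baseWord_of_ge {m p : ℕ} (h : m ≤ p) : idx (baseWord m) p = p - m := by
  have := cnt_add (baseWord m) p
  rw [cnt_baseWord] at this
  rw [idx, baseWord_of_ge h]; omega

/-- The base word with `n - b` letters `false` and `b` letters `true`. -/
def baseShape (n : ℕ) {b : ℕ} (hb : b ≤ n) : Shape n (strands n b) where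
  val := baseWord (n - b)
  tail p hp := by simp only [baseWord, decide_eq_true_eq]; omega
  count := by
    have h1 := cnt_baseWord (n - b) n
    have h2 := cnt_add (baseWord (n - b)) n
    intro c
    cases c <;> simp only [strands] <;> omega

end Words

section Tensor

open Polynomial

variable {R : Type u} [CommRing R] (q : Rˣ) {r : ℕ} (Q : Fin r → R) (n : ℕ) {s : ℕ} (hs : s ≤ r)
  (b : ℕ)

/-- The inclusion of the left factor of `H_b ⊗ H_{n-b}`. -/
noncomputable def inL : ArikiKoike q (firstParams Q hs) b →ₐ[R] TensorAlg q Q n hs b :=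
  Algebra.TensorProduct.includeLeft

/-- The inclusion of the right factor of `H_b ⊗ H_{n-b}`. -/
noncomputable def inR : ArikiKoike q (lastParams Q hs) (n - b) →ₐ[R] TensorAlg q Q n hs b :=
  Algebra.TensorProduct.includeRight

/-- The Hecke generators of the two factors of `H_b ⊗ H_{n-b}`. -/
noncomputable def tensorT : Bool → ℕ → TensorAlg q Q n hs b
  | true, j => inL q Q n hs b (T q (firstParams Q hs) b j)
  | false, j => inR q Q n hs b (T q (lastParams Q hs) (n - b) j)

/-- The Jucys–Murphy elements of the two factors of `H_b ⊗ H_{n-b}`. -/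
noncomputable def tensorX : Bool → ℕ → TensorAlg q Q n hs b
  | true, j => (inL q Q n hs b) (jm q (firstParams Q hs) b j)
  | false, j => (inR q Q n hs b) (jm q (lastParams Q hs) (n - b) j)

theorem commute_inL_inR (x : ArikiKoike q (firstParams Q hs) b)
    (y : ArikiKoike q (lastParams Q hs) (n - b)) :
    Commute (inL q Q n hs b x) (inR q Q n hs b y) := by
  simp [Commute, SemiconjBy, inL, inR]

variable {q Q n hs b}

theorem tensorX_ann (c : Bool) (j : ℕ) (hj : j < strands n b c) :
    aeval (tensorX q Q n hs b c j) (colorPoly q Q hs c j) = 0 := by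
  cases c
  · have := aeval_jm_annPoly q (lastParams Q hs) (n - b) hj
    have h2 := congrArg (inR q Q n hs b) this
    rw [map_zero, ← aeval_algHom_apply] at h2
    exact h2
  · have := aeval_jm_annPoly q (firstParams Q hs) b hj
    have h2 := congrArg (inL q Q n hs b) this
    rw [map_zero, ← aeval_algHom_apply] at h2
    exact h2

theorem tensorX_comm (c d : Bool) (j k : ℕ) :
    Commute (tensorX q Q n hs b c j) (tensorX q Q n hs b d k) := by
  cases c <;> cases d
  · exact (commute_jm_jm q _ _ j k).map (inR q Q n hs b)
  · exact (commute_inL_inR q Q n hs b _ _).symm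
  · exact commute_inL_inR q Q n hs b _ _
  · exact (commute_jm_jm q _ _ j k).map (inL q Q n hs b)

theorem tensorX_isUnit (hf : IsUnit (fPoly q Q n hs)) (i j : ℕ) (e : ℤ) (he : |e| ≤ 1)
    (hi : i < strands n b true) (hj : j < strands n b false) :
    IsUnit (tensorX q Q n hs b true i - ((q ^ e : Rˣ) : R) • tensorX q Q n hs b false j) := by
  refine isUnit_sub_smul (tensorX_comm _ _ _ _) (isCoprime_colorPoly_comp hf (e := e) ?_)
    (tensorX_ann true i hi) (tensorX_ann false j hj)
  simp only [strands] at hi hj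
  omega

/-- The two factors of `H_b ⊗ H_{n-b}` as two commuting copies of Ariki–Koike algebras. -/
noncomputable def tensorColor (hf : IsUnit (fPoly q Q n hs)) (b : ℕ) :
    TwoColor q Q hs (strands n b) (TensorAlg q Q n hs b) where
  t c j := tensorT q Q n hs b c (j + 1)
  x := tensorX q Q n hs b
  a i j := ((q : R) - 1) • (tensorX q Q n hs b true i *
    Ring.inverse (tensorX q Q n hs b true i - tensorX q Q n hs b false j))
  t_sq c j hj := by
    cases c
    · have := congrArg (inR q Q n hs b)
        (T_sq q (lastParams Q hs) (n - b) (show 1 ≤ j + 1 by omega) hj)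
      simpa only [map_mul, map_add, map_smul, map_one, tensorT] using this
    · have := congrArg (inL q Q n hs b)
        (T_sq q (firstParams Q hs) b (show 1 ≤ j + 1 by omega) hj)
      simpa only [map_mul, map_add, map_smul, map_one, tensorT] using this
  t_braid c j := by
    cases c
    · have := congrArg (inR q Q n hs b)
        (T_braid q (lastParams Q hs) (n - b) (show 1 ≤ j + 1 by omega))
      simpa only [map_mul, tensorT] using this
    · have := congrArg (inL q Q n hs b)
        (T_braid q (firstParams Q hs) b (show 1 ≤ j + 1 by omega))
      simpa only [map_mul, tensorT] using this
  commute_t_t c j k h := by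
    cases c
    · exact (commute_T_T q _ _ (by omega)).map (inR q Q n hs b)
    · exact (commute_T_T q _ _ (by omega)).map (inL q Q n hs b)
  commute_t_t' c d j k h := by
    cases c <;> cases d
    · exact absurd rfl h
    · exact (commute_inL_inR q Q n hs b _ _).symm
    · exact commute_inL_inR q Q n hs b _ _
    · exact absurd rfl h
  commute_x_x := tensorX_comm
  commute_t_x c d j k h := by
    cases c <;> cases d
    · exact (commute_T_jm q _ _ (h rfl).1 (h rfl).2).map (inR q Q n hs b)
    · exact (commute_inL_inR q Q n hs b _ _).symm
    · exact commute_inL_inR q Q n hs b _ _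
    · exact (commute_T_jm q _ _ (h rfl).1 (h rfl).2).map (inL q Q n hs b)
  t_x_t c j := by
    cases c
    · have := congrArg (inR q Q n hs b)
        (jm_succ q (lastParams Q hs) (n - b) j)
      simp only [map_mul, map_smul] at this
      simp only [tensorX, tensorT]
      rw [this, smul_smul, Units.mul_inv, one_smul]
    · have := congrArg (inL q Q n hs b)
        (jm_succ q (firstParams Q hs) b j)
      simp only [map_mul, map_smul] at this
      simp only [tensorX, tensorT]
      rw [this, smul_smul, Units.mul_inv, one_smul]
  isUnit_sub := tensorX_isUnit hf
  a_mul i j hi hj := by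
    have h := tensorX_isUnit hf i j 0 (by simp) hi hj
    rw [zpow_zero, Units.val_one, one_smul] at h
    rw [smul_mul_assoc, mul_assoc, Ring.inverse_mul_cancel _ h, mul_one]
  commute_a i j z h1 h2 := by
    refine (h1.mul_right ?_).smul_right _
    have h := h1.sub_right h2
    by_cases hu : IsUnit (tensorX q Q n hs b true i - tensorX q Q n hs b false j)
    · obtain ⟨w, hw⟩ := hu
      rw [← hw] at h ⊢
      rw [Ring.inverse_unit]
      exact h.units_inv_right
    · rw [Ring.inverse_non_unit _ hu]
      exact Commute.zero_right z
  ann := tensorX_ann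

theorem tensor_adjoin (S : Subalgebra R (TensorAlg q Q n hs b))
    (h : ∀ c j, j < strands n b c → tensorT q Q n hs b c j ∈ S) : S = ⊤ := by
  have h1 : ∀ x, (inL q Q n hs b) x ∈ S := by
    intro x
    have : (⊤ : Subalgebra R (ArikiKoike q (firstParams Q hs) b)) ≤
        S.comap (inL q Q n hs b) := by
      rw [← adjoin_range_T, Algebra.adjoin_le_iff]
      rintro _ ⟨j, rfl⟩
      rcases lt_or_ge j b with hj | hj
      · exact h true j hj
      · rw [T_of_le _ _ _ hj]; exact Subalgebra.zero_mem _
    exact this (Algebra.mem_top (x := x))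
  have h2 : ∀ x, (inR q Q n hs b) x ∈ S := by
    intro x
    have : (⊤ : Subalgebra R (ArikiKoike q (lastParams Q hs) (n - b))) ≤
        S.comap (inR q Q n hs b) := by
      rw [← adjoin_range_T, Algebra.adjoin_le_iff]
      rintro _ ⟨j, rfl⟩
      rcases lt_or_ge j (n - b) with hj | hj
      · exact h false j hj
      · rw [T_of_le _ _ _ hj]; exact Subalgebra.zero_mem _
    exact this (Algebra.mem_top (x := x))
  rw [eq_top_iff]
  rintro x -
  induction x using TensorProduct.induction_on with
  | zero => exact S.zero_mem
  | add x y hx hy => exact S.add_mem hx hy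
  | tmul x y =>
    have := S.mul_mem (h1 x) (h2 y)
    simpa [inL, inR] using this

end Tensor

/-! ### The embedding of `H_b ⊗ H_{n-b}` into `H` -/

section Corner

open Polynomial

section LeftMul

variable {R : Type*} [CommRing R] {A : Type*} [Ring A] [Algebra R A]

/-- The right ideal of the elements which are fixed by left multiplication with `e`. -/
def fixedIdeal (e : A) : Submodule Aᵐᵒᵖ A where
  carrier := {w | e * w = w}
  add_mem' {v w} hv hw := by
    rw [Set.mem_ofPred_eq] at hv hw ⊢
    rw [mul_add, hv, hw]
  zero_mem' := mul_zero e
  smul_mem' c w hw := by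
    rw [Set.mem_ofPred_eq] at hw ⊢
    rw [mul_smul_comm, hw]

theorem mem_fixedIdeal {e w : A} : w ∈ fixedIdeal e ↔ e * w = w := Iff.rfl

theorem span_eq_fixedIdeal {e : A} (he : e * e = e) :
    Submodule.span Aᵐᵒᵖ {e} = fixedIdeal e := by
  refine le_antisymm ?_ fun w hw => ?_
  · rw [Submodule.span_singleton_le_iff_mem]
    exact he
  · rw [← mem_fixedIdeal.1 hw]
    exact Submodule.smul_mem _ (MulOpposite.op w) (Submodule.mem_span_singleton_self e)

variable (R) in
/-- The elements of an algebra by which one can multiply a right ideal from the left. -/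
def idealizer (V : Submodule Aᵐᵒᵖ A) : Subalgebra R A where
  carrier := {h | ∀ w ∈ V, h * w ∈ V}
  mul_mem' {g h} hg hh w hw := by
    rw [mul_assoc]
    exact hg _ (hh w hw)
  add_mem' {g h} hg hh w hw := by
    rw [add_mul]
    exact V.add_mem (hg w hw) (hh w hw)
  algebraMap_mem' c w hw := by
    rw [Algebra.commutes]
    exact V.smul_mem (MulOpposite.op (algebraMap R A c)) hw

variable (R) in
/-- The action on a right ideal by left multiplication. -/
def leftMul (V : Submodule Aᵐᵒᵖ A) : idealizer R V →ₐ[R] Module.End Aᵐᵒᵖ V where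
  toFun h :=
    { toFun := fun w => ⟨h * w, h.2 w w.2⟩
      map_add' := fun _ _ => Subtype.ext (mul_add _ _ _)
      map_smul' := fun c _ => Subtype.ext (mul_smul_comm c _ _) }
  map_one' := LinearMap.ext fun _ => Subtype.ext (one_mul _)
  map_mul' _ _ := LinearMap.ext fun _ => Subtype.ext (mul_assoc _ _ _)
  map_zero' := LinearMap.ext fun _ => Subtype.ext (zero_mul _)
  map_add' _ _ := LinearMap.ext fun _ => Subtype.ext (add_mul _ _ _)
  commutes' _ := LinearMap.ext fun _ => Subtype.ext (Algebra.smul_def _ _).symm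

theorem leftMul_apply {V : Submodule Aᵐᵒᵖ A} (h : idealizer R V) (w : V) :
    (leftMul R V h w : A) = h * w := rfl

end LeftMul

variable {R : Type u} [CommRing R] {q : Rˣ} {r : ℕ} {Q : Fin r → R} {n : ℕ} {s : ℕ} {hs : s ≤ r}

theorem base_ne {m k : ℕ} (h : k + 1 ≠ m) : baseWord m k = baseWord m (k + 1) := by
  simp only [baseWord, decide_eq_decide]
  omega

theorem mem_idealizer_fixedIdeal {A : Type*} [Ring A] [Algebra R A] {e h : A}
    (he : e * (h * e) = h * e) : h ∈ idealizer R (fixedIdeal e) := by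
  intro w hw
  rw [mem_fixedIdeal] at hw ⊢
  rw [← hw, ← mul_assoc h, ← mul_assoc e, he]

theorem T_mem_idealizer (hf : IsUnit (fPoly q Q n hs)) {m j : ℕ} (hj : j = 0 ∨ j ≠ m) :
    T q Q n j ∈ idealizer R (fixedIdeal (idem q Q n hs (baseWord m) n)) := by
  refine mem_idealizer_fixedIdeal ?_
  rcases lt_or_ge j n with hn | hn
  · rcases j with _ | k
    · exact idem_mul_jm_mul_idem hf (baseWord m) 0 le_rfl
    · exact idem_mul_T_mul_idem hf hn le_rfl (base_ne (m := m) (k := k) (by omega))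
  · rw [T_of_le q Q n hn, zero_mul, mul_zero]

theorem jm_mem_idealizer (hf : IsUnit (fPoly q Q n hs)) (ε : ℕ → Bool) (j : ℕ) :
    jm q Q n j ∈ idealizer R (fixedIdeal (idem q Q n hs ε n)) :=
  mem_idealizer_fixedIdeal (idem_mul_jm_mul_idem hf ε j le_rfl)

/-- The left action of the right tensor factor. -/
theorem exists_action_last (hf : IsUnit (fPoly q Q n hs)) {m : ℕ} (hm : m ≤ n) :
    ∃ φ : ArikiKoike q (lastParams Q hs) m →ₐ[R] Module.End (ArikiKoike q Q n)ᵐᵒᵖ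
        (fixedIdeal (idem q Q n hs (baseWord m) n)),
      ∀ j < m, ∀ w, (φ (T q (lastParams Q hs) m j) w : ArikiKoike q Q n) = T q Q n j * w := by
  have hg : ∀ j, ∃ g : idealizer R (fixedIdeal (idem q Q n hs (baseWord m) n)),
      j < m → (g : ArikiKoike q Q n) = T q Q n j := fun j => by
    by_cases hj : j < m
    · exact ⟨⟨_, T_mem_idealizer hf (Or.inr hj.ne)⟩, fun _ => rfl⟩
    · exact ⟨0, fun h => absurd h hj⟩
  choose g hg using hg
  refine (exists_lift q (lastParams Q hs) m (fun j => leftMul R _ (g j))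
    ?_ ?_ ?_ ?_ ?_).imp fun φ hφ => ?_
  · intro h0
    have h1 := aeval_colorPoly_mul_idem q Q n hs (baseWord m) (show 0 < n by omega) le_rfl
    rw [baseWord_of_lt h0, idx_baseWord_of_lt h0, jm_zero] at h1
    have h2 : aeval (T q Q n 0) (paramPoly (lastParams Q hs)) *
      idem q Q n hs (baseWord m) n = 0 := h1
    refine (aeval_paramPoly _ _).symm.trans ?_
    rw [aeval_algHom_apply]
    refine LinearMap.ext fun w => Subtype.ext ?_
    rw [leftMul_apply, ← Subalgebra.coe_val, ← aeval_algHom_apply, Subalgebra.coe_val, hg 0 h0,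
      ← mem_fixedIdeal.1 w.2, ← mul_assoc, h2, zero_mul]
    rfl
  · intro h1
    simp only [← map_mul]
    congr 1
    refine Subtype.ext ?_
    simp only [MulMemClass.coe_mul, hg 0 (by omega), hg 1 h1]
    exact T_braid_zero q Q n
  · intro i h1 hi
    rw [← map_mul, ← map_one (leftMul R (fixedIdeal (idem q Q n hs (baseWord m) n))), ← map_smul,
      ← map_smul, ← map_add]
    congr 1
    refine Subtype.ext ?_
    have := T_sq q Q n h1 (show i < n by omega)
    rw [← hg i hi] at this
    exact this
  · intro i h1 hi
    simp only [← map_mul]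
    congr 1
    refine Subtype.ext ?_
    simp only [MulMemClass.coe_mul, hg i (by omega), hg (i + 1) hi]
    exact T_braid q Q n h1
  · intro i j hij hj
    simp only [← map_mul]
    congr 1
    refine Subtype.ext ?_
    simp only [MulMemClass.coe_mul, hg i (by omega), hg j hj]
    exact commute_T_T q Q n hij
  · intro j hj w
    rw [hφ j hj, leftMul_apply, hg j hj]

/-- The left action of the left tensor factor. -/
theorem exists_action_first (hf : IsUnit (fPoly q Q n hs)) {m b : ℕ} (hm : m + b = n) :
    ∃ φ : ArikiKoike q (firstParams Q hs) b →ₐ[R] Module.End (ArikiKoike q Q n)ᵐᵒᵖ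
        (fixedIdeal (idem q Q n hs (baseWord m) n)),
      (0 < b → ∀ w, (φ (T q (firstParams Q hs) b 0) w : ArikiKoike q Q n) = jm q Q n m * w) ∧
      (∀ j, j + 1 < b → ∀ w, (φ (T q (firstParams Q hs) b (j + 1)) w : ArikiKoike q Q n) =
        T q Q n (m + j + 1) * w) := by
  have hg : ∃ g : ℕ → idealizer R (fixedIdeal (idem q Q n hs (baseWord m) n)),
      (g 0 : ArikiKoike q Q n) = jm q Q n m ∧
      ∀ j, (g (j + 1) : ArikiKoike q Q n) = T q Q n (m + j + 1) :=
    ⟨fun j => match j with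
      | 0 => ⟨_, jm_mem_idealizer hf _ m⟩
      | j + 1 => ⟨_, T_mem_idealizer hf (j := m + j + 1) (Or.inr (by omega))⟩,
      rfl, fun _ => rfl⟩
  obtain ⟨g, hg0, hg⟩ := hg
  have hg' : ∀ j, 1 ≤ j → (g j : ArikiKoike q Q n) = T q Q n (m + j) := by
    rintro (_ | j) hj
    · omega
    · exact hg j
  refine (exists_lift q (firstParams Q hs) b (fun j => leftMul R _ (g j))
    ?_ ?_ ?_ ?_ ?_).imp fun φ hφ => ?_
  · intro h0
    have h1 := aeval_colorPoly_mul_idem q Q n hs (baseWord m) (show m < n by omega) le_rfl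
    rw [baseWord_of_ge le_rfl, idx_baseWord_of_ge le_rfl, Nat.sub_self] at h1
    have h2 : aeval (jm q Q n m) (paramPoly (firstParams Q hs)) *
      idem q Q n hs (baseWord m) n = 0 := h1
    refine (aeval_paramPoly _ _).symm.trans ?_
    rw [aeval_algHom_apply]
    refine LinearMap.ext fun w => Subtype.ext ?_
    rw [leftMul_apply, ← Subalgebra.coe_val, ← aeval_algHom_apply, Subalgebra.coe_val, hg0,
      ← mem_fixedIdeal.1 w.2, ← mul_assoc, h2, zero_mul]
    rfl
  · intro h1
    simp only [← map_mul]
    congr 1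
    refine Subtype.ext ?_
    simp only [MulMemClass.coe_mul, hg0, hg' 1 le_rfl]
    have h2 : T q Q n (m + 1) * jm q Q n m * T q Q n (m + 1) = (q : R) • jm q Q n (m + 1) := by
      rw [jm_succ, smul_smul, Units.mul_inv, one_smul]
    rw [mul_assoc, mul_assoc, ← mul_assoc (T q Q n (m + 1)), h2, mul_smul_comm, smul_mul_assoc,
      (commute_jm_jm q Q n m (m + 1)).eq]
  · intro i h1 hi
    rw [← map_mul, ← map_one (leftMul R (fixedIdeal (idem q Q n hs (baseWord m) n))), ← map_smul,
      ← map_smul, ← map_add]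
    congr 1
    refine Subtype.ext ?_
    have := T_sq q Q n (show 1 ≤ m + i by omega) (show m + i < n by omega)
    rw [← hg' i h1] at this
    exact this
  · intro i h1 hi
    simp only [← map_mul]
    congr 1
    refine Subtype.ext ?_
    simp only [MulMemClass.coe_mul, hg' i (by omega), hg' (i + 1) (by omega)]
    exact T_braid q Q n (show 1 ≤ m + i by omega)
  · intro i j hij hj
    simp only [← map_mul]
    congr 1
    refine Subtype.ext ?_
    rcases i with _ | i
    · obtain ⟨k, rfl⟩ : ∃ k, j = k + 1 := ⟨j - 1, by omega⟩
      simp only [MulMemClass.coe_mul, hg0, hg k]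
      exact (commute_T_jm q Q n (k := m + k) (j := m) (by omega) (by omega)).symm
    · simp only [MulMemClass.coe_mul, hg' (i + 1) (by omega), hg' j (by omega)]
      exact commute_T_T q Q n (by omega)
  · refine ⟨fun hb w => ?_, fun j hj w => ?_⟩
    · rw [hφ 0 hb, leftMul_apply, hg0]
    · rw [hφ _ hj, leftMul_apply, hg]

/-- A multiplicative map from `H_b ⊗ H_{n-b}` to the corner `e H e` at the idempotent `e` of the
base word. The two tensor factors act on the right ideal `e H` by left multiplication, and `π x` is
the image of `e` under `x`. -/
theorem exists_cornerMap (hf : IsUnit (fPoly q Q n hs)) {b : ℕ} (hb : b ≤ n) :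
    ∃ π : TensorAlg q Q n hs b →ₗ[R] ArikiKoike q Q n,
      π 1 = idem q Q n hs (baseWord (n - b)) n ∧
      (∀ x y, π (x * y) = π x * π y) ∧
      (∀ j < n - b, π (tensorT q Q n hs b false j) =
        T q Q n j * idem q Q n hs (baseWord (n - b)) n) ∧
      (0 < b → π (tensorT q Q n hs b true 0) =
        jm q Q n (n - b) * idem q Q n hs (baseWord (n - b)) n) ∧
      (∀ j, j + 1 < b → π (tensorT q Q n hs b true (j + 1)) =
        T q Q n (n - b + j + 1) * idem q Q n hs (baseWord (n - b)) n) := by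
  have h1 := exists_action_last (hs := hs) hf (show n - b ≤ n by omega)
  have h2 := exists_action_first (hs := hs) hf (show n - b + b = n by omega)
  have hee := idem_mul_idem (hs := hs) hf (baseWord (n - b)) le_rfl le_rfl
  generalize idem q Q n hs (baseWord (n - b)) n = e at h1 h2 hee ⊢
  obtain ⟨φ, hφ⟩ := h1
  obtain ⟨ψ, hψ0, hψ⟩ := h2
  have key : ∀ i j, i < b → j < n - b →
      Commute (ψ (T q (firstParams Q hs) b i)) (φ (T q (lastParams Q hs) (n - b) j)) := by
    intro i j hi hj
    refine LinearMap.ext fun w => Subtype.ext ?_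
    rw [Module.End.mul_apply, Module.End.mul_apply]
    rcases i with _ | i
    · rw [hψ0 hi, hφ j hj, hφ j hj, hψ0 hi, ← mul_assoc, ← mul_assoc]
      congr 1
      rcases j with _ | j
      · exact commute_jm_jm q Q n _ 0
      · exact (commute_T_jm q Q n (by omega) (by omega)).symm
    · rw [hψ i hi, hφ j hj, hφ j hj, hψ i hi, ← mul_assoc, ← mul_assoc]
      congr 1
      exact (commute_T_T q Q n (by omega)).symm
  have hcomm : ∀ x y, Commute (ψ x) (φ y) := by
    intro x y
    have h1 : ∀ i < b, φ y ∈ Subalgebra.centralizer R {ψ (T q (firstParams Q hs) b i)} := by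
      intro i hi
      have : (⊤ : Subalgebra R (ArikiKoike q (lastParams Q hs) (n - b))) ≤
          (Subalgebra.centralizer R {ψ (T q (firstParams Q hs) b i)}).comap φ := by
        rw [← adjoin_range_T, Algebra.adjoin_le_iff]
        rintro _ ⟨j, rfl⟩
        rcases lt_or_ge j (n - b) with hj | hj
        · rw [SetLike.mem_coe, Subalgebra.mem_comap, Subalgebra.mem_centralizer_iff]
          rintro _ rfl
          exact (key i j hi hj).eq
        · rw [T_of_le _ _ _ hj]; exact Subalgebra.zero_mem _
      exact this (Algebra.mem_top (x := y))
    have : (⊤ : Subalgebra R (ArikiKoike q (firstParams Q hs) b)) ≤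
        (Subalgebra.centralizer R {φ y}).comap ψ := by
      rw [← adjoin_range_T, Algebra.adjoin_le_iff]
      rintro _ ⟨i, rfl⟩
      rcases lt_or_ge i b with hi | hi
      · rw [SetLike.mem_coe, Subalgebra.mem_comap, Subalgebra.mem_centralizer_iff]
        rintro _ rfl
        exact ((Subalgebra.mem_centralizer_iff R).1 (h1 i hi) _ rfl).symm
      · rw [T_of_le _ _ _ hi]; exact Subalgebra.zero_mem _
    exact ((Subalgebra.mem_centralizer_iff R).1 (this (Algebra.mem_top (x := x))) _ rfl).symm
  let ρ : TensorAlg q Q n hs b →ₐ[R] Module.End (ArikiKoike q Q n)ᵐᵒᵖ (fixedIdeal e) :=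
    Algebra.TensorProduct.lift ψ φ hcomm
  let E : fixedIdeal e := ⟨e, hee⟩
  let π : TensorAlg q Q n hs b →ₗ[R] ArikiKoike q Q n :=
    { toFun := fun x => (ρ x E : ArikiKoike q Q n)
      map_add' := fun x y => by rw [map_add, LinearMap.add_apply]; rfl
      map_smul' := fun c x => by rw [map_smul, LinearMap.smul_apply]; rfl }
  have hρ : ∀ x (w : fixedIdeal e), (ρ x w : ArikiKoike q Q n) = π x * w := by
    intro x w
    have hw : w = MulOpposite.op (w : ArikiKoike q Q n) • E :=
      Subtype.ext (mem_fixedIdeal.1 w.2).symm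
    conv_lhs => rw [hw, map_smul]
    rfl
  have hR : ∀ y, ρ (inR q Q n hs b y) = φ y := fun y => by
    simp [ρ, inR]
  have hL : ∀ y, ρ (inL q Q n hs b y) = ψ y := fun y => by
    simp [ρ, inL]
  refine ⟨π, ?_, fun x y => ?_, fun j hj => ?_, fun h0 => ?_, fun j hj => ?_⟩
  · change (ρ 1 E : ArikiKoike q Q n) = e
    rw [map_one]
    rfl
  · change (ρ (x * y) E : ArikiKoike q Q n) = _
    rw [map_mul, Module.End.mul_apply, hρ]
    rfl
  · change (ρ (inR q Q n hs b _) E : ArikiKoike q Q n) = _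
    rw [hR, hφ j hj]
  · change (ρ (inL q Q n hs b _) E : ArikiKoike q Q n) = _
    rw [hL, hψ0 h0]
  · change (ρ (inL q Q n hs b _) E : ArikiKoike q Q n) = _
    rw [hL, hψ j hj]

/-- The embedding of `H_b ⊗ H_{n-b}` as the corner of `H` at the idempotent of the base word
with `n - b` letters `false` and `b` letters `true`. -/
noncomputable def cornerMap (hf : IsUnit (fPoly q Q n hs)) {b : ℕ} (hb : b ≤ n) :
    TensorAlg q Q n hs b →ₗ[R] ArikiKoike q Q n :=
  (exists_cornerMap hf hb).choose

section

variable (hf : IsUnit (fPoly q Q n hs)) {b : ℕ} (hb : b ≤ n)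

theorem cornerMap_one : cornerMap hf hb 1 = idem q Q n hs (baseWord (n - b)) n :=
  (exists_cornerMap hf hb).choose_spec.1

theorem cornerMap_mul (x y : TensorAlg q Q n hs b) :
    cornerMap hf hb (x * y) = cornerMap hf hb x * cornerMap hf hb y :=
  (exists_cornerMap hf hb).choose_spec.2.1 x y

theorem cornerMap_T_false {j : ℕ} (hj : j < n - b) :
    cornerMap hf hb (tensorT q Q n hs b false j) =
      T q Q n j * idem q Q n hs (baseWord (n - b)) n :=
  (exists_cornerMap hf hb).choose_spec.2.2.1 j hj

theorem cornerMap_T_true_zero (h0 : 0 < b) : cornerMap hf hb (tensorT q Q n hs b true 0) =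
    jm q Q n (n - b) * idem q Q n hs (baseWord (n - b)) n :=
  (exists_cornerMap hf hb).choose_spec.2.2.2.1 h0

theorem cornerMap_T_true_succ {j : ℕ} (hj : j + 1 < b) :
    cornerMap hf hb (tensorT q Q n hs b true (j + 1)) =
      T q Q n (n - b + j + 1) * idem q Q n hs (baseWord (n - b)) n :=
  (exists_cornerMap hf hb).choose_spec.2.2.2.2 j hj

theorem cornerMap_mul_idem (x : TensorAlg q Q n hs b) :
    cornerMap hf hb x * idem q Q n hs (baseWord (n - b)) n = cornerMap hf hb x := by
  rw [← cornerMap_one hf hb, ← cornerMap_mul, mul_one]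

theorem idem_mul_cornerMap (x : TensorAlg q Q n hs b) :
    idem q Q n hs (baseWord (n - b)) n * cornerMap hf hb x = cornerMap hf hb x := by
  rw [← cornerMap_one hf hb, ← cornerMap_mul, one_mul]

/-- If `x` and `y` act on the right ideal `e H` as left multiplication by `g` and `h`, then `x y`
acts as left multiplication by `g h`. -/
theorem cornerMap_mul_eq {x y : TensorAlg q Q n hs b} {g h : ArikiKoike q Q n}
    (hx : cornerMap hf hb x = g * idem q Q n hs (baseWord (n - b)) n)
    (hy : cornerMap hf hb y = h * idem q Q n hs (baseWord (n - b)) n) :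
    cornerMap hf hb (x * y) = g * h * idem q Q n hs (baseWord (n - b)) n := by
  rw [cornerMap_mul, hx, mul_assoc, idem_mul_cornerMap, hy, mul_assoc]

theorem cornerMap_X_false {j : ℕ} (hj : j < n - b) :
    cornerMap hf hb (tensorX q Q n hs b false j) =
      jm q Q n j * idem q Q n hs (baseWord (n - b)) n := by
  induction j with
  | zero => exact cornerMap_T_false hf hb hj
  | succ j ih =>
    have e : tensorX q Q n hs b false (j + 1) = ((q⁻¹ : Rˣ) : R) •
        (tensorT q Q n hs b false (j + 1) * tensorX q Q n hs b false j *
          tensorT q Q n hs b false (j + 1)) := by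
      simp only [tensorX, tensorT, jm_succ, map_smul, map_mul]
    rw [e, map_smul, cornerMap_mul_eq hf hb (cornerMap_mul_eq hf hb (cornerMap_T_false hf hb hj)
      (ih (by omega))) (cornerMap_T_false hf hb hj), jm_succ, smul_mul_assoc]

theorem cornerMap_X_true {j : ℕ} (hj : j < b) :
    cornerMap hf hb (tensorX q Q n hs b true j) =
      jm q Q n (n - b + j) * idem q Q n hs (baseWord (n - b)) n := by
  induction j with
  | zero => exact cornerMap_T_true_zero hf hb hj
  | succ j ih =>
    have e : tensorX q Q n hs b true (j + 1) = ((q⁻¹ : Rˣ) : R) •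
        (tensorT q Q n hs b true (j + 1) * tensorX q Q n hs b true j *
          tensorT q Q n hs b true (j + 1)) := by
      simp only [tensorX, tensorT, jm_succ, map_smul, map_mul]
    rw [e, map_smul, cornerMap_mul_eq hf hb (cornerMap_mul_eq hf hb
      (cornerMap_T_true_succ hf hb hj) (ih (by omega))) (cornerMap_T_true_succ hf hb hj),
      ← Nat.add_assoc, jm_succ, smul_mul_assoc]

end

end Corner

/-! ### The columns of the matrix units -/

section Column

variable {R : Type u} [CommRing R] {q : Rˣ} {r : ℕ} {Q : Fin r → R} {n : ℕ} {s : ℕ} {hs : s ≤ r}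
  {N : Bool → ℕ} {B : Type*} [Ring B] [Algebra R B]

/-- A multiplicative map from `B` to `H` whose image acts on the image of the idempotent `π 1` as
`B` acts, in the representation on words, on the component of the word `base`, which has no
descents. -/
structure Corner (P : TwoColor q Q hs N B) (n : ℕ) where
  π : B →ₗ[R] ArikiKoike q Q n
  base : Shape n N
  π_mul : ∀ x y, π (x * y) = π x * π y
  no_descent : ∀ k, k + 1 < n → ¬(base.val k = true ∧ base.val (k + 1) = false)
  map_val : ∀ k < n, π (P.val k base.val) = jm q Q n k * π 1
  map_t : ∀ k, k + 1 < n → base.val k = base.val (k + 1) →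
    π (P.t (base.val k) (idx base.val k)) = T q Q n (k + 1) * π 1

/-- The step from the second to the third component in a module over a Hecke algebra with three
components: on the third component the generator `W` acts as `U` acts on the first one. -/
theorem mul_third {A : Type*} [Ring A] [Algebra R A] {U W e t a₁ a₂ φ₁ φ₂ φ₃ : A} (c d : R)
    (hWW : W * W = c • W + d • 1) (hUW : W * U * W = U * W * U)
    (he : φ₁ * e = φ₁) (h0 : U * φ₁ = φ₁ * t) (h1 : φ₂ = W * φ₁ - φ₁ * a₂)
    (h2 : φ₃ = U * φ₂ - φ₂ * a₁) (hφ₂ : φ₂ * e = φ₂)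
    (id1 : a₁ * t = t * a₂ + (c • e - a₂) * a₁)
    (id2 : t * a₂ * t = a₂ * t * a₂ + (d • e + a₂ * (c • e - a₂)) * a₁) :
    W * φ₃ = φ₃ * t := by
  have w1 : W * φ₁ = φ₂ + φ₁ * a₂ := by rw [h1, sub_add_cancel]
  have u2 : U * φ₂ = φ₃ + φ₂ * a₁ := by rw [h2, sub_add_cancel]
  have w2 : W * φ₂ = φ₂ * (c • e - a₂) + φ₁ * (d • e + a₂ * (c • e - a₂)) := by
    have e1 : W * φ₂ = c • (W * φ₁) + d • φ₁ - W * φ₁ * a₂ := by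
      rw [h1, mul_sub, ← mul_assoc, hWW, ← mul_assoc, add_mul, smul_mul_assoc, smul_mul_assoc,
        one_mul]
    have e2 : φ₁ * (a₂ * e) = φ₁ * a₂ := by
      have : φ₁ * a₂ = W * φ₁ - φ₂ := by rw [h1]; abel
      rw [← mul_assoc, this, sub_mul, mul_assoc, he, hφ₂]
    rw [e1, w1]
    simp only [mul_sub, mul_add, mul_smul_comm, he, hφ₂, e2, add_mul, smul_add, mul_assoc]
    abel
  calc W * φ₃ = W * U * W * φ₁ - W * U * φ₁ * a₂ - W * φ₂ * a₁ := by
        rw [h2, mul_sub, ← mul_assoc, ← mul_assoc]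
        congr 1
        rw [h1, mul_sub]
        simp only [← mul_assoc]
    _ = U * (W * φ₁) * t - W * φ₁ * t * a₂ - W * φ₂ * a₁ := by
        rw [hUW, mul_assoc (U * W), h0, mul_assoc W U, h0]
        simp only [mul_assoc]
    _ = φ₃ * t + φ₂ * (a₁ * t - t * a₂ - (c • e - a₂) * a₁) +
        φ₁ * (t * a₂ * t - a₂ * t * a₂ - (d • e + a₂ * (c • e - a₂)) * a₁) := by
        rw [w2, w1, mul_add, u2, ← mul_assoc, h0]
        simp only [mul_sub, mul_add, add_mul, sub_mul, ← mul_assoc]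
        abel
    _ = φ₃ * t := by
        rw [id1, id2]
        simp only [add_sub_cancel_left, sub_self, mul_zero, add_zero]

namespace Corner

variable {P : TwoColor q Q hs N B} (C : Corner P n)

open Classical in
/-- The element of `H` which maps the base component to the component of the word `ε`. It is defined
by recursion on the weight, by solving the action of `T_{k+1}` in the representation on words for
the component of `ε`, where `k` is some descent of `ε`. -/
noncomputable def col (ε : Shape n N) : ArikiKoike q Q n :=
  if h : ∃ k, k + 1 < n ∧ ε.val k = true ∧ ε.val (k + 1) = false then
    T q Q n (h.choose + 1) * col (Shape.swap h.choose ε) -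
      col (Shape.swap h.choose ε) * C.π (P.dg h.choose (Shape.swap h.choose ε).val)
  else C.π 1
termination_by weight n ε.val
decreasing_by
  all_goals
    rw [Shape.swap_val h.choose_spec.1]
    have := weight_swp h.choose_spec.1 h.choose_spec.2.1 h.choose_spec.2.2
    omega

theorem col_of_exists {ε : Shape n N}
    (h : ∃ k, k + 1 < n ∧ ε.val k = true ∧ ε.val (k + 1) = false) :
    ∃ k, (k + 1 < n ∧ ε.val k = true ∧ ε.val (k + 1) = false) ∧
      C.col ε = T q Q n (k + 1) * C.col (Shape.swap k ε) -
        C.col (Shape.swap k ε) * C.π (P.dg k (Shape.swap k ε).val) := by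
  refine ⟨h.choose, h.choose_spec, ?_⟩
  rw [col, dif_pos h]

theorem eq_base {ε : Shape n N}
    (h : ¬∃ k, k + 1 < n ∧ ε.val k = true ∧ ε.val (k + 1) = false) : ε = C.base := by
  refine Shape.ext_of_lt fun p hp => ?_
  rw [eq_baseWord_of_forall (fun k hk hd => h ⟨k, hk, hd⟩) p hp,
    eq_baseWord_of_forall C.no_descent p hp, ε.count, C.base.count]

theorem col_base : C.col C.base = C.π 1 := by
  rw [col, dif_neg]
  rintro ⟨k, hk, h⟩
  exact C.no_descent k hk h

theorem map_one_mul (x : B) : C.π 1 * C.π x = C.π x := by rw [← C.π_mul, one_mul]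

theorem map_mul_one (x : B) : C.π x * C.π 1 = C.π x := by rw [← C.π_mul, mul_one]

theorem col_mul_one (ε : Shape n N) : C.col ε * C.π 1 = C.col ε := by
  generalize hw : weight n ε.val = w
  induction w using Nat.strong_induction_on generalizing ε with
  | _ w ih =>
    by_cases h : ∃ k, k + 1 < n ∧ ε.val k = true ∧ ε.val (k + 1) = false
    · obtain ⟨k, ⟨hk, h1, h2⟩, he⟩ := C.col_of_exists h
      have hw' := weight_swp hk h1 h2
      rw [he, sub_mul, mul_assoc, mul_assoc, C.map_mul_one,
        ih _ (by rw [Shape.swap_val hk]; omega) _ rfl]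
    · rw [C.eq_base h, C.col_base, C.map_mul_one]

/-- The recursion for `col` holds at each descent, not only at the chosen one. -/
theorem col_of_descent (ε : Shape n N) {k : ℕ} (hk : k + 1 < n) (h1 : ε.val k = true)
    (h2 : ε.val (k + 1) = false) :
    C.col ε = T q Q n (k + 1) * C.col (Shape.swap k ε) -
      C.col (Shape.swap k ε) * C.π (P.dg k (Shape.swap k ε).val) := by
  generalize hw : weight n ε.val = w
  induction w using Nat.strong_induction_on generalizing ε k with
  | _ w ih =>
    obtain ⟨l, ⟨hl, h3, h4⟩, he⟩ := C.col_of_exists ⟨k, hk, h1, h2⟩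
    by_cases hkl : k = l
    · rw [hkl]; exact he
    have hkl' : k + 1 < l ∨ l + 1 < k := by
      have h5 : k + 1 ≠ l := fun h => by rw [← h, h2] at h3; cases h3
      have h6 : l + 1 ≠ k := fun h => by rw [← h, h4] at h1; cases h1
      omega
    have hwk := weight_swp hk h1 h2
    have hwl := weight_swp hl h3 h4
    have vk := Shape.swap_val hk ε
    have vl := Shape.swap_val hl ε
    have hcomm : Shape.swap k (Shape.swap l ε) = Shape.swap l (Shape.swap k ε) := by
      rcases hkl' with h | h
      · exact Shape.swap_comm h hl ε
      · exact (Shape.swap_comm h hk ε).symm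
    have ek : C.col (Shape.swap l ε) = _ := ih (weight n (Shape.swap l ε).val)
      (by rw [vl]; omega) (Shape.swap l ε) hk
      (by rw [vl, swp_of_ne _ (by omega) (by omega), h1])
      (by rw [vl, swp_of_ne _ (by omega) (by omega), h2]) rfl
    have el : C.col (Shape.swap k ε) = _ := ih (weight n (Shape.swap k ε).val)
      (by rw [vk]; omega) (Shape.swap k ε) hl
      (by rw [vk, swp_of_ne _ (by omega) (by omega), h3])
      (by rw [vk, swp_of_ne _ (by omega) (by omega), h4]) rfl
    rw [hcomm] at ek
    have d1 : P.dg l (Shape.swap l ε).val = P.dg l (Shape.swap l (Shape.swap k ε)).val := by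
      rw [← hcomm, Shape.swap_val hk]
      exact P.dg_congr (swp_of_ne _ (by omega) (by omega)).symm
        (swp_of_ne _ (by omega) (by omega)).symm (idx_swp_of_ne _ (by omega) (by omega)).symm
        (idx_swp_of_ne _ (by omega) (by omega)).symm
    have d2 : P.dg k (Shape.swap k ε).val = P.dg k (Shape.swap l (Shape.swap k ε)).val := by
      rw [Shape.swap_val hl]
      exact P.dg_congr (swp_of_ne _ (by omega) (by omega)).symm
        (swp_of_ne _ (by omega) (by omega)).symm (idx_swp_of_ne _ (by omega) (by omega)).symm
        (idx_swp_of_ne _ (by omega) (by omega)).symm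
    rw [he, ek, el, d1, d2]
    have hT : T q Q n (k + 1) * T q Q n (l + 1) = T q Q n (l + 1) * T q Q n (k + 1) := by
      rcases hkl' with h | h
      · exact commute_T_T q Q n (by omega)
      · exact (commute_T_T q Q n (by omega)).symm
    have hd : ∀ γ : ℕ → Bool,
        C.π (P.dg k γ) * C.π (P.dg l γ) = C.π (P.dg l γ) * C.π (P.dg k γ) := by
      intro γ
      rw [← C.π_mul, ← C.π_mul]
      rcases hkl' with h | h
      · rw [(P.commute_dg_dg h).eq]
      · rw [(P.commute_dg_dg h).eq]
    simp only [mul_sub, sub_mul, mul_assoc, hd]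
    rw [← mul_assoc (T q Q n (l + 1)), ← hT, mul_assoc]
    abel

theorem jm_mul_col (ε : Shape n N) {j : ℕ} (hj : j < n) :
    jm q Q n j * C.col ε = C.col ε * C.π (P.val j ε.val) := by
  generalize hw : weight n ε.val = w
  induction w using Nat.strong_induction_on generalizing ε j with
  | _ w ih =>
    by_cases h : ∃ k, k + 1 < n ∧ ε.val k = true ∧ ε.val (k + 1) = false
    swap
    · rw [C.eq_base h, C.col_base, C.map_one_mul, C.map_val j hj]
    obtain ⟨k, ⟨hk, h1, h2⟩, he⟩ := C.col_of_exists h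
    have hw' := weight_swp hk h1 h2
    have ih := fun j hj => ih (weight n (Shape.swap k ε).val)
      (by rw [Shape.swap_val hk]; omega) (Shape.swap k ε) (j := j) hj rfl
    have hne : ε.val k ≠ ε.val (k + 1) := by rw [h1, h2]; decide
    have hv := Shape.swap_val hk ε
    rw [he]
    by_cases hjk : j ≠ k ∧ j ≠ k + 1
    · have e1 : P.val j ε.val = P.val j (Shape.swap k ε).val := by
        rw [TwoColor.val, TwoColor.val, hv, swp_of_ne _ hjk.1 hjk.2,
          idx_swp_of_ne _ hjk.1 hjk.2]
      rw [e1, mul_sub, ← mul_assoc, ← (commute_T_jm q Q n hjk.1 hjk.2).eq, mul_assoc, ih j hj,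
        ← mul_assoc (jm q Q n j), ih j hj, sub_mul, mul_assoc, mul_assoc, mul_assoc, ← C.π_mul,
        ← C.π_mul,
        (P.commute_val_dg hjk.1 hjk.2).eq]
    -- the positions of the descent are related by the identity which defines the quotient `a`
    have ihk := ih k (by omega)
    have ihk' := ih (k + 1) hk
    have p1 : (Shape.swap k ε).val k = false := by rw [hv, swp_left, h2]
    have p2 : (Shape.swap k ε).val (k + 1) = true := by rw [hv, swp_right, h1]
    obtain ⟨b1, b2⟩ := Shape.idx_bounds hk p1 p2
    have e1 : P.val k ε.val = P.val (k + 1) (Shape.swap k ε).val := by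
      rw [TwoColor.val, TwoColor.val, hv, swp_right, idx_swp_right hne]
    have e2 : P.val (k + 1) ε.val = P.val k (Shape.swap k ε).val := by
      rw [TwoColor.val, TwoColor.val, hv, swp_left, idx_swp_left hne]
    have hd : P.dg k (Shape.swap k ε).val =
        P.a (idx (Shape.swap k ε).val (k + 1)) (idx (Shape.swap k ε).val k) := by
      rw [TwoColor.dg, if_neg (by rw [p1, p2]; decide), if_pos p1]
    have v1 : P.val k (Shape.swap k ε).val = P.x false (idx (Shape.swap k ε).val k) := by
      rw [TwoColor.val, p1]
    have v2 : P.val (k + 1) (Shape.swap k ε).val =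
        P.x true (idx (Shape.swap k ε).val (k + 1)) := by rw [TwoColor.val, p2]
    have ha := P.a_mul _ _ b1 b2
    have hax := (P.commute_a_x (idx (Shape.swap k ε).val (k + 1)) (idx (Shape.swap k ε).val k)
      true (idx (Shape.swap k ε).val (k + 1))).eq
    have hay := (P.commute_a_x (idx (Shape.swap k ε).val (k + 1)) (idx (Shape.swap k ε).val k)
      false (idx (Shape.swap k ε).val k)).eq
    rw [v1] at ihk e2
    rw [v2] at ihk' e1
    rw [mul_sub] at ha
    have ha' := congrArg (fun z => C.col (Shape.swap k ε) * C.π z) ha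
    simp only [map_sub, map_smul, C.π_mul, mul_sub, mul_smul_comm] at ha'
    have hax' := congrArg C.π hax
    have hay' := congrArg C.π hay
    simp only [C.π_mul] at hax' hay'
    rcases eq_or_ne j k with rfl | hj'
    · have hT : jm q Q n j * T q Q n (j + 1) =
          T q Q n (j + 1) * jm q Q n (j + 1) - ((q : R) - 1) • jm q Q n (j + 1) := by
        rw [T_mul_jm q Q n hk, add_sub_cancel_right]
      rw [e1, mul_sub, ← mul_assoc, hT, sub_mul, mul_assoc, ihk', smul_mul_assoc, ihk',
        ← mul_assoc (jm q Q n j), ihk, hd, sub_mul, mul_assoc (C.col _), ← hay',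
        mul_assoc (C.col _), mul_assoc (T q Q n (j + 1)), ← ha']
      abel
    · obtain rfl : j = k + 1 := by
        by_contra h'
        exact hjk ⟨hj', h'⟩
      rw [e2, mul_sub, ← mul_assoc, jm_mul_T q Q n hk, add_mul, mul_assoc, ihk, smul_mul_assoc,
        ihk', ← mul_assoc (jm q Q n (k + 1)), ihk', hd, sub_mul, mul_assoc (C.col _), ← hax',
        mul_assoc (C.col _), mul_assoc (T q Q n (k + 1)), ← ha']
      abel

theorem T_mul_col_of_eq (ε : Shape n N) {l : ℕ} (hl : l + 1 < n)
    (hε : ε.val l = ε.val (l + 1)) :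
    T q Q n (l + 1) * C.col ε = C.col ε * C.π (P.t (ε.val l) (idx ε.val l)) := by
  generalize hw : weight n ε.val = w
  induction w using Nat.strong_induction_on generalizing ε l with
  | _ w ih =>
    by_cases h : ∃ k, k + 1 < n ∧ ε.val k = true ∧ ε.val (k + 1) = false
    swap
    · rw [C.eq_base h] at hε ⊢
      rw [C.col_base, C.map_one_mul, C.map_t l hl hε]
    obtain ⟨k, ⟨hk, h1, h2⟩, he⟩ := C.col_of_exists h
    have hw' := weight_swp hk h1 h2
    have hv := Shape.swap_val hk ε
    have hne : ε.val k ≠ ε.val (k + 1) := by rw [h1, h2]; decide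
    have hlk : l ≠ k := by rintro rfl; exact hne hε
    by_cases hfar : k + 1 < l ∨ l + 1 < k
    · have q1 : (Shape.swap k ε).val l = ε.val l := by
        rw [hv, swp_of_ne _ (by omega) (by omega)]
      have q2 : (Shape.swap k ε).val (l + 1) = ε.val (l + 1) := by
        rw [hv, swp_of_ne _ (by omega) (by omega)]
      have q3 : idx (Shape.swap k ε).val l = idx ε.val l := by
        rw [hv, idx_swp_of_ne _ (by omega) (by omega)]
      have hε' : (Shape.swap k ε).val l = (Shape.swap k ε).val (l + 1) := by rw [q1, q2, hε]
      have e1 := ih (weight n (Shape.swap k ε).val) (by rw [hv]; omega) (Shape.swap k ε) hl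
        hε' rfl
      have hT : T q Q n (l + 1) * T q Q n (k + 1) = T q Q n (k + 1) * T q Q n (l + 1) := by
        rcases hfar with h | h
        · exact (commute_T_T q Q n (by omega)).symm
        · exact commute_T_T q Q n (by omega)
      have hc : Commute (P.t ((Shape.swap k ε).val l) (idx (Shape.swap k ε).val l))
          (P.dg k (Shape.swap k ε).val) := by
        have : P.t ((Shape.swap k ε).val l) (idx (Shape.swap k ε).val l) =
            P.dg l (Shape.swap k ε).val := by rw [TwoColor.dg, if_pos hε']
        rw [this]
        rcases hfar with h | h
        · exact (P.commute_dg_dg h).symm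
        · exact P.commute_dg_dg h
      rw [he, mul_sub, ← mul_assoc, hT, mul_assoc, e1, ← mul_assoc (T q Q n (l + 1)), e1, sub_mul,
        ← q1, ← q3, mul_assoc (C.col _), ← C.π_mul, hc.eq, C.π_mul]
      simp only [mul_assoc]
    have hadj : l = k + 1 ∨ k = l + 1 := by omega
    rcases hadj with rfl | rfl
    · -- the letters `true, false, false`, obtained from `false, false, true`
      set ε₂ := Shape.swap k ε with hε₂
      set ε₁ := Shape.swap (k + 1) ε₂ with hε₁
      have h3 : ε.val (k + 2) = false := hε.symm.trans h2
      have v₁ : ε₁.val = swp (k + 1) ε₂.val := Shape.swap_val hl ε₂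
      have p1 : ε₂.val k = false := by rw [hv, swp_left, h2]
      have p2 : ε₂.val (k + 1) = true := by rw [hv, swp_right, h1]
      have p3 : ε₂.val (k + 1 + 1) = false := by
        rw [hv, swp_of_ne _ (by omega) (by omega)]; exact h3
      have hne₂ : ε₂.val (k + 1) ≠ ε₂.val (k + 1 + 1) := by rw [p2, p3]; decide
      have r1 : ε₁.val k = false := by rw [v₁, swp_of_ne _ (by omega) (by omega), p1]
      have r2 : ε₁.val (k + 1) = false := by rw [v₁, swp_left, p3]
      have r3 : ε₁.val (k + 1 + 1) = true := by rw [v₁, swp_right, p2]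
      have j1 : idx ε₁.val k = idx ε₂.val k := by rw [v₁, idx_swp_of_ne _ (by omega) (by omega)]
      have j2 : idx ε₁.val (k + 1) = idx ε₁.val k + 1 := idx_succ (r1.trans r2.symm)
      have j3 : idx ε₁.val (k + 1 + 1) = idx ε₂.val (k + 1) := by rw [v₁, idx_swp_right hne₂]
      have j4 : idx ε.val (k + 1) = idx ε₂.val k := by rw [hv, idx_swp_left hne]
      obtain ⟨b1, b2⟩ := Shape.idx_bounds hl r2 r3
      rw [j2] at b2
      have hw₂ := weight_swp hl p2 p3
      have id1 := P.a_mul_t_false b1 b2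
      have id2 := TwoColor.t_mul_a_mul_t (P.t_sq false _ b2) id1
      have d1 : P.dg k ε₂.val = P.a (idx ε₁.val (k + 1 + 1)) (idx ε₁.val k) := by
        rw [TwoColor.dg, if_neg (by rw [p1, p2]; decide), if_pos p1, j3, j1]
      have d2 : P.dg (k + 1) ε₁.val = P.a (idx ε₁.val (k + 1 + 1)) (idx ε₁.val k + 1) := by
        rw [TwoColor.dg, if_neg (by rw [r2, r3]; decide), if_pos r2, j2]
      rw [d1] at he
      have e2 := C.col_of_descent ε₂ hl p2 p3
      rw [← hε₁, d2] at e2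
      have e0 := ih (weight n ε₁.val) (by rw [v₁]; rw [hv] at hw₂ ⊢; omega) ε₁ hk
        (r1.trans r2.symm) rfl
      rw [r1] at e0
      rw [TwoColor.a'] at id1
      have id1' := congrArg C.π id1
      have id2' := congrArg C.π id2
      simp only [C.π_mul, map_add, map_sub, map_smul] at id1' id2'
      rw [h2, j4, ← j1]
      exact mul_third _ _ (T_sq q Q n (by omega) hl) (T_braid q Q n (by omega))
        (C.col_mul_one _) e0 e2 he (C.col_mul_one _) id1' id2'
    · -- the letters `true, true, false`, obtained from `false, true, true`
      set ε₂ := Shape.swap (l + 1) ε with hε₂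
      set ε₁ := Shape.swap l ε₂ with hε₁
      have v₁ : ε₁.val = swp l ε₂.val := Shape.swap_val hl ε₂
      have h0 : ε.val l = true := hε.trans h1
      have p1 : ε₂.val l = true := by rw [hv, swp_of_ne _ (by omega) (by omega), h0]
      have p2 : ε₂.val (l + 1) = false := by rw [hv, swp_left, h2]
      have p3 : ε₂.val (l + 1 + 1) = true := by rw [hv, swp_right, h1]
      have hne₂ : ε₂.val l ≠ ε₂.val (l + 1) := by rw [p1, p2]; decide
      have r1 : ε₁.val l = false := by rw [v₁, swp_left, p2]
      have r2 : ε₁.val (l + 1) = true := by rw [v₁, swp_right, p1]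
      have r3 : ε₁.val (l + 1 + 1) = true := by rw [v₁, swp_of_ne _ (by omega) (by omega), p3]
      have j0 : idx ε₁.val l = idx ε₂.val (l + 1) := by rw [v₁, idx_swp_left hne₂]
      have j1 : idx ε₁.val (l + 1) = idx ε₂.val l := by rw [v₁, idx_swp_right hne₂]
      have j2 : idx ε₁.val (l + 1 + 1) = idx ε₂.val (l + 1 + 1) := by
        rw [v₁, idx_swp_of_ne _ (by omega) (by omega)]
      have j3 : idx ε₁.val (l + 1 + 1) = idx ε₁.val (l + 1) + 1 := idx_succ (r2.trans r3.symm)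
      have j4 : idx ε.val l = idx ε₂.val l := by rw [hv, idx_swp_of_ne _ (by omega) (by omega)]
      have b1 : idx ε₁.val (l + 1) + 1 < N true := by
        have := ε₁.idx_lt hk
        rwa [j3, r3] at this
      have b2 := (Shape.idx_bounds hl r1 r2).2
      have hw₂ := weight_swp hl p1 p2
      have id1 := P.a_mul_t_true b1 b2
      have id2 := TwoColor.t_mul_a_mul_t (P.t_sq true _ b1) id1
      have d1 : P.dg (l + 1) ε₂.val = P.a (idx ε₁.val (l + 1) + 1) (idx ε₁.val l) := by
        rw [TwoColor.dg, if_neg (by rw [p2, p3]; decide), if_pos p2, ← j2, j3, j0]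
      have d2 : P.dg l ε₁.val = P.a (idx ε₁.val (l + 1)) (idx ε₁.val l) := by
        rw [TwoColor.dg, if_neg (by rw [r1, r2]; decide), if_pos r1]
      rw [d1] at he
      have e2 := C.col_of_descent ε₂ hl p1 p2
      rw [← hε₁, d2] at e2
      have e0 := ih (weight n ε₁.val) (by rw [v₁]; rw [hv] at hw₂ ⊢; omega) ε₁ hk
        (r2.trans r3.symm) rfl
      rw [r2] at e0
      rw [TwoColor.a'] at id1
      have id1' := congrArg C.π id1
      have id2' := congrArg C.π id2
      simp only [C.π_mul, map_add, map_sub, map_smul] at id1' id2'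
      rw [h0, j4, ← j1]
      exact mul_third _ _ (T_sq q Q n (by omega) hl) (T_braid q Q n (by omega)).symm
        (C.col_mul_one _) e0 e2 he (C.col_mul_one _) id1' id2'

/-- The columns transform under `H` as the components in the representation on words. -/
theorem T_mul_col (ε : Shape n N) {k : ℕ} (hk : k + 1 < n) :
    T q Q n (k + 1) * C.col ε =
      C.col ε * C.π (P.dg k ε.val) + C.col (Shape.swap k ε) * C.π (P.off k ε.val) := by
  refine Shape.cases hk (p := fun ε => T q Q n (k + 1) * C.col ε =
    C.col ε * C.π (P.dg k ε.val) + C.col (Shape.swap k ε) * C.π (P.off k ε.val))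
    (fun ε h => ?_) (fun ε h1 h2 => ?_) ε
  · rw [C.T_mul_col_of_eq ε hk h, TwoColor.dg, if_pos h, TwoColor.off, if_pos h, map_zero, mul_zero,
      add_zero]
  · have h : ε.val k ≠ ε.val (k + 1) := by rw [h1, h2]; decide
    have h' : swp k ε.val k ≠ swp k ε.val (k + 1) := by rw [swp_left, swp_right]; exact h.symm
    have h'' : ¬ swp k ε.val k = false := by rw [swp_left, h2]; decide
    have hv := Shape.swap_val hk ε
    have hd := C.col_of_descent (Shape.swap k ε) hk (by rw [hv, swp_left, h2])
      (by rw [hv, swp_right, h1])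
    rw [Shape.swap_swap] at hd
    have ho : P.off k ε.val = 1 := by rw [TwoColor.off, if_neg h, if_pos h1]
    have hda : P.dg k ε.val = P.a (idx ε.val (k + 1)) (idx ε.val k) := by
      rw [TwoColor.dg, if_neg h, if_pos h1]
    have up : T q Q n (k + 1) * C.col ε =
      C.col ε * C.π (P.dg k ε.val) + C.col (Shape.swap k ε) := by rw [hd]; abel
    refine ⟨by rw [up, ho, C.col_mul_one], ?_⟩
    rw [Shape.swap_swap, hv, TwoColor.dg, if_neg h', if_neg h'', TwoColor.off, if_neg h',
      if_neg h'',
      idx_swp_left h, idx_swp_right h, TwoColor.g, TwoColor.a']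
    rw [hda] at up
    have hd' : C.col (Shape.swap k ε) = T q Q n (k + 1) * C.col ε -
      C.col ε * C.π (P.a (idx ε.val (k + 1)) (idx ε.val k)) := by rw [up]; abel
    have e1 : T q Q n (k + 1) * C.col (Shape.swap k ε) =
        ((q : R) - 1) • (T q Q n (k + 1) * C.col ε) + (q : R) • C.col ε -
          T q Q n (k + 1) * C.col ε * C.π (P.a (idx ε.val (k + 1)) (idx ε.val k)) := by
      rw [hd', mul_sub, ← mul_assoc, T_sq q Q n (by omega) hk, ← mul_assoc, add_mul,
        smul_mul_assoc, smul_mul_assoc, one_mul]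
    rw [e1, up]
    simp only [mul_sub, mul_add, map_add, map_sub, map_smul, C.π_mul, mul_smul_comm,
      C.col_mul_one, add_mul, smul_add, mul_assoc, mul_one]
    abel

/-- The map from the representation on words to `H` given by the columns. -/
noncomputable def toH : (Shape n N →₀ B) →ₗ[R] ArikiKoike q Q n :=
  Finsupp.lsum R fun ε => LinearMap.mulLeft R (C.col ε) ∘ₗ C.π

theorem toH_single (ε : Shape n N) (y : B) :
    C.toH (Finsupp.single ε y) = C.col ε * C.π y := by
  simp [toH]

theorem mul_toH (h : ArikiKoike q Q n) (v : Shape n N →₀ B) :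
    h * C.toH v = C.toH (P.rep n h v) := by
  let S : Subalgebra R (ArikiKoike q Q n) :=
    { carrier := {h | ∀ v, h * C.toH v = C.toH (P.rep n h v)}
      mul_mem' := fun {g h} hg hh v => by
        rw [mul_assoc, hh, hg, map_mul, Module.End.mul_apply]
      add_mem' := fun {g h} hg hh v => by
        rw [add_mul, hg, hh, map_add, LinearMap.add_apply, map_add]
      algebraMap_mem' := fun c v => by
        rw [AlgHom.commutes, Module.algebraMap_end_apply, map_smul, Algebra.smul_def] }
  have hS : ∀ k < n, T q Q n k ∈ S := by
    intro k hk v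
    induction v using Finsupp.induction_linear with
    | zero => simp
    | add v w hv hw => rw [map_add, mul_add, hv, hw, map_add, map_add]
    | single ε y =>
      rcases k with _ | k
      · have := P.rep_jm hk
        rw [jm_zero] at this
        rw [this, TwoColor.dop_single, C.toH_single, C.toH_single, ← mul_assoc, ← jm_zero,
          C.jm_mul_col ε hk, C.π_mul, mul_assoc]
      · rw [P.rep_T hk, P.op_single, map_add, C.toH_single, C.toH_single, C.toH_single,
          ← mul_assoc, C.T_mul_col ε hk, C.π_mul, C.π_mul, add_mul, mul_assoc, mul_assoc]
  have : (⊤ : Subalgebra R (ArikiKoike q Q n)) ≤ S := by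
    rw [← adjoin_range_T, Algebra.adjoin_le_iff]
    rintro _ ⟨k, rfl⟩
    rcases lt_or_ge k n with hk | hk
    · exact hS k hk
    · rw [T_of_le _ _ _ hk]; exact Subalgebra.zero_mem _
  exact this (Algebra.mem_top (x := h)) v

/-- Left multiplication of the idempotent `π 1` is determined by the representation on words. -/
theorem mul_map_one (h : ArikiKoike q Q n) :
    h * C.π 1 = C.toH (P.rep n h (Finsupp.single C.base 1)) := by
  rw [← C.mul_toH, C.toH_single, C.col_base, C.map_mul_one]

end Corner

end Column

section Column

variable {R : Type u} [CommRing R] {q : Rˣ} {r : ℕ} {Q : Fin r → R} {n : ℕ} {s : ℕ} {hs : s ≤ r}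

namespace Corner

variable {N : Bool → ℕ} {B : Type*} [Ring B] [Algebra R B] {P : TwoColor q Q hs N B}
  (C : Corner P n)

/-- The component of the base word generates the representation on words. -/
theorem exists_rep_eq (hπ : ∀ x y, P.rep n (C.π x) (Finsupp.single C.base y) =
    Finsupp.single C.base (x * y)) (w : Shape n N →₀ B) :
    ∃ h, P.rep n h (Finsupp.single C.base 1) = w := by
  induction w using Finsupp.induction_linear with
  | zero => exact ⟨0, by rw [map_zero, LinearMap.zero_apply]⟩
  | add v w hv hw =>
    obtain ⟨g, hg⟩ := hv
    obtain ⟨h, hh⟩ := hw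
    exact ⟨g + h, by rw [map_add, LinearMap.add_apply, hg, hh]⟩
  | single ε y =>
    generalize hw : weight n ε.val = w
    induction w using Nat.strong_induction_on generalizing ε y with
    | _ w ih =>
      by_cases h : ∃ k, k + 1 < n ∧ ε.val k = true ∧ ε.val (k + 1) = false
      · obtain ⟨k, hk, h1, h2⟩ := h
        have hw' := weight_swp hk h1 h2
        have hv := Shape.swap_val hk ε
        have ih := fun y => ih (weight n (Shape.swap k ε).val) (by rw [hv]; omega)
          (Shape.swap k ε) y rfl
        have p1 : (Shape.swap k ε).val k = false := by rw [hv, swp_left, h2]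
        have p2 : (Shape.swap k ε).val (k + 1) = true := by rw [hv, swp_right, h1]
        obtain ⟨g, hg⟩ := ih y
        obtain ⟨h, hh⟩ := ih (P.a (idx (Shape.swap k ε).val (k + 1))
          (idx (Shape.swap k ε).val k) * y)
        refine ⟨T q Q n (k + 1) * g - h, ?_⟩
        rw [map_sub, map_mul, LinearMap.sub_apply, Module.End.mul_apply, hg, hh, P.rep_T hk,
          P.op_single_up p1 p2, add_sub_cancel_left, Shape.swap_swap]
      · refine ⟨C.π y, ?_⟩
        rw [hπ, mul_one, C.eq_base h]

end Corner

section

variable (hf : IsUnit (fPoly q Q n hs)) {b : ℕ} (hb : b ≤ n)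

/-- The algebra `H_b ⊗ H_{n-b}` as a corner of `H`. -/
noncomputable def tensorCorner : Corner (tensorColor hf b) n where
  π := cornerMap hf hb
  base := baseShape n hb
  π_mul := cornerMap_mul hf hb
  no_descent k hk h := by
    have h1 : baseWord (n - b) k = true := h.1
    have h2 : baseWord (n - b) (k + 1) = false := h.2
    simp only [baseWord, decide_eq_true_eq, decide_eq_false_iff_not] at h1 h2
    omega
  map_val k hk := by
    rw [cornerMap_one]
    change cornerMap hf hb (tensorX q Q n hs b (baseWord (n - b) k) (idx (baseWord (n - b)) k)) = _
    rcases lt_or_ge k (n - b) with h | h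
    · rw [baseWord_of_lt h, idx_baseWord_of_lt h, cornerMap_X_false hf hb h]
    · rw [baseWord_of_ge h, idx_baseWord_of_ge h, cornerMap_X_true hf hb (by omega),
        Nat.add_sub_cancel' h]
  map_t k hk h := by
    rw [cornerMap_one]
    change cornerMap hf hb (tensorT q Q n hs b (baseWord (n - b) k)
      (idx (baseWord (n - b)) k + 1)) = _
    have h' : baseWord (n - b) k = baseWord (n - b) (k + 1) := h
    rcases lt_or_ge k (n - b) with h | h
    · rcases lt_or_ge (k + 1) (n - b) with h1 | h1
      · rw [baseWord_of_lt h, idx_baseWord_of_lt h, cornerMap_T_false hf hb h1]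
      · rw [baseWord_of_lt h, baseWord_of_ge h1] at h'
        cases h'
    · rw [baseWord_of_ge h, idx_baseWord_of_ge h, cornerMap_T_true_succ hf hb (by omega),
        Nat.add_sub_cancel' h]

theorem rep_cornerMap_single (x y : TensorAlg q Q n hs b) :
    (tensorColor hf b).rep n (cornerMap hf hb x) (Finsupp.single (baseShape n hb) y) =
      Finsupp.single (baseShape n hb) (x * y) := by
  have he : ∀ y, (tensorColor hf b).rep n (idem q Q n hs (baseWord (n - b)) n)
      (Finsupp.single (baseShape n hb) y) = Finsupp.single (baseShape n hb) y :=
    (tensorColor hf b).rep_idem_single_self hf (baseShape n hb)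
  let S : Subalgebra R (TensorAlg q Q n hs b) :=
    { carrier := {x | ∀ y, (tensorColor hf b).rep n (cornerMap hf hb x)
        (Finsupp.single (baseShape n hb) y) = Finsupp.single (baseShape n hb) (x * y)}
      mul_mem' := fun {x z} hx hz y => by
        rw [cornerMap_mul, map_mul, Module.End.mul_apply, hz, hx, mul_assoc]
      add_mem' := fun {x z} hx hz y => by
        rw [map_add, map_add, LinearMap.add_apply, hx, hz, add_mul, Finsupp.single_add]
      algebraMap_mem' := fun c y => by
        rw [Algebra.algebraMap_eq_smul_one, map_smul, map_smul, LinearMap.smul_apply,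
          cornerMap_one, he, Finsupp.smul_single, smul_mul_assoc, one_mul] }
  have hS : S = ⊤ := by
    refine tensor_adjoin S fun c j hj => ?_
    intro y
    have key : ∀ k, k + 1 < n → baseWord (n - b) k = baseWord (n - b) (k + 1) →
        (tensorColor hf b).rep n (T q Q n (k + 1) * idem q Q n hs (baseWord (n - b)) n)
          (Finsupp.single (baseShape n hb) y) = Finsupp.single (baseShape n hb)
          (tensorT q Q n hs b (baseWord (n - b) k) (idx (baseWord (n - b)) k + 1) * y) := by
      intro k hk h
      rw [map_mul, Module.End.mul_apply, he, TwoColor.rep_T _ hk]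
      exact (tensorColor hf b).op_single_of_eq (ε := baseShape n hb) h y
    have key' : ∀ k, k < n →
        (tensorColor hf b).rep n (jm q Q n k * idem q Q n hs (baseWord (n - b)) n)
          (Finsupp.single (baseShape n hb) y) = Finsupp.single (baseShape n hb)
          (tensorX q Q n hs b (baseWord (n - b) k) (idx (baseWord (n - b)) k) * y) := by
      intro k hk
      rw [map_mul, Module.End.mul_apply, he, TwoColor.rep_jm _ hk, TwoColor.dop_single]
      rfl
    cases c
    · change j < n - b at hj
      rw [cornerMap_T_false hf hb hj]
      rcases j with _ | j
      · have := key' 0 (by omega)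
        rwa [baseWord_of_lt hj, idx_baseWord_of_lt hj] at this
      · have := key j (by omega) (by rw [baseWord_of_lt hj, baseWord_of_lt (by omega)])
        rwa [baseWord_of_lt (by omega), idx_baseWord_of_lt (by omega)] at this
    · change j < b at hj
      rcases j with _ | j
      · rw [cornerMap_T_true_zero hf hb hj]
        have := key' (n - b) (by omega)
        rwa [baseWord_of_ge le_rfl, idx_baseWord_of_ge le_rfl, Nat.sub_self] at this
      · rw [cornerMap_T_true_succ hf hb hj]
        have := key (n - b + j) (by omega) (by rw [baseWord_of_ge (by omega),
          baseWord_of_ge (by omega)])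
        rwa [baseWord_of_ge (by omega), idx_baseWord_of_ge (by omega),
          Nat.add_sub_cancel_left] at this
  have : x ∈ S := by rw [hS]; exact Algebra.mem_top
  exact this y

theorem cornerMap_injective : Function.Injective (cornerMap hf hb) := by
  intro x y h
  have h1 := rep_cornerMap_single hf hb x 1
  rw [h, rep_cornerMap_single hf hb y 1, mul_one, mul_one] at h1
  exact (Finsupp.single_injective _ h1).symm

/-- The image of the embedding is the whole corner `e H e`. The columns write `h e` as a sum of
products of columns and elements of the image, and `e` annihilates all columns but that of the base
word. -/
theorem exists_cornerMap_eq (h : ArikiKoike q Q n) : ∃ x, cornerMap hf hb x =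
    idem q Q n hs (baseWord (n - b)) n * h * idem q Q n hs (baseWord (n - b)) n := by
  have h1 := (tensorCorner hf hb).mul_map_one h
  have h2 : (tensorCorner hf hb).π 1 = idem q Q n hs (baseWord (n - b)) n := cornerMap_one hf hb
  have h3 : ∀ v, (tensorColor hf b).rep n (idem q Q n hs (baseWord (n - b)) n) v =
      Finsupp.single (baseShape n hb) (v (baseShape n hb)) :=
    (tensorColor hf b).rep_idem hf (baseShape n hb)
  refine ⟨(tensorColor hf b).rep n h (Finsupp.single (baseShape n hb) 1) (baseShape n hb), ?_⟩
  rw [mul_assoc, ← h2, h1, h2, (tensorCorner hf hb).mul_toH, h3,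
    (tensorCorner hf hb).toH_single]
  have h4 : (tensorCorner hf hb).col (baseShape n hb) = (tensorCorner hf hb).π 1 :=
    (tensorCorner hf hb).col_base
  rw [h4, (tensorCorner hf hb).map_one_mul]
  rfl

end

/-- The idempotents of distinct base words are orthogonal in the strong sense that there are no
homomorphisms between the right ideals which they generate. -/
theorem idem_mul_mul_idem_eq_zero (hf : IsUnit (fPoly q Q n hs)) {b c : ℕ} (hb : b ≤ n)
    (hc : c ≤ n) (hbc : b ≠ c) (h : ArikiKoike q Q n) :
    idem q Q n hs (baseWord (n - c)) n * h * idem q Q n hs (baseWord (n - b)) n = 0 := by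
  have h1 := (tensorCorner hf hb).mul_map_one h
  have h2 : (tensorCorner hf hb).π 1 = idem q Q n hs (baseWord (n - b)) n := cornerMap_one hf hb
  rw [mul_assoc, ← h2, h1, (tensorCorner hf hb).mul_toH,
    (tensorColor hf b).rep_idem_eq_zero (c := false), LinearMap.zero_apply, map_zero]
  rw [cnt_baseWord]
  simp only [strands]
  omega

/-- The representations on words are jointly faithful. -/
theorem eq_of_rep_eq (hf : IsUnit (fPoly q Q n hs)) {g h : ArikiKoike q Q n}
    (hgh : ∀ b ≤ n, (tensorColor hf b).rep n g = (tensorColor hf b).rep n h) : g = h := by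
  have key : ∀ z ∈ Submodule.span R
      {z | ∃ m ≤ n, ∃ x y, z = x * idem q Q n hs (baseWord m) n * y}, g * z = h * z := by
    intro z hz
    induction hz using Submodule.span_induction with
    | mem z hz =>
      obtain ⟨m, hm, x, y, rfl⟩ := hz
      have hb : n - m ≤ n := by omega
      have h2 : (tensorCorner hf hb).π 1 = idem q Q n hs (baseWord m) n := by
        have := cornerMap_one hf hb
        have h3 : n - (n - m) = m := Nat.sub_sub_self hm
        exact this.trans (by rw [h3])
      rw [← h2, ← mul_assoc g, ← mul_assoc g, ← mul_assoc h, ← mul_assoc h,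
        (tensorCorner hf hb).mul_map_one, (tensorCorner hf hb).mul_map_one, map_mul, map_mul,
        hgh _ hb]
    | zero => rw [mul_zero, mul_zero]
    | add x y _ _ hx hy => rw [mul_add, mul_add, hx, hy]
    | smul c x _ hx => rw [mul_smul_comm, mul_smul_comm, hx]
  have := key 1 (one_mem_span_idem hf)
  rwa [mul_one, mul_one] at this

end Column

/-! ### The right ideals `V^b` -/

section RightIdeal

open Polynomial

variable {R : Type u} [CommRing R] {q : Rˣ} {r : ℕ} {Q : Fin r → R} {n : ℕ} {s : ℕ} {hs : s ≤ r}

theorem isUnit_aeval_of_isCoprime {A : Type*} [Ring A] [Algebra R A] {p₁ p₂ : R[X]} {x : A}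
    (h : IsCoprime p₁ p₂) (hx : aeval x p₂ = 0) : IsUnit (aeval x p₁) := by
  obtain ⟨U, W, hUW⟩ := h
  have h1 := congrArg (aeval x) hUW
  rw [map_add, map_mul, map_mul, hx, mul_zero, add_zero, map_one] at h1
  refine ⟨⟨aeval x p₁, aeval x U, ?_, h1⟩, rfl⟩
  rw [← map_mul, mul_comm, map_mul, h1]

theorem cnt_eq_zero {c : Bool} {ε : ℕ → Bool} {k : ℕ} (h : ∀ p < k, ε p ≠ c) : cnt c ε k = 0 := by
  induction k with
  | zero => rfl
  | succ k ih => rw [cnt_succ_of_ne (h k (by omega)), ih fun p hp => h p (by omega)]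

theorem cnt_eq_self {c : Bool} {ε : ℕ → Bool} {k : ℕ} (h : ∀ p < k, ε p = c) : cnt c ε k = k := by
  induction k with
  | zero => rfl
  | succ k ih => rw [cnt_succ, if_pos (h k (by omega)), ih fun p hp => h p (by omega)]

variable (q Q n hs) in
/-- The product `u_m^-` (letter `true`) or `u_m^+` (letter `false`), ordered by Jucys–Murphy
elements. -/
noncomputable def colorProd (c : Bool) : ℕ → ArikiKoike q Q n
  | 0 => 1
  | m + 1 => aeval (jm q Q n m) (colorPoly q Q hs c 0) * colorProd c m

variable (q Q n) in
theorem jmProd_succ (c : List R) (m : ℕ) : jmProd q Q n c (m + 1) =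
    (c.map fun x => jm q Q n m - algebraMap R (ArikiKoike q Q n) x).prod * jmProd q Q n c m := by
  induction c with
  | nil => simp [jmProd]
  | cons x c ih =>
    have hcons : ∀ l, jmProd q Q n (x :: c) l =
        ((List.range l).map fun k => jm q Q n k - algebraMap R (ArikiKoike q Q n) x).prod *
          jmProd q Q n c l := fun l => rfl
    have hc : Commute ((List.range m).map fun k =>
        jm q Q n k - algebraMap R (ArikiKoike q Q n) x).prod
        ((jm q Q n m - algebraMap R (ArikiKoike q Q n) x) *
          (c.map fun x => jm q Q n m - algebraMap R (ArikiKoike q Q n) x).prod) := by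
      refine Commute.mul_right ?_ (Commute.list_prod_right _ _ fun y hy => ?_)
      all_goals
        refine Commute.list_prod_left _ _ fun z hz => ?_
        obtain ⟨k, -, rfl⟩ := List.mem_map.1 hz
        refine Commute.sub_left ?_ (Algebra.commutes x _)
      · exact (commute_jm_jm q Q n k m).sub_right (Algebra.commutes x _).symm
      · obtain ⟨x', -, rfl⟩ := List.mem_map.1 hy
        exact (commute_jm_jm q Q n k m).sub_right (Algebra.commutes x' _).symm
    rw [hcons, hcons, ih, List.range_succ, List.map_append, List.prod_append, List.map_singleton,
      List.prod_singleton, List.map_cons, List.prod_cons, mul_assoc, ← mul_assoc (jm q Q n m - _),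
      ← mul_assoc, hc.eq, mul_assoc]

theorem jmProd_ofFn_eq {k : ℕ} (p : Fin k → R) {c : Bool} (h : colorPoly q Q hs c 0 = paramPoly p)
    (m : ℕ) : jmProd q Q n (List.ofFn p) m = colorProd q Q n hs c m := by
  induction m with
  | zero =>
    refine List.prod_eq_one fun y hy => ?_
    obtain ⟨x, -, rfl⟩ := List.mem_map.1 hy
    rfl
  | succ m ih =>
    rw [jmProd_succ, ih, colorProd, h, aeval_paramPoly, List.map_ofFn]
    rfl

variable (q Q n hs) in
theorem jmProd_first (m : ℕ) :
    jmProd q Q n (List.ofFn (firstParams Q hs)) m = colorProd q Q n hs true m :=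
  jmProd_ofFn_eq _ rfl m

variable (q Q n hs) in
theorem jmProd_last (m : ℕ) :
    jmProd q Q n (List.ofFn (lastParams Q hs)) m = colorProd q Q n hs false m :=
  jmProd_ofFn_eq _ rfl m

namespace TwoColor

variable {N : Bool → ℕ} {B : Type*} [Ring B] [Algebra R B] (P : TwoColor q Q hs N B)

/-- The first letter `c` of a word gives the factor zero. -/
theorem rep_colorProd_eq_zero {c : Bool} {m : ℕ} (hm : m ≤ n) {ε : Shape n N}
    (h : ∃ p < m, ε.val p = c) (v : Shape n N →₀ B) :
    P.rep n (colorProd q Q n hs c m) v ε = 0 := by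
  induction m with
  | zero => obtain ⟨p, hp, -⟩ := h; omega
  | succ m ih =>
    rw [colorProd, map_mul, Module.End.mul_apply, P.rep_aeval_jm hm]
    by_cases h' : ∃ p < m, ε.val p = c
    · rw [ih (by omega) h', mul_zero]
    · have hm' : ε.val m = c := by
        obtain ⟨p, hp, hc⟩ := h
        rcases Nat.lt_succ_iff_lt_or_eq.1 hp with hp | rfl
        · exact absurd ⟨p, hp, hc⟩ h'
        · exact hc
      have h0 : idx ε.val m = 0 := by
        rw [idx, hm']
        exact cnt_eq_zero fun p hp hc => h' ⟨p, hp, hc⟩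
      have := P.ann_val ε hm
      rw [h0, hm'] at this
      rw [this, zero_mul]

theorem rep_colorProd_eq_mul (hf : IsUnit (fPoly q Q n hs)) {c : Bool} {m : ℕ} (hm : m ≤ n)
    {ε : Shape n N} (h : ∀ p < m, ε.val p ≠ c) :
    ∃ κ, IsUnit κ ∧ ∀ v, P.rep n (colorProd q Q n hs c m) v ε = κ * v ε := by
  induction m with
  | zero =>
    exact ⟨1, isUnit_one, fun v => by rw [colorProd, map_one, Module.End.one_apply, one_mul]⟩
  | succ m ih =>
    obtain ⟨κ, hκ, hv⟩ := ih (by omega) fun p hp => h p (by omega)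
    have hm' : ε.val m = !c := by
      have := h m (by omega)
      cases hc : ε.val m <;> cases c <;> simp_all
    have hann := P.ann_val ε hm
    rw [hm'] at hann
    have hidx : idx ε.val m ≤ m := by
      have := cnt_add_not (ε.val m) ε.val m
      rw [idx]
      omega
    have hu := isUnit_aeval_of_isCoprime
      (isCoprime_colorPoly hf (i := 0) (j := idx ε.val m) (by omega) c) hann
    refine ⟨_, hu.mul hκ, fun v => ?_⟩
    rw [colorProd, map_mul, Module.End.mul_apply, P.rep_aeval_jm hm, hv, mul_assoc]

theorem op_apply {k : ℕ} (v : Shape n N →₀ B) (δ : Shape n N) :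
    P.op n k v δ = P.dg k δ.val * v δ +
      P.off k (Shape.swap k δ).val * v (Shape.swap k δ) := by
  classical
  induction v using Finsupp.induction_linear with
  | zero => simp
  | add v w hv hw =>
    rw [map_add, Finsupp.add_apply, hv, hw, Finsupp.add_apply, Finsupp.add_apply, mul_add, mul_add]
    abel
  | single ε y =>
    rw [op_single, Finsupp.add_apply]
    congr 1
    · by_cases h : ε = δ
      · rw [h, Finsupp.single_eq_same, Finsupp.single_eq_same]
      · rw [Finsupp.single_apply, if_neg h, Finsupp.single_apply, if_neg h, mul_zero]
    · by_cases h : ε = Shape.swap k δ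
      · rw [h, Shape.swap_swap, Finsupp.single_eq_same, Finsupp.single_eq_same]
      · have h' : Shape.swap k ε ≠ δ := by
          rintro rfl
          exact h (Shape.swap_swap k ε).symm
        rw [Finsupp.single_apply, if_neg h', Finsupp.single_apply, if_neg h, mul_zero]

end TwoColor

theorem weight_swp_le {k : ℕ} (hk : k + 1 < n) (ε : ℕ → Bool) :
    weight n (swp k ε) ≤ weight n ε + 1 := by
  rcases h1 : ε k with _ | _ <;> rcases h2 : ε (k + 1) with _ | _
  · rw [swp_of_eq (h1.trans h2.symm)]; omega
  · have := weight_swp hk (ε := swp k ε) (by rw [swp_left, h2]) (by rw [swp_right, h1])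
    rw [swp_swp] at this
    omega
  · have := weight_swp hk h1 h2
    omega
  · rw [swp_of_eq (h1.trans h2.symm)]; omega

namespace Shape

variable {N : Bool → ℕ}

/-- The word `ε` arises from `δ` by exchanging letters along the list `l`, where each exchange
replaces the adjacent letters `false, true` by `true, false`. -/
def Path : List ℕ → Shape n N → Shape n N → Prop
  | [], δ, ε => δ = ε
  | i :: l, δ, ε => ∃ k, i = k + 1 ∧ k + 1 < n ∧ δ.val k = false ∧ δ.val (k + 1) = true ∧
      Path l (swap k δ) ε

theorem Path.append {l l' : List ℕ} {δ ε ζ : Shape n N} (h : Path l δ ε) (h' : Path l' ε ζ) :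
    Path (l ++ l') δ ζ := by
  induction l generalizing δ with
  | nil => rw [Path] at h; rwa [h]
  | cons i l ih =>
    obtain ⟨k, hi, hk, h1, h2, hl⟩ := h
    exact ⟨k, hi, hk, h1, h2, ih hl⟩

theorem weight_swap_of_ascent {k : ℕ} (hk : k + 1 < n) {δ : Shape n N} (h1 : δ.val k = false)
    (h2 : δ.val (k + 1) = true) : weight n (swap k δ).val = weight n δ.val + 1 := by
  rw [swap_val hk]
  have := weight_swp hk (ε := swp k δ.val) (by rw [swp_left, h2]) (by rw [swp_right, h1])
  rw [swp_swp] at this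
  omega

theorem Path.weight_eq {l : List ℕ} {δ ε : Shape n N} (h : Path l δ ε) :
    weight n ε.val = weight n δ.val + l.length := by
  induction l generalizing δ with
  | nil => rw [Path] at h; rw [h, List.length_nil, add_zero]
  | cons i l ih =>
    obtain ⟨k, -, hk, h1, h2, hl⟩ := h
    rw [ih hl, weight_swap_of_ascent hk h1 h2, List.length_cons]
    omega

/-- The first letter `false` is moved to the right across `b` letters `true`. -/
theorem exists_path_row (b : ℕ) {a : ℕ} (δ : Shape n N) (hab : a + b < n)
    (h1 : δ.val a = false) (h2 : ∀ p, a < p → p ≤ a + b → δ.val p = true) :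
    ∃ ε, Path ((List.range b).map fun j => a + 1 + j) δ ε ∧ (∀ p < a, ε.val p = δ.val p) ∧
      (∀ p, a ≤ p → p < a + b → ε.val p = true) ∧ ε.val (a + b) = false ∧
      ∀ p, a + b < p → ε.val p = δ.val p := by
  induction b with
  | zero => exact ⟨δ, rfl, fun _ _ => rfl, fun p h h' => by omega, h1, fun _ _ => rfl⟩
  | succ b ih =>
    obtain ⟨ε, hε, e1, e2, e3, e4⟩ := ih (by omega) fun p hp hp' => h2 p hp (by omega)
    have hk : a + b + 1 < n := by omega
    have e5 : ε.val (a + b + 1) = true := by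
      rw [e4 _ (by omega)]; exact h2 _ (by omega) (by omega)
    refine ⟨swap (a + b) ε, ?_, fun p hp => ?_, fun p hp hp' => ?_, ?_, fun p hp => ?_⟩
    · rw [List.range_succ, List.map_append]
      exact hε.append ⟨a + b, Nat.add_right_comm a 1 b, hk, e3, e5, rfl⟩
    · rw [swap_val hk, swp_of_ne _ (by omega) (by omega), e1 p hp]
    · rw [swap_val hk]
      rcases eq_or_ne p (a + b) with rfl | hne
      · rw [swp_left, e5]
      · rw [swp_of_ne _ hne (by omega), e2 p hp (by omega)]
    · rw [swap_val hk]
      exact (swp_right _ _).trans e3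
    · rw [swap_val hk, swp_of_ne _ (by omega) (by omega), e4 p (by omega)]

theorem exists_path_block (a b : ℕ) (δ : Shape n N) (hab : a + b ≤ n)
    (h1 : ∀ p < a, δ.val p = false) (h2 : ∀ p, a ≤ p → p < a + b → δ.val p = true) :
    ∃ ε, Path (blockWord a b) δ ε ∧ ∀ p < b, ε.val p = true := by
  induction a generalizing δ with
  | zero => exact ⟨δ, rfl, fun p hp => h2 p (by omega) (by omega)⟩
  | succ a ih =>
    obtain ⟨ε, hε, e1, e2, -, -⟩ := exists_path_row b δ (by omega) (h1 a (by omega))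
      fun p hp hp' => h2 p (by omega) (by omega)
    obtain ⟨ζ, hζ, hb⟩ := ih ε (by omega) (fun p hp => by rw [e1 p hp, h1 p (by omega)])
      fun p hp hp' => e2 p hp hp'
    exact ⟨ζ, hε.append hζ, hb⟩

end Shape

namespace TwoColor

variable {N : Bool → ℕ} {B : Type*} [Ring B] [Algebra R B] (P : TwoColor q Q hs N B)

/-- A generator lowers the weight of a word at most by one. -/
theorem rep_prod_single_eq_zero {l : List ℕ} (hl : ∀ i ∈ l, ∃ k, i = k + 1 ∧ k + 1 < n)
    {δ ε : Shape n N} (h : weight n δ.val + l.length < weight n ε.val) (y : B) :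
    P.rep n (l.map (T q Q n)).prod (Finsupp.single ε y) δ = 0 := by
  classical
  induction l generalizing δ with
  | nil =>
    rw [List.map_nil, List.prod_nil, map_one, Module.End.one_apply, Finsupp.single_apply, if_neg]
    rintro rfl
    simp at h
  | cons i l ih =>
    obtain ⟨k, rfl, hk⟩ := hl i List.mem_cons_self
    have hl' : ∀ i ∈ l, ∃ k, i = k + 1 ∧ k + 1 < n := fun i hi => hl i (List.mem_cons_of_mem _ hi)
    rw [List.length_cons] at h
    have hw := weight_swp_le hk δ.val
    rw [List.map_cons, List.prod_cons, map_mul, Module.End.mul_apply, P.rep_T hk, P.op_apply,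
      ih hl' (by omega), ih hl' (by rw [Shape.swap_val hk]; omega), mul_zero, mul_zero, add_zero]

/-- Along a path the leading coefficient is a product of units. -/
theorem rep_prod_single_of_path {l : List ℕ} {δ ε : Shape n N} (h : Shape.Path l δ ε) :
    ∃ γ : B, IsUnit γ ∧
      ∀ y, P.rep n (l.map (T q Q n)).prod (Finsupp.single ε y) δ = γ * y := by
  induction l generalizing δ with
  | nil =>
    rw [Shape.Path] at h
    refine ⟨1, isUnit_one, fun y => ?_⟩
    rw [List.map_nil, List.prod_nil, map_one, Module.End.one_apply, h, Finsupp.single_eq_same,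
      one_mul]
  | cons i l ih =>
    have hw := h.weight_eq
    obtain ⟨k, rfl, hk, h1, h2, hp⟩ := h
    obtain ⟨γ, hγ, hy⟩ := ih hp
    have hl : ∀ {l : List ℕ} {δ : Shape n N}, Shape.Path l δ ε →
        ∀ i ∈ l, ∃ k, i = k + 1 ∧ k + 1 < n := by
      intro l
      induction l with
      | nil => simp
      | cons i l ih =>
        rintro δ ⟨k, hi, hk, -, -, hp⟩ j hj
        rcases List.mem_cons.1 hj with rfl | hj
        · exact ⟨k, hi, hk⟩
        · exact ih hp j hj
    have h : δ.val k ≠ δ.val (k + 1) := by rw [h1, h2]; decide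
    have h' : swp k δ.val k ≠ swp k δ.val (k + 1) := by rw [swp_left, swp_right]; exact h.symm
    have h'' : ¬ swp k δ.val k = false := by rw [swp_left, h2]; decide
    obtain ⟨b1, b2⟩ := Shape.idx_bounds hk h1 h2
    have hoff : IsUnit (P.off k (Shape.swap k δ).val) := by
      rw [Shape.swap_val hk, off, if_neg h', if_neg h'', idx_swp_left h, idx_swp_right h]
      exact P.isUnit_g b1 b2
    refine ⟨_, hoff.mul hγ, fun y => ?_⟩
    rw [List.length_cons] at hw
    rw [List.map_cons, List.prod_cons, map_mul, Module.End.mul_apply, P.rep_T hk, P.op_apply, hy,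
      P.rep_prod_single_eq_zero (hl hp) (by omega), mul_zero, zero_add, mul_assoc]

end TwoColor

theorem v_eq (q : Rˣ) (Q : Fin r → R) (n : ℕ) (hs : s ≤ r) (b : ℕ) : v q Q n hs b =
    colorProd q Q n hs true (n - b) * TBlock q Q n (n - b) b * colorProd q Q n hs false b := by
  rw [v, jmProd_first, jmProd_last]

/-- In the representations on words, `v_b` maps into the component of the base word. The factor
`u_{n-b}^-` vanishes on words with a letter `true` among the first `n - b`, and the remaining words
with fewer than `b` letters `true` are dealt with by `u_b^+`. -/
theorem idem_mul_v (hf : IsUnit (fPoly q Q n hs)) {b : ℕ} (hb : b ≤ n) :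
    idem q Q n hs (baseWord (n - b)) n * v q Q n hs b = v q Q n hs b := by
  refine eq_of_rep_eq hf fun c hc => LinearMap.ext fun w => Finsupp.ext fun ε => ?_
  rw [map_mul, Module.End.mul_apply]
  by_cases h : ∀ p < n, baseWord (n - b) p = ε.val p
  · exact (tensorColor hf c).rep_idem_apply_of_eq hf le_rfl h _
  rw [(tensorColor hf c).rep_idem_apply_of_ne le_rfl (by push Not at h; exact h), v_eq, map_mul,
    Module.End.mul_apply, map_mul, Module.End.mul_apply]
  symm
  by_cases h1 : ∃ p < n - b, ε.val p = true
  · exact (tensorColor hf c).rep_colorProd_eq_zero (by omega) h1 _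
  -- If the first `n - b` letters of `ε` are `false`, then there are fewer than `b` letters `true`.
  push Not at h1
  have h1 : ∀ p < n - b, ε.val p = false := fun p hp => Bool.eq_false_of_not_eq_true (h1 p hp)
  have hcb : c < b := by
    by_contra hcb
    refine h fun p hp => ?_
    rcases lt_or_ge p (n - b) with hp' | hp'
    · rw [baseWord_of_lt hp', h1 p hp']
    · rw [baseWord_of_ge hp']
      by_contra hne
      have hpf : ε.val p = false := Bool.eq_false_of_not_eq_true fun h => hne h.symm
      have h2 : cnt false ε.val (n - b) = n - b := cnt_eq_self h1
      have h3 := cnt_mono false ε.val hp'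
      have h4 := ε.idx_lt hp
      rw [idx, hpf] at h4
      simp only [strands] at h4
      omega
  have hzero : (tensorColor hf c).rep n (colorProd q Q n hs false b) w = 0 := by
    refine Finsupp.ext fun δ => ?_
    refine (tensorColor hf c).rep_colorProd_eq_zero hb ?_ w
    by_contra hδ
    push Not at hδ
    have h2 : cnt true δ.val b = b :=
      cnt_eq_self fun p hp => Bool.eq_true_of_not_eq_false (hδ p hp)
    have h3 := cnt_mono true δ.val hb
    rw [δ.count] at h3
    simp only [strands] at h3
    omega
  rw [hzero, map_zero, map_zero, Finsupp.zero_apply]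

/-- The operator `v_b` maps the component of the word with the letters `true` in front onto the
component of the base word: `u_b^+` and `u_{n-b}^-` act as units there, and so does the leading
coefficient of `T_w`. -/
theorem exists_v_mul_eq (hf : IsUnit (fPoly q Q n hs)) {b : ℕ} (hb : b ≤ n) :
    ∃ h, v q Q n hs b * h = idem q Q n hs (baseWord (n - b)) n := by
  have hbase1 : ∀ p < n - b, (baseShape n hb).val p = false := fun p hp => baseWord_of_lt hp
  obtain ⟨ε, hε, hεb⟩ := Shape.exists_path_block (n - b) b (baseShape n hb) (by omega) hbase1
    fun p hp _ => baseWord_of_ge hp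
  obtain ⟨γ, hγ, hT⟩ := (tensorColor hf b).rep_prod_single_of_path hε
  obtain ⟨κ₁, hκ₁, h₁⟩ := (tensorColor hf b).rep_colorProd_eq_mul hf (c := false) hb
    (ε := ε) fun p hp => by rw [hεb p hp]; decide
  obtain ⟨κ₂, hκ₂, h₂⟩ := (tensorColor hf b).rep_colorProd_eq_mul hf (c := true)
    (show n - b ≤ n by omega) (ε := baseShape n hb) fun p hp => by rw [hbase1 p hp]; decide
  obtain ⟨z, hz⟩ := ((hκ₂.mul hγ).mul hκ₁).exists_right_inv
  obtain ⟨g, hg⟩ := (tensorCorner hf hb).exists_rep_eq (rep_cornerMap_single hf hb)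
    (Finsupp.single ε z)
  have hdiag : (tensorColor hf b).rep n (colorProd q Q n hs false b) (Finsupp.single ε z) =
      Finsupp.single ε (κ₁ * z) := by
    classical
    refine Finsupp.ext fun δ => ?_
    by_cases hδ : ∃ p < b, δ.val p = false
    · rw [(tensorColor hf b).rep_colorProd_eq_zero hb hδ, Finsupp.single_apply, if_neg]
      rintro rfl
      obtain ⟨p, hp, hp'⟩ := hδ
      rw [hεb p hp] at hp'
      cases hp'
    · -- all letters `true` are among the first `b` letters of `δ`
      have key : ∀ δ : Shape n (strands n b), (∀ p < b, δ.val p = true) →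
          ∀ p < n, δ.val p = decide (p < b) := by
        intro δ hδ p hp
        rcases lt_or_ge p b with hp' | hp'
        · rw [hδ p hp', decide_eq_true hp']
        · rw [decide_eq_false (by omega)]
          by_contra hne
          have hpt : δ.val p = true := Bool.eq_true_of_not_eq_false hne
          have h2 : cnt true δ.val b = b := cnt_eq_self hδ
          have h3 := cnt_mono true δ.val hp'
          have h4 := δ.idx_lt hp
          rw [idx, hpt] at h4
          simp only [strands] at h4
          omega
      push Not at hδ
      have hδε : δ = ε := Shape.ext_of_lt fun p hp => by
        rw [key δ (fun p hp => Bool.eq_true_of_not_eq_false (hδ p hp)) p hp, key ε hεb p hp]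
      rw [hδε, h₁, Finsupp.single_eq_same, Finsupp.single_eq_same]
  have hrep : (tensorColor hf b).rep n (v q Q n hs b * g)
      (Finsupp.single (baseShape n hb) 1) = Finsupp.single (baseShape n hb) 1 := by
    have hg' : (tensorColor hf b).rep n g (Finsupp.single (baseShape n hb) 1) =
      Finsupp.single ε z := hg
    have he : ∀ w, (tensorColor hf b).rep n (v q Q n hs b) w = Finsupp.single (baseShape n hb)
        ((tensorColor hf b).rep n (v q Q n hs b) w (baseShape n hb)) := by
      intro w
      rw [← (tensorColor hf b).rep_idem hf (baseShape n hb), ← Module.End.mul_apply, ← map_mul]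
      congr 2
      exact (idem_mul_v hf hb).symm
    rw [map_mul, Module.End.mul_apply, hg', he, v_eq, map_mul, Module.End.mul_apply, map_mul,
      Module.End.mul_apply, hdiag, h₂]
    congr 1
    rw [TBlock, hT, ← mul_assoc, ← mul_assoc, hz]
  refine ⟨g * idem q Q n hs (baseWord (n - b)) n, ?_⟩
  have h1 := (tensorCorner hf hb).mul_map_one (v q Q n hs b * g)
  have h2 : (tensorCorner hf hb).π 1 = idem q Q n hs (baseWord (n - b)) n := cornerMap_one hf hb
  have h3 : (tensorColor hf b).rep n (v q Q n hs b * g)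
      (Finsupp.single (tensorCorner hf hb).base 1) = Finsupp.single (tensorCorner hf hb).base 1 :=
    hrep
  rw [h2, h3, (tensorCorner hf hb).toH_single, (tensorCorner hf hb).col_base,
    (tensorCorner hf hb).map_mul_one, h2] at h1
  rw [← mul_assoc, h1]

/-- The right ideal `V^b` is `e H` for the idempotent `e` of the base word. -/
theorem V_eq (hf : IsUnit (fPoly q Q n hs)) {b : ℕ} (hb : b ≤ n) :
    V q Q n hs b = fixedIdeal (idem q Q n hs (baseWord (n - b)) n) := by
  refine le_antisymm ?_ ?_
  · rw [V, Submodule.span_singleton_le_iff_mem]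
    exact idem_mul_v hf hb
  · rw [← span_eq_fixedIdeal (idem_mul_idem hf _ le_rfl le_rfl),
      Submodule.span_singleton_le_iff_mem]
    obtain ⟨h, hh⟩ := exists_v_mul_eq hf hb
    rw [← hh]
    exact Submodule.smul_mem _ (MulOpposite.op h) (Submodule.mem_span_singleton_self _)

end RightIdeal
end ArikiKoike

/-! ### Full idempotents and Morita equivalence -/

section Morita

open CategoryTheory
open scoped ModuleCat.Algebra

/-- An algebra `S` which is isomorphic, through `ι`, to the corner `e A e` of an algebra `A` at an
idempotent `e = ι 1`, where `e` is full: the two-sided ideal which it generates contains `1`. -/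
structure FullCorner (R A S : Type*) [CommRing R] [Ring A] [Algebra R A] [Ring S]
    [Algebra R S] where
  ι : S →ₗ[R] A
  ι_mul : ∀ x y, ι (x * y) = ι x * ι y
  injective : Function.Injective ι
  exists_eq : ∀ a, ∃ x, ι x = ι 1 * a * ι 1
  size : ℕ
  left : Fin size → A
  right : Fin size → A
  sum_eq : ∑ i, left i * ι 1 * right i = 1

namespace FullCorner

variable {R A S : Type*} [CommRing R] [Ring A] [Algebra R A] [Ring S] [Algebra R S]
  (F : FullCorner R A S)

theorem ι_one_mul (x : S) : F.ι 1 * F.ι x = F.ι x := by rw [← F.ι_mul, one_mul]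

theorem ι_mul_one (x : S) : F.ι x * F.ι 1 = F.ι x := by rw [← F.ι_mul, mul_one]

/-- The map `a ↦ e a e`, with values in `S`. -/
noncomputable def sec (a : A) : S := (F.exists_eq a).choose

theorem ι_sec (a : A) : F.ι (F.sec a) = F.ι 1 * a * F.ι 1 := (F.exists_eq a).choose_spec

theorem sec_add (a b : A) : F.sec (a + b) = F.sec a + F.sec b :=
  F.injective (by rw [map_add, F.ι_sec, F.ι_sec, F.ι_sec, mul_add, add_mul])

theorem sec_zero : F.sec 0 = 0 :=
  F.injective (by rw [map_zero, F.ι_sec, mul_zero, zero_mul])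

theorem sec_sum {α : Type*} (t : Finset α) (f : α → A) :
    F.sec (∑ i ∈ t, f i) = ∑ i ∈ t, F.sec (f i) :=
  map_sum (⟨⟨F.sec, F.sec_zero⟩, F.sec_add⟩ : A →+ S) f t

theorem sec_one : F.sec 1 = 1 := F.injective (by rw [F.ι_sec, mul_one, F.ι_mul_one])

theorem sec_ι (x : S) : F.sec (F.ι x) = x :=
  F.injective (by rw [F.ι_sec, F.ι_one_mul, F.ι_mul_one])

theorem sec_mul_sec (a b : A) : F.sec a * F.sec b = F.sec (a * F.ι 1 * b) := by
  refine F.injective ?_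
  rw [F.ι_mul, F.ι_sec, F.ι_sec, F.ι_sec]
  have := F.ι_mul_one 1
  simp only [mul_assoc]
  rw [← mul_assoc (F.ι 1) (F.ι 1), this]

theorem sec_mul_ι (a : A) (x : S) : F.sec (a * F.ι x) = F.sec a * x := by
  conv_rhs => rw [← F.sec_ι x, F.sec_mul_sec, mul_assoc, F.ι_one_mul]

/-- The matrix product of the matrices with entries `e p'_i a p_j e` and `e p'_i b p_j e`. -/
theorem sum_sec_mul_sec (a b c d : A) :
    ∑ i, F.sec (a * b * F.left i) * F.sec (F.right i * c * d) = F.sec (a * b * c * d) := by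
  simp only [F.sec_mul_sec]
  rw [← F.sec_sum]
  congr 1
  calc ∑ i, a * b * F.left i * F.ι 1 * (F.right i * c * d) =
      a * b * (∑ i, F.left i * F.ι 1 * F.right i) * (c * d) := by
        simp only [Finset.mul_sum, Finset.sum_mul, mul_assoc]
    _ = a * b * c * d := by rw [F.sum_eq, mul_one]; simp only [mul_assoc]

section Functor

variable {M M' : Type*} [AddCommGroup M] [Module A M] [AddCommGroup M'] [Module A M']

/-- The image of the idempotent in a module. -/
def Fixed (F : FullCorner R A S) (M : Type*) [AddCommGroup M] [Module A M] : Type _ :=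
  (DistribSMul.toAddMonoidHom M (F.ι 1)).eqLocus (AddMonoidHom.id M)

instance : AddCommGroup (F.Fixed M) :=
  inferInstanceAs (AddCommGroup ((DistribSMul.toAddMonoidHom M (F.ι 1)).eqLocus
    (AddMonoidHom.id M)))

/-- The inclusion of the image of the idempotent. -/
def incl (M : Type*) [AddCommGroup M] [Module A M] : F.Fixed M →+ M :=
  AddSubgroup.subtype _

theorem incl_injective : Function.Injective (F.incl M) := Subtype.val_injective

theorem ι_one_smul_incl (m : F.Fixed M) : F.ι 1 • F.incl M m = F.incl M m := m.2

/-- An element which is fixed by the idempotent. -/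
def toFixed (m : M) (h : F.ι 1 • m = m) : F.Fixed M := ⟨m, h⟩

theorem incl_toFixed (m : M) (h : F.ι 1 • m = m) : F.incl M (F.toFixed m h) = m := rfl

instance : Module S (F.Fixed M) where
  smul x m := F.toFixed (F.ι x • F.incl M m) (by rw [← mul_smul, F.ι_one_mul])
  one_smul m := F.incl_injective (F.ι_one_smul_incl m)
  mul_smul x y m := F.incl_injective (by
    change F.ι (x * y) • F.incl M m = F.ι x • F.ι y • F.incl M m
    rw [F.ι_mul, mul_smul])
  smul_zero x := F.incl_injective (by
    change F.ι x • F.incl M 0 = F.incl M 0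
    rw [map_zero, smul_zero])
  smul_add x m m' := F.incl_injective (by
    change F.ι x • F.incl M (m + m') = F.ι x • F.incl M m + F.ι x • F.incl M m'
    rw [map_add, smul_add])
  add_smul x y m := F.incl_injective (by
    change F.ι (x + y) • F.incl M m = F.ι x • F.incl M m + F.ι y • F.incl M m
    rw [map_add, add_smul])
  zero_smul m := F.incl_injective (by
    change F.ι 0 • F.incl M m = F.incl M 0
    rw [map_zero, zero_smul, map_zero])

theorem incl_smul (x : S) (m : F.Fixed M) : F.incl M (x • m) = F.ι x • F.incl M m := rfl

theorem ι_algebraMap_smul_incl (c : R) (m : F.Fixed M) :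
    F.ι (algebraMap R S c) • F.incl M m = algebraMap R A c • F.incl M m := by
  rw [Algebra.algebraMap_eq_smul_one c, map_smul, Algebra.smul_def, mul_smul, F.ι_one_smul_incl]

/-- The restriction of a homomorphism to the images of the idempotent. -/
def restrict (f : M →ₗ[A] M') : F.Fixed M →ₗ[S] F.Fixed M' where
  toFun m := F.toFixed (f (F.incl M m)) (by rw [← map_smul, F.ι_one_smul_incl])
  map_add' m m' := F.incl_injective (by
    rw [incl_toFixed, map_add (F.incl M), map_add (F.incl M'), incl_toFixed, incl_toFixed, map_add])
  map_smul' x m := F.incl_injective (by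
    rw [RingHom.id_apply, incl_toFixed, incl_smul, incl_smul, incl_toFixed, map_smul])

theorem incl_restrict (f : M →ₗ[A] M') (m : F.Fixed M) :
    F.incl M' (F.restrict f m) = f (F.incl M m) := rfl

/-- The component `e p'_i m` of an element `m` of a module. -/
def coord (i : Fin F.size) (m : M) : F.Fixed M :=
  F.toFixed ((F.ι 1 * F.right i) • m) (by rw [← mul_smul, ← mul_assoc, F.ι_mul_one])

theorem sum_left_smul_coord (m : M) : ∑ i, F.left i • F.incl M (F.coord i m) = m := by
  simp only [coord, incl_toFixed, ← mul_smul, ← mul_assoc]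
  rw [← Finset.sum_smul, F.sum_eq, one_smul]

theorem coord_smul (i : Fin F.size) (a : A) (m : M) :
    F.coord i (a • m) = ∑ j, F.sec (F.right i * a * F.left j) • F.coord j m := by
  refine F.incl_injective ?_
  rw [map_sum]
  simp only [incl_smul, coord, incl_toFixed, F.ι_sec, ← mul_smul]
  rw [← Finset.sum_smul]
  congr 1
  calc F.ι 1 * F.right i * a = F.ι 1 * F.right i * a *
      ∑ j, F.left j * F.ι 1 * F.right j := by rw [F.sum_eq, mul_one]
    _ = _ := by
      rw [Finset.mul_sum]
      refine Finset.sum_congr rfl fun j _ => ?_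
      have := F.ι_mul_one 1
      simp only [mul_assoc]
      rw [← mul_assoc (F.ι 1) (F.ι 1), this]

theorem restrict_injective {f g : M →ₗ[A] M'} (h : F.restrict f = F.restrict g) : f = g := by
  refine LinearMap.ext fun m => ?_
  rw [← F.sum_left_smul_coord m, map_sum, map_sum]
  refine Finset.sum_congr rfl fun i _ => ?_
  rw [map_smul, map_smul, ← incl_restrict, h, incl_restrict]

/-- Each homomorphism between the images of the idempotent extends. -/
theorem restrict_surjective (g : F.Fixed M →ₗ[S] F.Fixed M') :
    ∃ f : M →ₗ[A] M', F.restrict f = g := by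
  have hadd : ∀ i (m m' : M), F.coord i (m + m') = F.coord i m + F.coord i m' := fun i m m' =>
    F.incl_injective (by rw [map_add]; exact smul_add _ _ _)
  refine ⟨⟨⟨fun m => ∑ i, F.left i • F.incl M' (g (F.coord i m)), fun m m' => ?_⟩,
    fun a m => ?_⟩, LinearMap.ext fun m => F.incl_injective ?_⟩
  · simp only [hadd, map_add, smul_add, Finset.sum_add_distrib]
  · simp only [coord_smul, map_sum, map_smul, incl_smul, RingHom.id_apply, F.ι_sec,
      Finset.smul_sum]
    rw [Finset.sum_comm]
    refine Finset.sum_congr rfl fun j _ => ?_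
    simp only [← mul_smul]
    rw [← Finset.sum_smul]
    have h1 : ∑ i, F.left i * (F.ι 1 * (F.right i * a * F.left j) * F.ι 1) =
        (∑ i, F.left i * F.ι 1 * F.right i) * (a * F.left j * F.ι 1) := by
      rw [Finset.sum_mul]
      simp only [mul_assoc]
    rw [h1, F.sum_eq, one_mul, mul_smul, F.ι_one_smul_incl]
  · change ∑ i, F.left i • F.incl M' (g (F.coord i (F.incl M m))) = F.incl M' (g m)
    have h1 : ∀ i, F.coord i (F.incl M m) = F.sec (F.right i) • m := by
      intro i
      refine F.incl_injective ?_
      rw [incl_smul, F.ι_sec, mul_smul, F.ι_one_smul_incl]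
      rfl
    simp only [h1, map_smul, incl_smul, F.ι_sec, ← mul_smul]
    rw [← Finset.sum_smul]
    have h2 : ∑ i, F.left i * (F.ι 1 * F.right i * F.ι 1) =
        (∑ i, F.left i * F.ι 1 * F.right i) * F.ι 1 := by
      rw [Finset.sum_mul]
      simp only [mul_assoc]
    rw [h2, F.sum_eq, one_mul, F.ι_one_smul_incl]

end Functor

section Induction

variable {N : Type*} [AddCommGroup N] [Module S N]

/-- The action of `a` on columns with entries in an `S`-module through the matrix with the entries
`e p'_i a p_j e`. -/
noncomputable def act (N : Type*) [AddCommGroup N] [Module S N] (a : A) :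
    (Fin F.size → N) →+ (Fin F.size → N) where
  toFun x i := ∑ j, F.sec (F.right i * a * F.left j) • x j
  map_zero' := by
    funext i
    simp
  map_add' x y := by
    funext i
    simp [smul_add, Finset.sum_add_distrib]

theorem act_apply (a : A) (x : Fin F.size → N) (i : Fin F.size) :
    F.act N a x i = ∑ j, F.sec (F.right i * a * F.left j) • x j := rfl

theorem act_mul (a b : A) (x : Fin F.size → N) : F.act N (a * b) x = F.act N a (F.act N b x) := by
  funext i
  simp only [act_apply, Finset.smul_sum, ← mul_smul]
  rw [Finset.sum_comm]
  refine Finset.sum_congr rfl fun j _ => ?_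
  rw [← Finset.sum_smul, F.sum_sec_mul_sec, ← mul_assoc (F.right i)]

theorem act_add (a b : A) (x : Fin F.size → N) :
    F.act N (a + b) x = F.act N a x + F.act N b x := by
  funext i
  simp only [act_apply, Pi.add_apply, mul_add, add_mul, F.sec_add, add_smul,
    Finset.sum_add_distrib]

theorem act_zero (x : Fin F.size → N) : F.act N 0 x = 0 := by
  funext i
  simp [act_apply, F.sec_zero]

/-- The `A`-module induced from an `S`-module: the columns which are fixed by the idempotent matrix
with the entries `e p'_i p_j e`. -/
def Induced (F : FullCorner R A S) (N : Type*) [AddCommGroup N] [Module S N] : Type _ :=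
  (F.act N 1).eqLocus (AddMonoidHom.id (Fin F.size → N))

noncomputable instance : AddCommGroup (F.Induced N) :=
  inferInstanceAs (AddCommGroup ((F.act N 1).eqLocus (AddMonoidHom.id (Fin F.size → N))))

/-- The entries of an element of the induced module. -/
noncomputable def entries (N : Type*) [AddCommGroup N] [Module S N] :
    F.Induced N →+ (Fin F.size → N) :=
  AddSubgroup.subtype _

theorem entries_injective : Function.Injective (F.entries N) := Subtype.val_injective

theorem act_one_entries (x : F.Induced N) : F.act N 1 (F.entries N x) = F.entries N x := x.2

/-- An element of the induced module, given by its entries. -/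
noncomputable def ofEntries (x : Fin F.size → N) (h : F.act N 1 x = x) : F.Induced N := ⟨x, h⟩

theorem entries_ofEntries (x : Fin F.size → N) (h : F.act N 1 x = x) :
    F.entries N (F.ofEntries x h) = x := rfl

noncomputable instance : Module A (F.Induced N) where
  smul a x := F.ofEntries (F.act N a (F.entries N x)) (by rw [← F.act_mul, one_mul])
  one_smul x := F.entries_injective (F.act_one_entries x)
  mul_smul a b x := F.entries_injective (F.act_mul a b _)
  smul_zero a := F.entries_injective (by
    change F.act N a (F.entries N 0) = F.entries N 0
    rw [map_zero, map_zero])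
  smul_add a x y := F.entries_injective (by
    change F.act N a (F.entries N (x + y)) =
      F.act N a (F.entries N x) + F.act N a (F.entries N y)
    rw [map_add, map_add])
  add_smul a b x := F.entries_injective (F.act_add a b _)
  zero_smul x := F.entries_injective (F.act_zero _)

theorem entries_smul (a : A) (x : F.Induced N) :
    F.entries N (a • x) = F.act N a (F.entries N x) := rfl

/-- The image of the idempotent in the induced module is the given `S`-module. -/
noncomputable def fixedInducedEquiv (N : Type*) [AddCommGroup N] [Module S N] :
    N ≃ₗ[S] F.Fixed (F.Induced N) :=
  have h1 : ∀ (a : A) (y : N), F.act N a (fun i => F.sec (F.right i) • y) =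
      fun i => F.sec (F.right i * a) • y := by
    intro a y
    funext i
    simp only [act_apply, ← mul_smul]
    rw [← Finset.sum_smul]
    have := F.sum_sec_mul_sec (F.right i) a 1 1
    simp only [mul_one] at this
    rw [this]
  { toFun := fun y => F.toFixed (F.ofEntries (fun i => F.sec (F.right i) • y) (by
        rw [h1]; simp only [mul_one])) (F.entries_injective (by
          rw [entries_smul, entries_ofEntries, h1]
          funext i
          rw [F.sec_mul_ι, mul_one]))
    map_add' := fun y z => F.incl_injective (F.entries_injective (by
      funext i
      exact smul_add _ _ _))
    map_smul' := fun x y => F.incl_injective (F.entries_injective (by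
      change (fun i => F.sec (F.right i) • x • y) =
        F.act N (F.ι x) fun i => F.sec (F.right i) • y
      rw [h1]
      funext i
      rw [F.sec_mul_ι, mul_smul]))
    invFun := fun z => ∑ j, F.sec (F.left j) • F.entries N (F.incl _ z) j
    left_inv := fun y => by
      change ∑ j, F.sec (F.left j) • F.sec (F.right j) • y = y
      simp only [← mul_smul]
      rw [← Finset.sum_smul]
      have := F.sum_sec_mul_sec 1 1 1 1
      simp only [one_mul, mul_one] at this
      rw [this, F.sec_one, one_smul]
    right_inv := fun z => F.incl_injective (F.entries_injective (by
      rw [incl_toFixed, entries_ofEntries]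
      conv_rhs => rw [← F.ι_one_smul_incl z, entries_smul]
      funext i
      rw [act_apply, Finset.smul_sum]
      refine Finset.sum_congr rfl fun j _ => ?_
      rw [← mul_smul, F.sec_mul_sec])) }

end Induction

end FullCorner

namespace FullCorner

variable {R : Type*} {A S : Type u} [CommRing R] [Ring A] [Algebra R A] [Ring S] [Algebra R S]
  (F : FullCorner R A S)

/-- The functor which maps a module to the image of the idempotent. -/
def functor : ModuleCat.{u} A ⥤ ModuleCat.{u} S where
  obj M := ModuleCat.of S (F.Fixed M)
  map f := ModuleCat.ofHom (F.restrict f.hom)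

instance : F.functor.Faithful where
  map_injective h :=
    ModuleCat.hom_ext (F.restrict_injective (congrArg ModuleCat.Hom.hom h))

instance : F.functor.Full where
  map_surjective {_ _} g := by
    obtain ⟨f, hf⟩ := F.restrict_surjective g.hom
    exact ⟨ModuleCat.ofHom f, ModuleCat.hom_ext hf⟩

instance : F.functor.EssSurj where
  mem_essImage N := ⟨ModuleCat.of A (F.Induced N), ⟨(F.fixedInducedEquiv N).toModuleIso.symm⟩⟩

instance : F.functor.IsEquivalence where

instance : F.functor.Linear R where
  map_smul {_ _} f c := ModuleCat.hom_ext (LinearMap.ext fun m => F.incl_injective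
    (F.ι_algebraMap_smul_incl c (F.restrict f.hom m)).symm)

/-- An algebra is Morita equivalent to its corner at a full idempotent `e`, through `M ↦ e M`. -/
theorem isMoritaEquivalent (F : FullCorner R A S) : IsMoritaEquivalent R A S where
  cond := ⟨{ eqv := F.functor.asEquivalence
             linear := inferInstanceAs (F.functor.Linear R) }⟩

end FullCorner

end Morita

namespace ArikiKoike

/-! ### The action on `V^b` and the Morita equivalence -/

section Final

variable {R : Type u} [CommRing R] {q : Rˣ} {r : ℕ} {Q : Fin r → R} {n : ℕ} {s : ℕ} {hs : s ≤ r}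

theorem idem_mul_mem (hf : IsUnit (fPoly q Q n hs)) {b : ℕ} (hb : b ≤ n) (w : V q Q n hs b) :
    idem q Q n hs (baseWord (n - b)) n * (w : ArikiKoike q Q n) = w :=
  mem_fixedIdeal.1 ((V_eq hf hb).le w.2)

/-- The left action of `H_b ⊗ H_{n-b}` on `V^b`, by left multiplication through the embedding. -/
noncomputable def leftAction (hf : IsUnit (fPoly q Q n hs)) {b : ℕ} (hb : b ≤ n) :
    TensorAlg q Q n hs b →ₐ[R] Module.End (ArikiKoike q Q n)ᵐᵒᵖ (V q Q n hs b) :=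
  have hmem : ∀ (x : TensorAlg q Q n hs b) (w : ArikiKoike q Q n),
      cornerMap hf hb x * w ∈ V q Q n hs b := fun x w => by
    rw [V_eq hf hb, mem_fixedIdeal, ← mul_assoc, idem_mul_cornerMap]
  have hone : ∀ w : V q Q n hs b, cornerMap hf hb 1 * (w : ArikiKoike q Q n) = w := fun w => by
    rw [cornerMap_one, idem_mul_mem hf hb]
  { toFun := fun x =>
      { toFun := fun w => ⟨cornerMap hf hb x * w, hmem x w⟩
        map_add' := fun _ _ => Subtype.ext (mul_add _ _ _)
        map_smul' := fun c _ => Subtype.ext (mul_smul_comm c _ _) }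
    map_one' := LinearMap.ext fun w => Subtype.ext (hone w)
    map_mul' := fun x y => LinearMap.ext fun w => Subtype.ext (by
      change cornerMap hf hb (x * y) * (w : ArikiKoike q Q n) = _
      rw [cornerMap_mul, mul_assoc]
      rfl)
    map_zero' := LinearMap.ext fun w => Subtype.ext (by
      change cornerMap hf hb 0 * (w : ArikiKoike q Q n) = 0
      rw [map_zero, zero_mul])
    map_add' := fun x y => LinearMap.ext fun w => Subtype.ext (by
      change cornerMap hf hb (x + y) * (w : ArikiKoike q Q n) = _
      rw [map_add, add_mul]
      rfl)
    commutes' := fun c => LinearMap.ext fun w => Subtype.ext (by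
      change cornerMap hf hb (algebraMap R _ c) * (w : ArikiKoike q Q n) = c • _
      rw [Algebra.algebraMap_eq_smul_one, map_smul, smul_mul_assoc, hone]
      rfl) }

theorem leftAction_apply (hf : IsUnit (fPoly q Q n hs)) {b : ℕ} (hb : b ≤ n)
    (x : TensorAlg q Q n hs b) (w : V q Q n hs b) :
    (leftAction hf hb x w : ArikiKoike q Q n) = cornerMap hf hb x * w := rfl

theorem leftAction_of_eq (hf : IsUnit (fPoly q Q n hs)) {b : ℕ} (hb : b ≤ n)
    {x : TensorAlg q Q n hs b} {h : ArikiKoike q Q n}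
    (hx : cornerMap hf hb x = h * idem q Q n hs (baseWord (n - b)) n) (w : V q Q n hs b) :
    (leftAction hf hb x w : ArikiKoike q Q n) = h * w := by
  rw [leftAction_apply, hx, mul_assoc, idem_mul_mem hf hb]

theorem isLeftAction_leftAction (hf : IsUnit (fPoly q Q n hs)) {b : ℕ} (hb : b ≤ n) :
    IsLeftAction q Q n hs b (leftAction hf hb) where
  left_zero h := leftAction_of_eq hf hb (cornerMap_T_true_zero hf hb h)
  left_pos i h1 hi := by
    obtain ⟨j, rfl⟩ : ∃ j, i = j + 1 := ⟨i - 1, by omega⟩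
    exact leftAction_of_eq hf hb (cornerMap_T_true_succ hf hb hi)
  right_zero h := leftAction_of_eq hf hb (cornerMap_T_false hf hb h)
  right_pos j _ hj := leftAction_of_eq hf hb (cornerMap_T_false hf hb hj)

theorem idem_mem (hf : IsUnit (fPoly q Q n hs)) {b : ℕ} (hb : b ≤ n) :
    idem q Q n hs (baseWord (n - b)) n ∈ V q Q n hs b := by
  rw [V_eq hf hb]
  exact idem_mul_idem hf _ le_rfl le_rfl

theorem leftAction_bijective (hf : IsUnit (fPoly q Q n hs)) {b : ℕ} (hb : b ≤ n) :
    Function.Bijective (leftAction hf hb) := by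
  constructor
  · intro x y h
    have h1 := leftAction_apply hf hb x ⟨_, idem_mem hf hb⟩
    rw [h, leftAction_apply] at h1
    refine (cornerMap_injective hf hb ?_).symm
    rwa [cornerMap_mul_idem, cornerMap_mul_idem] at h1
  · intro f
    obtain ⟨x, hx⟩ := exists_cornerMap_eq hf hb (f ⟨_, idem_mem hf hb⟩ : ArikiKoike q Q n)
    refine ⟨x, LinearMap.ext fun w => Subtype.ext ?_⟩
    have hw : w = MulOpposite.op (w : ArikiKoike q Q n) •
        (⟨_, idem_mem hf hb⟩ : V q Q n hs b) := Subtype.ext (idem_mul_mem hf hb w).symm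
    rw [leftAction_apply, hx, idem_mul_mem hf hb, mul_assoc, idem_mul_mem hf hb]
    conv_rhs => rw [hw, map_smul]
    rfl

/-- Elements of the span are finite sums of products. -/
theorem exists_sum_of_mem_span {A : Type*} [Ring A] [Algebra R A] {e z : A} {X : Set A}
    (hX : ∀ y ∈ X, ∃ a b, y = a * e * b) (hz : z ∈ Submodule.span R X) :
    ∃ (k : ℕ) (f g : Fin k → A), ∑ i, f i * e * g i = z := by
  induction hz using Submodule.span_induction with
  | mem y hy =>
    obtain ⟨a, b, rfl⟩ := hX y hy
    exact ⟨1, fun _ => a, fun _ => b, by simp⟩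
  | zero => exact ⟨0, Fin.elim0, Fin.elim0, by simp⟩
  | add x y _ _ hx hy =>
    obtain ⟨k, f, g, rfl⟩ := hx
    obtain ⟨l, f', g', rfl⟩ := hy
    refine ⟨k + l, Fin.append f f', Fin.append g g', ?_⟩
    rw [Fin.sum_univ_add]
    simp only [Fin.append_left, Fin.append_right]
  | smul c x _ hx =>
    obtain ⟨k, f, g, rfl⟩ := hx
    refine ⟨k, fun i => c • f i, g, ?_⟩
    simp only [smul_mul_assoc, Finset.smul_sum]

theorem cornerMap_mul_mul_cornerMap (hf : IsUnit (fPoly q Q n hs)) {b c : ℕ} (hb : b ≤ n)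
    (hc : c ≤ n) (hbc : c ≠ b) (x : TensorAlg q Q n hs b) (y : TensorAlg q Q n hs c)
    (h : ArikiKoike q Q n) : cornerMap hf hb x * h * cornerMap hf hc y = 0 := by
  rw [← cornerMap_mul_idem hf hb x, ← idem_mul_cornerMap hf hc y, mul_assoc, mul_assoc,
    ← mul_assoc h, ← mul_assoc (idem q Q n hs _ n), ← mul_assoc (idem q Q n hs _ n),
    idem_mul_mul_idem_eq_zero hf hc hb hbc, zero_mul, mul_zero]

variable (q Q n hs) in
/-- The embedding of the direct sum of the algebras `H_b ⊗ H_{n-b}` into `H`. -/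
noncomputable def sumMap (hf : IsUnit (fPoly q Q n hs)) :
    ((b : Fin (n + 1)) → TensorAlg q Q n hs b.val) →ₗ[R] ArikiKoike q Q n :=
  ∑ b : Fin (n + 1), cornerMap hf (Nat.lt_succ_iff.1 b.2) ∘ₗ LinearMap.proj b

theorem sumMap_apply (hf : IsUnit (fPoly q Q n hs))
    (x : (b : Fin (n + 1)) → TensorAlg q Q n hs b.val) : sumMap q Q n hs hf x =
      ∑ b : Fin (n + 1), cornerMap hf (Nat.lt_succ_iff.1 b.2) (x b) := by
  simp [sumMap]

theorem sumMap_mul_mul_sumMap (hf : IsUnit (fPoly q Q n hs))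
    (x y : (b : Fin (n + 1)) → TensorAlg q Q n hs b.val) (h : ArikiKoike q Q n) :
    sumMap q Q n hs hf x * h * sumMap q Q n hs hf y = ∑ b : Fin (n + 1),
      cornerMap hf (Nat.lt_succ_iff.1 b.2) (x b) * h *
        cornerMap hf (Nat.lt_succ_iff.1 b.2) (y b) := by
  rw [sumMap_apply, sumMap_apply, Finset.sum_mul, Finset.sum_mul]
  refine Finset.sum_congr rfl fun b _ => ?_
  rw [Finset.mul_sum, Finset.sum_eq_single b]
  · intro c _ hcb
    exact cornerMap_mul_mul_cornerMap hf _ _ (fun h => hcb (Fin.ext h)) _ _ _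
  · intro h
    exact absurd (Finset.mem_univ b) h

theorem cornerMap_one_mul_sumMap (hf : IsUnit (fPoly q Q n hs))
    (x : (b : Fin (n + 1)) → TensorAlg q Q n hs b.val) (b : Fin (n + 1)) :
    cornerMap hf (Nat.lt_succ_iff.1 b.2) 1 * sumMap q Q n hs hf x =
      cornerMap hf (Nat.lt_succ_iff.1 b.2) (x b) := by
  rw [sumMap_apply, Finset.mul_sum, Finset.sum_eq_single b]
  · rw [← cornerMap_mul, one_mul]
  · intro c _ hcb
    have := cornerMap_mul_mul_cornerMap hf (Nat.lt_succ_iff.1 b.2) (Nat.lt_succ_iff.1 c.2)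
      (fun h => hcb (Fin.ext h)) 1 (x c) 1
    rwa [mul_one] at this
  · intro h
    exact absurd (Finset.mem_univ b) h

theorem exists_fullCorner (hf : IsUnit (fPoly q Q n hs)) :
    Nonempty (FullCorner R (ArikiKoike q Q n)
      ((b : Fin (n + 1)) → TensorAlg q Q n hs b.val)) := by
  have hspan : ∃ (k : ℕ) (f g : Fin k → ArikiKoike q Q n),
      ∑ i, f i * sumMap q Q n hs hf 1 * g i = 1 := by
    refine exists_sum_of_mem_span ?_ (one_mem_span_idem (hs := hs) hf)
    rintro _ ⟨m, hm, x, y, rfl⟩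
    refine ⟨x * idem q Q n hs (baseWord m) n, y, ?_⟩
    have hb : n - m ≤ n := by omega
    have h1 := cornerMap_one_mul_sumMap hf 1 ⟨n - m, by omega⟩
    have h2 : cornerMap hf hb 1 = idem q Q n hs (baseWord m) n := by
      have h3 : n - (n - m) = m := Nat.sub_sub_self hm
      exact (cornerMap_one hf hb).trans (by rw [h3])
    change cornerMap hf hb 1 * _ = cornerMap hf hb 1 at h1
    rw [h2] at h1
    rw [mul_assoc x (idem q Q n hs (baseWord m) n) (sumMap q Q n hs hf 1), h1]
  obtain ⟨k, f, g, hfg⟩ := hspan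
  refine ⟨{ ι := sumMap q Q n hs hf, ι_mul := fun x y => ?_, injective := fun x y hxy => ?_,
            exists_eq := fun h => ?_, size := k, left := f, right := g, sum_eq := hfg }⟩
  · have := sumMap_mul_mul_sumMap hf x y 1
    simp only [mul_one, ← cornerMap_mul] at this
    rw [this, sumMap_apply]
    rfl
  · funext b
    refine cornerMap_injective hf (Nat.lt_succ_iff.1 b.2) ?_
    rw [← cornerMap_one_mul_sumMap, ← cornerMap_one_mul_sumMap, hxy]
  · choose x hx using fun b : Fin (n + 1) => exists_cornerMap_eq hf (Nat.lt_succ_iff.1 b.2) h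
    refine ⟨x, ?_⟩
    rw [sumMap_mul_mul_sumMap, sumMap_apply]
    refine Finset.sum_congr rfl fun b _ => ?_
    rw [hx, Pi.one_apply, cornerMap_one]

end Final

end ArikiKoike

theorem theorem4p7 {R : Type u} [CommRing R] (q : Rˣ) {r : ℕ} (Q : Fin r → R) (n s : ℕ)
    (hs1 : 1 ≤ s) (hs : s ≤ r) (hf : IsUnit (ArikiKoike.fPoly q Q n hs)) :
    (∀ b : ℕ, b ≤ n →
      ∃ ρ : ArikiKoike.TensorAlg q Q n hs b →ₐ[R]
          Module.End (ArikiKoike q Q n)ᵐᵒᵖ (ArikiKoike.V q Q n hs b),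
        ArikiKoike.IsLeftAction q Q n hs b ρ ∧
        Function.Injective ρ ∧
        ∃ e : Module.End (ArikiKoike q Q n)ᵐᵒᵖ (ArikiKoike.V q Q n hs b) ≃ₐ[R]
            ArikiKoike.TensorAlg q Q n hs b,
          ∀ h : ArikiKoike.TensorAlg q Q n hs b, e (ρ h) = h) ∧
    IsMoritaEquivalent R (ArikiKoike q Q n)
      ((b : Fin (n + 1)) → ArikiKoike.TensorAlg q Q n hs b.val) := by
  refine ⟨fun b hb => ⟨ArikiKoike.leftAction hf hb, ArikiKoike.isLeftAction_leftAction hf hb,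
    (ArikiKoike.leftAction_bijective hf hb).1,
    (AlgEquiv.ofBijective _ (ArikiKoike.leftAction_bijective hf hb)).symm,
    fun h => AlgEquiv.ofBijective_symm_apply_apply _ _ h⟩, ?_⟩
  obtain ⟨F⟩ := ArikiKoike.exists_fullCorner hf
  exact F.isMoritaEquivalent
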